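/- For $a>0$ and a probability measure $H$ on $\mathbb R$, a random probability measure $P_{H,a}$ on $\mathbb R$ is a normalized inverse-Gaussian process with parameters $a$ and $H$ if $P_{H,a}(A)=0$ almost surely for every Borel set $A$ with $H(A)=0$, and if for every finite measurable partition $A_1,\dots,A_m$ of $\mathbb R$ with $H(A_i)>0$ for all $i$ the vector $(P_{H,a}(A_1),\dots,P_{H,a}(A_m))$ has the normalized inverse-Gaussian distribution with parameters $\gamma_i=aH(A_i)$, that is, the density (with respect to Lebesgue measure in $z_1,\dots,z_{m-1}$, with $z_m=1-z_1-\dots-z_{m-1}$) $$\frac{e^{\sum_{i=1}^m\gamma_i}\prod_{i=1}^m\gamma_i}{2^{m/2-1}\pi^{m/2}}\,K_{-m/2}\Big(\sqrt{\textstyle\sum_{i=1}^m\gamma_i^2/z_i}\Big)\Big(\sum_{i=1}^m\gamma_i^2/z_i\Big)^{-m/4}\prod_{i=1}^m z_i^{-3/2}$$ on the simplex $z_i>0$, $\sum_i z_i=1$, where $K$ is the modified Bessel function of the third kind. The same letter denotes a probability measure on $\mathbb R$ and its distribution function, and $F^{-1}(t)=\inf\{x:F(x)\ge t\}$ for $0<t<1$.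 Let $0<p<q<1$ and let $H$ be a probability measure on $\mathbb R$ whose distribution function has, on $[H^{-1}(p)-\epsilon,H^{-1}(q)+\epsilon]$ for some $\epsilon>0$, a positive derivative $h$, where $h$ is continuous on $[H^{-1}(p),H^{-1}(q)]$. Let $B_\lambda$ be a standard Brownian bridge on $[0,1]$, that is, a centred Gaussian process with covariance $\min(s,t)-st$ and almost surely continuous paths. Then, as $a\to\infty$ (along any sequence $a_n\to\infty$ of positive numbers), $$Q_{H,a}(\cdot)=\sqrt a\,\big(P_{H,a}^{-1}(\cdot)-H^{-1}(\cdot)\big)\ \xrightarrow{d}\ Q(\cdot)=-\frac{B_\lambda(\cdot)}{h(H^{-1}(\cdot))}$$ in the space $D[p,q]$ of right-continuous functions with left limits, with the Skorokhod topology; here $Q_{H,a}$ has its paths in $D[p,q]$ with a probability that tends to one, and the convergence is that of random elements of $D[p,q]$ which coincide with $Q_{H,a}$ outside events of vanishing probability. The limit $Q$ is a Gaussian process with mean zero and covariance function $$\operatorname{Cov}(Q(s),Q(t))=\frac{\min(s,t)-st}{h(H^{-1}(s))\,h(H^{-1}(t))},\qquad s,t\in[p,q].$$ -/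

import Mathlib

open MeasureTheory ProbabilityTheory Filter Set
open scoped Topology ENNReal

/-! ### Normalized inverse-Gaussian distributions and processes -/

/-- The modified Bessel function of the third kind `K_ν (x)`, for `x > 0`:
`K_ν (x) = (1/2) ∫_0^∞ u^(ν-1) exp (-(x/2) (u + 1/u)) du`. -/
noncomputable def besselK (ν x : ℝ) : ℝ :=
  (1 / 2) * ∫ u in Ioi (0 : ℝ), u ^ (ν - 1) * Real.exp (-(x / 2) * (u + 1 / u))

/-- The density of the normalized inverse-Gaussian distribution with parameters
`γ_0, …, γ_m` (that is, on `m + 1` coordinates), at a point of the open simplex. -/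
noncomputable def nigDensity {m : ℕ} (γ z : Fin (m + 1) → ℝ) : ℝ :=
  Real.exp (∑ i, γ i) * (∏ i, γ i) /
      ((2 : ℝ) ^ (((m + 1 : ℕ) : ℝ) / 2 - 1) * Real.pi ^ (((m + 1 : ℕ) : ℝ) / 2))
    * besselK (-((m + 1 : ℕ) : ℝ) / 2) (Real.sqrt (∑ i, γ i ^ 2 / z i))
    * (∑ i, γ i ^ 2 / z i) ^ (-((m + 1 : ℕ) : ℝ) / 4)
    * ∏ i, z i ^ (-(3 : ℝ) / 2)

/-- The point `(w_0, …, w_{m-1}, 1 - ∑ w_i)` of the hyperplane `∑ z_i = 1`. -/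
noncomputable def simplexPoint {m : ℕ} (w : Fin m → ℝ) : Fin (m + 1) → ℝ :=
  Fin.snoc (α := fun _ => ℝ) w (1 - ∑ i, w i)

open Classical in
/-- The normalized inverse-Gaussian distribution with parameters `γ_0, …, γ_m`: the law on the
simplex whose density, in the first `m` coordinates, is `nigDensity γ`. -/
noncomputable def nigMeasure {m : ℕ} (γ : Fin (m + 1) → ℝ) : Measure (Fin (m + 1) → ℝ) :=
  ((volume : Measure (Fin m → ℝ)).withDensity fun w =>
    ENNReal.ofReal
      (if ∀ i, 0 < simplexPoint w i then nigDensity γ (simplexPoint w) else 0)).map simplexPoint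

/-- `P` is a normalized inverse-Gaussian process with parameters `a` and `H`, on the probability
space `(Ω, μ)`. A random probability measure on `𝓧` is a Markov kernel from `Ω` to `𝓧`.
Sets of `H`-measure zero are almost surely `P`-null, and over every finite measurable partition
into sets of positive `H`-measure the vector of `P`-masses is normalized inverse-Gaussian. -/
structure IsNIGProcess {Ω 𝓧 : Type*} [MeasurableSpace Ω] [MeasurableSpace 𝓧]
    (a : ℝ) (H : Measure 𝓧) (P : Kernel Ω 𝓧) (μ : Measure Ω) : Prop where
  null : ∀ A : Set 𝓧, MeasurableSet A → H A = 0 → ∀ᵐ ω ∂μ, P ω A = 0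
  law : ∀ (m : ℕ) (A : Fin (m + 1) → Set 𝓧), (∀ i, MeasurableSet (A i)) →
    Pairwise (fun i j => Disjoint (A i) (A j)) → (⋃ i, A i) = univ → (∀ i, H (A i) ≠ 0) →
    μ.map (fun ω i => (P ω).real (A i)) = nigMeasure fun i => a * H.real (A i)

/-! ### Brownian bridge and quantile function -/

/-- A family `(B i)` indexed by sets `S i` is a Brownian bridge with parameter measure `H`: a
centred Gaussian process with `Cov (B i, B j) = H (S i ∩ S j) - H (S i) H (S j)`. -/
structure IsBrownianBridge {Ω 𝓧 ι : Type*} [MeasurableSpace Ω] [MeasurableSpace 𝓧]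
    (H : Measure 𝓧) (S : ι → Set 𝓧) (B : ι → Ω → ℝ) (μ : Measure Ω) : Prop where
  gaussian : IsGaussianProcess B μ
  mean : ∀ i, ∫ ω, B i ω ∂μ = 0
  covariance : ∀ i j, cov[B i, B j; μ] = H.real (S i ∩ S j) - H.real (S i) * H.real (S j)

/-- The quantile function of a probability measure on `ℝ`,
`F⁻¹ (t) = inf {x | F (x) ≥ t}`, for `0 < t < 1`. -/
noncomputable def quantile (m : Measure ℝ) (t : ℝ) : ℝ := sInf {x : ℝ | t ≤ cdf m x}

/-! ### The Skorokhod space `D[p, q]` -/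

/-- The space `D[p, q]` of right-continuous functions on `[p, q]` with left limits. -/
def SkorokhodSpace (p q : ℝ) : Type :=
  {f : Icc p q → ℝ // ∀ t, ContinuousWithinAt f (Ici t) t ∧ ∃ l, Tendsto f (𝓝[<] t) (𝓝 l)}

namespace SkorokhodSpace

variable {p q : ℝ}

instance : CoeFun (SkorokhodSpace p q) (fun _ => Icc p q → ℝ) := ⟨Subtype.val⟩

/-- The cost of matching `x` with `y` through the time change `e`. -/
noncomputable def cost (e : Icc p q ≃o Icc p q) (x y : SkorokhodSpace p q) : ℝ≥0∞ :=
  max (⨆ t, edist (e t) t) (⨆ t, edist (x t) (y (e t)))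

lemma cost_refl (x : SkorokhodSpace p q) : cost (OrderIso.refl _) x x = 0 := by
  simp [cost]

lemma cost_symm (e : Icc p q ≃o Icc p q) (x y : SkorokhodSpace p q) :
    cost e.symm y x ≤ cost e x y := by
  refine max_le_max (iSup_le fun t => ?_) (iSup_le fun t => ?_)
  · refine le_iSup_of_le (e.symm t) ?_
    rw [e.apply_symm_apply, edist_comm]
  · refine le_iSup_of_le (e.symm t) ?_
    rw [e.apply_symm_apply, edist_comm]

lemma cost_trans (e f : Icc p q ≃o Icc p q) (x y z : SkorokhodSpace p q) :
    cost (e.trans f) x z ≤ cost e x y + cost f y z := by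
  refine max_le (iSup_le fun t => ?_) (iSup_le fun t => ?_)
  · calc edist (f (e t)) t ≤ edist (e t) t + edist (f (e t)) (e t) := by
          rw [add_comm]; exact edist_triangle _ _ _
      _ ≤ _ := add_le_add
          ((le_iSup (fun s => edist (e s) s) t).trans (le_max_left _ _))
          ((le_iSup (fun s => edist (f s) s) (e t)).trans (le_max_left _ _))
  · calc edist (x t) (z (f (e t))) ≤ edist (x t) (y (e t)) + edist (y (e t)) (z (f (e t))) :=
          edist_triangle _ _ _
      _ ≤ _ := add_le_add
          ((le_iSup (fun s => edist (x s) (y (e s))) t).trans (le_max_right _ _))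
          ((le_iSup (fun s => edist (y s) (z (f s))) (e t)).trans (le_max_right _ _))

/-- The Skorokhod metric: the infimum, over the increasing bijections `e` of `[p, q]`, of
`max (sup |e t - t|) (sup |x t - y (e t)|)`. It induces the Skorokhod (J1) topology. -/
noncomputable instance : PseudoEMetricSpace (SkorokhodSpace p q) where
  edist x y := ⨅ e : Icc p q ≃o Icc p q, cost e x y
  edist_self x := le_antisymm ((iInf_le _ (OrderIso.refl _)).trans (cost_refl x).le) bot_le
  edist_comm x y := le_antisymm
    (le_iInf fun e => (iInf_le _ e.symm).trans (cost_symm e y x))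
    (le_iInf fun e => (iInf_le _ e.symm).trans (cost_symm e x y))
  edist_triangle x y z := by
    simp only [ENNReal.iInf_add, ENNReal.add_iInf]
    exact le_iInf fun e => le_iInf fun f => (iInf_le _ (f.trans e)).trans (cost_trans f e x y z)

noncomputable instance : MeasurableSpace (SkorokhodSpace p q) := borel _

instance : BorelSpace (SkorokhodSpace p q) := ⟨rfl⟩

end SkorokhodSpace

/-- The processes `X n` with time set `[p, q]` converge in distribution, in `D[p, q]` with the
Skorokhod topology, to the process `Z`. The paths of `X n` need to be in `D[p, q]` only with a
probability that tends to one, and those of `Z` almost surely: up to such events, `X n` and `Z` are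
random elements `Y n` and `W` of `D[p, q]`, and `Y n` converges in distribution to `W`.
(Events of vanishing probability do not affect convergence in distribution, so the choice
of `Y n` is immaterial.) -/
def ConvergesInDistributionInD {p q : ℝ} {Ω : ℕ → Type*} {Ω' : Type*}
    [∀ n, MeasurableSpace (Ω n)] [MeasurableSpace Ω']
    (X : ∀ n, Icc p q → Ω n → ℝ) (Z : Icc p q → Ω' → ℝ)
    (μ : ∀ n, Measure (Ω n)) [∀ n, IsProbabilityMeasure (μ n)]
    (ν : Measure Ω') [IsProbabilityMeasure ν] : Prop :=
  ∃ (Y : ∀ n, Ω n → SkorokhodSpace p q) (W : Ω' → SkorokhodSpace p q),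
    Tendsto (fun n => μ n {ω | ¬ ∀ t, Y n ω t = X n t ω}) atTop (𝓝 0) ∧
    (∀ᵐ ω ∂ν, ∀ t, W ω t = Z t ω) ∧
    TendstoInDistribution Y atTop W μ ν

/-! Put `g = quantile H` and `D u = √a (P (Iic (g u)) - u)`, the centred and rescaled random
distribution function read in the scale of `H`. The proof shows that `D` is asymptotically a
Brownian bridge and that the quantile process is uniformly close to `-D / (h ∘ g)`.

A normalized inverse-Gaussian vector is a vector of independent inverse Gaussian variables divided
by their sum (`nigMeasure_eq_map_pi_invGauss`): in the coordinates (total, point of the simplex),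
integrating out the total produces the Bessel function. Hence `D` on a finite grid is a function of
independent variables with explicit density and Laplace transform, and this has two consequences.
First, the densities of the rescaled variables converge pointwise to Gaussian ones, while
normalization becomes linear in the limit; Fatou's lemma then gives the finite-dimensional limits
(`tendstoInDistribution_nig_grid`). Second, Doob's inequality for exponential functionals gives
maximal inequalities whose constants do not depend on the grid. Monotonicity of distribution
functions extends them to whole intervals, and a union bound over short blocks gives asymptotic
equicontinuity (`exists_eventually_measure_osc_le`).

The passage to quantiles is deterministic. If `D` is bounded and oscillates little, the quantile of
`P` at `t` is `g R` with `√a (R - t)` close to `-D t` (`quantile_inversion`). As `g` is continuously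
differentiable on `[p, q]` with derivative `1 / (h ∘ g)`, a uniform first-order expansion finishes
the comparison (`abs_quantileProcess_add_le`).

The limit has continuous paths almost surely, and the quantile path of `P` is itself continuous with
probability tending to one, because `P` almost surely charges the relevant rational intervals.
Convergence can therefore be proved in the separable metric space `C[p, q]`
(`tendstoInDistribution_continuousMap`) and carried to `D[p, q]` by the continuous inclusion. -/

/-! ### The inverse Gaussian distribution: total mass and Laplace transform. -/

/-- The unnormalized standard normal distribution function, centred at `0`. -/
noncomputable def gaussPrimitive (x : ℝ) : ℝ := ∫ t in (0:ℝ)..x, Real.exp (-t ^ 2 / 2)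

lemma hasDerivAt_gaussPrimitive (x : ℝ) :
    HasDerivAt gaussPrimitive (Real.exp (-x ^ 2 / 2)) x := by
  have hc : Continuous fun t : ℝ => Real.exp (-t ^ 2 / 2) := by fun_prop
  exact intervalIntegral.integral_hasDerivAt_right (hc.intervalIntegrable _ _)
    (hc.stronglyMeasurableAtFilter _ _) hc.continuousAt

lemma gaussPrimitive_neg (x : ℝ) : gaussPrimitive (-x) = -gaussPrimitive x := by
  unfold gaussPrimitive
  have := intervalIntegral.integral_comp_neg (a := (0:ℝ)) (b := x)
    (fun t : ℝ => Real.exp (-t ^ 2 / 2))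
  simp only [neg_sq, neg_zero] at this
  rw [this, intervalIntegral.integral_symm]

lemma tendsto_gaussPrimitive_atTop :
    Tendsto gaussPrimitive atTop (𝓝 (Real.sqrt (2 * Real.pi) / 2)) := by
  have h1 : IntegrableOn (fun t : ℝ => Real.exp (-t ^ 2 / 2)) (Ioi 0) := by
    have := (integrable_exp_neg_mul_sq (b := 1 / 2) (by norm_num)).integrableOn (s := Ioi (0:ℝ))
    refine this.congr_fun (fun t _ => ?_) measurableSet_Ioi
    ring_nf
  have h2 : ∫ t in Ioi (0:ℝ), Real.exp (-t ^ 2 / 2) = Real.sqrt (2 * Real.pi) / 2 := by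
    have := integral_gaussian_Ioi (1 / 2)
    rw [show Real.pi / (1 / 2) = 2 * Real.pi by ring] at this
    rw [← this]
    refine setIntegral_congr_fun measurableSet_Ioi (fun t _ => ?_)
    ring_nf
  rw [← h2]
  exact intervalIntegral_tendsto_integral_Ioi 0 h1 tendsto_id

lemma tendsto_gaussPrimitive_atBot :
    Tendsto gaussPrimitive atBot (𝓝 (-(Real.sqrt (2 * Real.pi) / 2))) := by
  have := (tendsto_gaussPrimitive_atTop.comp tendsto_neg_atBot_atTop).neg
  refine this.congr fun x => ?_
  simp [gaussPrimitive_neg]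

/-- The density of the inverse Gaussian distribution: the first passage time at level `α` of a
Brownian motion with drift `c`. -/
noncomputable def invGaussPDF (α c v : ℝ) : ℝ :=
  if 0 < v then
    α / Real.sqrt (2 * Real.pi) * v ^ (-(3 : ℝ) / 2) * Real.exp (-(c * v - α) ^ 2 / (2 * v))
  else 0

lemma measurable_invGaussPDF (α c : ℝ) : Measurable (invGaussPDF α c) := by
  unfold invGaussPDF
  refine Measurable.ite measurableSet_Ioi ?_ measurable_const
  fun_prop

lemma invGaussPDF_nonneg {α : ℝ} (hα : 0 ≤ α) (c v : ℝ) : 0 ≤ invGaussPDF α c v := by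
  unfold invGaussPDF
  split_ifs <;> positivity

/-- This is the classical first-passage distribution function, up to constants. The factor `exp
(2αc)` makes the two Gaussian exponentials equal; after that the drift terms of the inner
derivatives cancel and the level terms add up. -/
lemma hasDerivAt_invGaussPDF_primitive (α c : ℝ) {v : ℝ} (hv : 0 < v) :
    HasDerivAt (fun v => gaussPrimitive (c * Real.sqrt v - α / Real.sqrt v) +
      Real.exp (2 * α * c) * gaussPrimitive (-(c * Real.sqrt v + α / Real.sqrt v)))
      (Real.sqrt (2 * Real.pi) * invGaussPDF α c v) v := by
  have hs : 0 < Real.sqrt v := Real.sqrt_pos.2 hv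
  have h1 := Real.hasDerivAt_sqrt hv.ne'
  have h2 := (h1.const_mul c)
  have h3 := (h1.fun_inv hs.ne').const_mul α
  have h4 := (hasDerivAt_gaussPrimitive _).comp v (h2.sub h3)
  have h5 := ((hasDerivAt_gaussPrimitive _).comp v ((h2.add h3).neg)).const_mul
    (Real.exp (2 * α * c))
  refine ((h4.add h5).congr_deriv ?_)
  have hv' : v = Real.sqrt v ^ 2 := (Real.sq_sqrt hv.le).symm
  have hpow : v ^ (-(3 : ℝ) / 2) = (Real.sqrt v ^ 3)⁻¹ := by
    rw [Real.sqrt_eq_rpow, ← Real.rpow_natCast, ← Real.rpow_mul hv.le, ← Real.rpow_neg hv.le]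
    norm_num
  have hsp : Real.sqrt (2 * Real.pi) ≠ 0 := by positivity
  simp only [invGaussPDF, if_pos hv, hpow]
  set s := Real.sqrt v with hsdef
  simp only [Pi.add_apply, Pi.sub_apply, Pi.neg_apply, ← hsdef]
  have e1 : Real.exp (2 * α * c) * (Real.exp (-(-(c * s + α * s⁻¹)) ^ 2 / 2)) =
      Real.exp (-(c * s - α * s⁻¹) ^ 2 / 2) := by
    rw [← Real.exp_add]
    congr 1
    field_simp
    ring
  have e2 : Real.exp (-(c * v - α) ^ 2 / (2 * v)) = Real.exp (-(c * s - α * s⁻¹) ^ 2 / 2) := by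
    congr 1
    rw [hv']
    field_simp
  rw [← mul_assoc, e1, e2]
  field_simp
  ring

lemma lintegral_invGaussPDF {α c : ℝ} (hα : 0 < α) (hc : 0 < c) :
    ∫⁻ v, ENNReal.ofReal (invGaussPDF α c v) = 1 := by
  set F : ℝ → ℝ := fun v => gaussPrimitive (c * Real.sqrt v - α / Real.sqrt v) +
      Real.exp (2 * α * c) * gaussPrimitive (-(c * Real.sqrt v + α / Real.sqrt v)) with hF
  set S := Real.sqrt (2 * Real.pi) with hS
  have hSpos : 0 < S := by positivity
  set l0 : ℝ := -(S / 2) + Real.exp (2 * α * c) * -(S / 2)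
  set l1 : ℝ := S / 2 + Real.exp (2 * α * c) * -(S / 2)
  have hsq0 : Tendsto Real.sqrt (𝓝[>] 0) (𝓝[>] 0) := by
    refine tendsto_nhdsWithin_iff.2 ⟨?_, ?_⟩
    · have := Real.continuous_sqrt.tendsto 0
      rw [Real.sqrt_zero] at this
      exact this.mono_left nhdsWithin_le_nhds
    · filter_upwards [self_mem_nhdsWithin] with v hv using Real.sqrt_pos.2 hv
  have hdiv0 : Tendsto (fun v => α / Real.sqrt v) (𝓝[>] 0) atTop := by
    simp only [div_eq_mul_inv]
    exact Tendsto.const_mul_atTop hα (tendsto_inv_nhdsGT_zero.comp hsq0)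
  have hc0 : Tendsto (fun v => c * Real.sqrt v) (𝓝[>] 0) (𝓝 0) := by
    have := (hsq0.mono_right nhdsWithin_le_nhds).const_mul c
    rwa [mul_zero] at this
  have hc1 : Tendsto (fun v => c * Real.sqrt v) atTop atTop :=
    Tendsto.const_mul_atTop hc Real.tendsto_sqrt_atTop
  have hdiv1 : Tendsto (fun v => α / Real.sqrt v) atTop (𝓝 0) :=
    Tendsto.div_atTop tendsto_const_nhds Real.tendsto_sqrt_atTop
  have hF0 : Tendsto F (𝓝[>] 0) (𝓝 l0) := by
    refine (tendsto_gaussPrimitive_atBot.comp ?_).add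
      ((tendsto_gaussPrimitive_atBot.comp ?_).const_mul _)
    · simp only [sub_eq_add_neg]
      exact hc0.add_atBot (tendsto_neg_atTop_atBot.comp hdiv0)
    · exact tendsto_neg_atTop_atBot.comp (hc0.add_atTop hdiv0)
  have hF1 : Tendsto F atTop (𝓝 l1) := by
    refine (tendsto_gaussPrimitive_atTop.comp ?_).add
      ((tendsto_gaussPrimitive_atBot.comp ?_).const_mul _)
    · simp only [sub_eq_add_neg]
      have := hdiv1.neg
      exact hc1.atTop_add this
    · exact tendsto_neg_atTop_atBot.comp (hc1.atTop_add hdiv1)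
  -- With division by zero, `F 0 = 0`, which is not the right limit of `F` at `0`; the value is
  -- corrected to make the primitive continuous on `[0, ∞)`.
  set G : ℝ → ℝ := Function.update F 0 l0
  have hGF : ∀ v : ℝ, 0 < v → G =ᶠ[𝓝 v] F := fun v hv => by
    filter_upwards [isOpen_Ioi.mem_nhds hv] with y hy
    exact Function.update_of_ne (ne_of_gt hy) _ _
  have hG0 : ContinuousWithinAt G (Ici 0) 0 := by
    rw [continuousWithinAt_update_same]
    simpa [Ici_sdiff_left] using hF0
  have hGd : ∀ v ∈ Ioi (0:ℝ), HasDerivAt G (S * invGaussPDF α c v) v := fun v hv =>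
    (hasDerivAt_invGaussPDF_primitive α c hv).congr_of_eventuallyEq (hGF v hv)
  have hG1 : Tendsto G atTop (𝓝 l1) := by
    refine hF1.congr' ?_
    filter_upwards [eventually_gt_atTop 0] with v hv
    exact ((Function.update_of_ne (ne_of_gt hv) _ _)).symm
  have hnn : ∀ v ∈ Ioi (0:ℝ), 0 ≤ S * invGaussPDF α c v := fun v _ =>
    mul_nonneg hSpos.le (invGaussPDF_nonneg hα.le c v)
  have hint := integral_Ioi_of_hasDerivAt_of_nonneg hG0 hGd hnn hG1
  have hio := integrableOn_Ioi_deriv_of_nonneg hG0 hGd hnn hG1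
  rw [integral_const_mul] at hint
  have hio' : IntegrableOn (invGaussPDF α c) (Ioi 0) := by
    have := hio.const_mul S⁻¹
    simp only [← mul_assoc, inv_mul_cancel₀ hSpos.ne', one_mul] at this
    exact this
  have hval : ∫ v in Ioi (0:ℝ), invGaussPDF α c v = 1 := by
    have : G 0 = l0 := Function.update_self _ _ _
    rw [this] at hint
    -- The term carrying `exp (2αc)` has the same limit at `0` and at infinity, so only the first
    -- one contributes.
    have h2 : l1 - l0 = S := by simp only [l1, l0]; ring
    rw [h2] at hint
    exact (mul_eq_left₀ hSpos.ne').1 hint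
  have : ∫⁻ v, ENNReal.ofReal (invGaussPDF α c v) =
      ∫⁻ v in Ioi (0:ℝ), ENNReal.ofReal (invGaussPDF α c v) := by
    rw [← lintegral_indicator measurableSet_Ioi]
    refine lintegral_congr fun v => ?_
    by_cases hv : 0 < v
    · simp [hv]
    · simp [hv, invGaussPDF]
  rw [this, ← ofReal_integral_eq_lintegral_ofReal hio'
    (Eventually.of_forall fun v => invGaussPDF_nonneg hα.le c v), hval, ENNReal.ofReal_one]

/-- The inverse Gaussian distribution with parameters `α` and `1`. -/
noncomputable def invGauss (α : ℝ) : Measure ℝ :=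
  volume.withDensity fun v => ENNReal.ofReal (invGaussPDF α 1 v)

lemma isProbabilityMeasure_invGauss {α : ℝ} (hα : 0 < α) : IsProbabilityMeasure (invGauss α) :=
  ⟨by rw [invGauss, withDensity_apply _ MeasurableSet.univ, setLIntegral_univ,
    lintegral_invGaussPDF hα one_pos]⟩

/-- Completing the square: exponential tilting only changes the drift from `1` to `√(1 - 2θ)`. Since
the tilted density also has mass one, the constant in front is the Laplace transform. -/
lemma exp_mul_invGaussPDF {α θ : ℝ} (hθ : θ < 1 / 2) (v : ℝ) :
    Real.exp (θ * v) * invGaussPDF α 1 v =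
      Real.exp (α * (1 - Real.sqrt (1 - 2 * θ))) * invGaussPDF α (Real.sqrt (1 - 2 * θ)) v := by
  unfold invGaussPDF
  split_ifs with hv
  · set c := Real.sqrt (1 - 2 * θ)
    have hc : c ^ 2 = 1 - 2 * θ := Real.sq_sqrt (by linarith)
    have : Real.exp (θ * v) * Real.exp (-(1 * v - α) ^ 2 / (2 * v)) =
        Real.exp (α * (1 - c)) * Real.exp (-(c * v - α) ^ 2 / (2 * v)) := by
      rw [← Real.exp_add, ← Real.exp_add]
      congr 1
      field_simp
      linear_combination v ^ 2 * hc
    linear_combination (α / Real.sqrt (2 * Real.pi) * v ^ (-(3 : ℝ) / 2)) * this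
  · simp

lemma lintegral_exp_mul_invGauss {α θ : ℝ} (hα : 0 < α) (hθ : θ < 1 / 2) :
    ∫⁻ v, ENNReal.ofReal (Real.exp (θ * v)) ∂(invGauss α) =
      ENNReal.ofReal (Real.exp (α * (1 - Real.sqrt (1 - 2 * θ)))) := by
  have hm : Measurable fun v => ENNReal.ofReal (invGaussPDF α 1 v) :=
    (measurable_invGaussPDF α 1).ennreal_ofReal
  rw [invGauss, lintegral_withDensity_eq_lintegral_mul _ hm (by fun_prop)]
  have : ∀ v, ((fun v => ENNReal.ofReal (invGaussPDF α 1 v)) *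
      fun v => ENNReal.ofReal (Real.exp (θ * v))) v =
      ENNReal.ofReal (Real.exp (α * (1 - Real.sqrt (1 - 2 * θ)))) *
        ENNReal.ofReal (invGaussPDF α (Real.sqrt (1 - 2 * θ)) v) := fun v => by
    rw [Pi.mul_apply, ← ENNReal.ofReal_mul (Real.exp_nonneg _), ← exp_mul_invGaussPDF hθ,
      ← ENNReal.ofReal_mul (invGaussPDF_nonneg hα.le _ _), mul_comm]
  simp_rw [this]
  rw [lintegral_const_mul _ (measurable_invGaussPDF _ _).ennreal_ofReal,
    lintegral_invGaussPDF hα (Real.sqrt_pos.2 (by linarith)), mul_one]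

lemma ae_pos_invGauss (α : ℝ) : ∀ᵐ v ∂(invGauss α), 0 < v := by
  rw [invGauss, ae_withDensity_iff (measurable_invGaussPDF α 1).ennreal_ofReal]
  refine Eventually.of_forall fun v hv => ?_
  by_contra h
  exact hv (by simp [invGaussPDF, h])


/-! ### Normalized inverse-Gaussian laws from independent inverse Gaussian variables. -/

lemma lintegral_pi_fin_prod {n : ℕ} {X : Type*} [MeasurableSpace X]
    (μ : Fin n → Measure X) [∀ i, SigmaFinite (μ i)] {f : Fin n → X → ℝ≥0∞}
    (hf : ∀ i, Measurable (f i)) :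
    ∫⁻ x, ∏ i, f i (x i) ∂(Measure.pi μ) = ∏ i, ∫⁻ x, f i x ∂(μ i) := by
  induction n with
  | zero => simp
  | succ n ih =>
    have hmp := (measurePreserving_piFinSuccAbove (α := fun _ => X) μ 0).symm
    have hm : Measurable fun x : Fin (n + 1) → X => ∏ i, f i (x i) :=
      Finset.measurable_prod _ fun i _ => (hf i).comp (measurable_pi_apply i)
    rw [← hmp.lintegral_comp hm]
    have he : ∀ p : X × (Fin n → X),
        ∏ i, f i ((MeasurableEquiv.piFinSuccAbove (fun _ => X) 0).symm p i) =
          f 0 p.1 * ∏ i : Fin n, f i.succ (p.2 i) := fun p => by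
      rw [Fin.prod_univ_succ]
      rfl
    rw [lintegral_congr he, Fin.prod_univ_succ]
    have hm' : Measurable fun x : Fin n → X => ∏ i, f i.succ (x i) :=
      Finset.measurable_prod _ fun i _ => (hf i.succ).comp (measurable_pi_apply i)
    rw [← ih _ fun i => hf i.succ]
    exact lintegral_prod_mul (hf 0).aemeasurable hm'.aemeasurable

lemma pi_withDensity_fin {n : ℕ} {X : Type*} [MeasurableSpace X]
    (μ : Fin n → Measure X) [∀ i, SigmaFinite (μ i)] {f : Fin n → X → ℝ≥0∞}
    (hf : ∀ i, Measurable (f i)) [∀ i, SigmaFinite ((μ i).withDensity (f i))] :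
    Measure.pi (fun i => (μ i).withDensity (f i)) =
      (Measure.pi μ).withDensity fun x => ∏ i, f i (x i) := by
  refine Measure.pi_eq fun s hs => ?_
  rw [withDensity_apply _ (MeasurableSet.univ_pi hs), Measure.restrict_pi_pi,
    lintegral_pi_fin_prod _ hf]
  exact Finset.prod_congr rfl fun i _ => (withDensity_apply _ (hs i)).symm

lemma sum_simplexPoint {m : ℕ} (w : Fin m → ℝ) : ∑ i, simplexPoint w i = 1 := by
  simp [simplexPoint, Fin.sum_univ_castSucc]

lemma measurable_snoc {m : ℕ} :
    Measurable fun p : (Fin m → ℝ) × ℝ => (Fin.snoc (α := fun _ => ℝ) p.1 p.2 : Fin (m + 1) → ℝ) := by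
  refine measurable_pi_iff.2 fun i => ?_
  refine Fin.lastCases ?_ (fun j => ?_) i
  · simpa using! measurable_snd
  · simpa using! (measurable_pi_apply j).comp measurable_fst

lemma measurable_simplexPoint {m : ℕ} : Measurable (simplexPoint (m := m)) :=
  measurable_snoc.comp (measurable_id.prodMk (by fun_prop))

/-- Integration over `ℝ^(m+1)` in the coordinates `v = s • z`, where `z` is in the hyperplane
`∑ z_i = 1`. -/
lemma lintegral_eq_lintegral_simplexPoint {m : ℕ} {G : (Fin (m + 1) → ℝ) → ℝ≥0∞}
    (hG : Measurable G) (hG0 : ∀ v, ∑ i, v i ≤ 0 → G v = 0) :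
    ∫⁻ v, G v = ∫⁻ w : Fin m → ℝ, ∫⁻ s in Ioi (0 : ℝ),
      ENNReal.ofReal (s ^ m) * G (s • simplexPoint w) := by
  have hmp := (volume_preserving_piFinSuccAbove (fun _ : Fin (m + 1) => ℝ) (Fin.last m)).symm
  have hsw : Measurable fun p : (Fin m → ℝ) × ℝ =>
      G (Fin.snoc (α := fun _ => ℝ) p.1 (p.2 - ∑ i, p.1 i)) :=
    hG.comp (measurable_snoc.comp (measurable_fst.prodMk (by fun_prop)))
  have hsw2 : Measurable fun p : (Fin m → ℝ) × ℝ => G (p.2 • simplexPoint p.1) :=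
    hG.comp (measurable_snd.smul (measurable_simplexPoint.comp measurable_fst))
  calc ∫⁻ v, G v
      = ∫⁻ p : ℝ × (Fin m → ℝ), G (Fin.snoc (α := fun _ => ℝ) p.2 p.1) := by
        rw [← hmp.lintegral_comp hG]
        refine lintegral_congr fun p => ?_
        congr 1
        simp [MeasurableEquiv.piFinSuccAbove]
        rfl
    _ = ∫⁻ x : Fin m → ℝ, ∫⁻ y : ℝ, G (Fin.snoc (α := fun _ => ℝ) x y) := by
        have : Measurable fun p : ℝ × (Fin m → ℝ) => G (Fin.snoc (α := fun _ => ℝ) p.2 p.1) :=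
          hG.comp (measurable_snoc.comp measurable_swap)
        rw [Measure.volume_eq_prod, lintegral_prod_symm _ this.aemeasurable]
    _ = ∫⁻ x : Fin m → ℝ, ∫⁻ s : ℝ, G (Fin.snoc (α := fun _ => ℝ) x (s - ∑ i, x i)) := by
        -- Translating the last coordinate turns it into the total `s` of all coordinates.
        refine lintegral_congr fun x => ?_
        exact (lintegral_sub_right_eq_self (fun y => G (Fin.snoc (α := fun _ => ℝ) x y)) _).symm
    _ = ∫⁻ s : ℝ, ∫⁻ x : Fin m → ℝ, G (Fin.snoc (α := fun _ => ℝ) x (s - ∑ i, x i)) :=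
        lintegral_lintegral_swap hsw.aemeasurable
    _ = ∫⁻ s in Ioi (0 : ℝ), ∫⁻ x : Fin m → ℝ,
          G (Fin.snoc (α := fun _ => ℝ) x (s - ∑ i, x i)) := by
        rw [← lintegral_indicator measurableSet_Ioi]
        refine lintegral_congr fun s => ?_
        by_cases hs : 0 < s
        · simp [hs]
        · rw [indicator_of_notMem (by simpa using hs)]
          rw [← lintegral_zero (μ := (volume : Measure (Fin m → ℝ)))]
          refine lintegral_congr fun x => hG0 _ ?_
          simpa [Fin.sum_univ_castSucc] using hs
    _ = ∫⁻ s in Ioi (0 : ℝ), ∫⁻ w : Fin m → ℝ,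
          ENNReal.ofReal (s ^ m) * G (s • simplexPoint w) := by
        refine setLIntegral_congr_fun measurableSet_Ioi fun s hs => ?_
        have hs : 0 < s := hs
        -- For a fixed total `s`, dilating the `m` free coordinates by `s` gives the Jacobian `s ^
        -- m`.
        have hmap := Measure.map_addHaar_smul (volume : Measure (Fin m → ℝ)) hs.ne'
        have hg : Measurable fun x : Fin m → ℝ =>
            G (Fin.snoc (α := fun _ => ℝ) x (s - ∑ i, x i)) :=
          hsw.comp (measurable_id.prodMk measurable_const)
        have h1 := lintegral_map (μ := (volume : Measure (Fin m → ℝ))) hg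
          (measurable_const_smul s)
        rw [hmap, lintegral_smul_measure] at h1
        have h2 : ∀ w : Fin m → ℝ, (Fin.snoc (α := fun _ => ℝ) (s • w)
            (s - ∑ i, (s • w) i) : Fin (m + 1) → ℝ) = s • simplexPoint w := fun w => by
          ext i
          refine Fin.lastCases ?_ (fun j => ?_) i
          · simp [simplexPoint, ← Finset.mul_sum, mul_sub]
          · simp [simplexPoint]
        simp_rw [h2] at h1
        rw [lintegral_const_mul' _ _ ENNReal.ofReal_ne_top, ← h1, smul_eq_mul, ← mul_assoc,
          ← ENNReal.ofReal_mul (by positivity)]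
        have : s ^ m * |(s ^ Module.finrank ℝ (Fin m → ℝ))⁻¹| = 1 := by
          rw [Module.finrank_fin_fun, abs_of_pos (by positivity)]
          field_simp
        rw [this, ENNReal.ofReal_one, one_mul]
    _ = _ := by
        refine lintegral_lintegral_swap ?_
        refine Measurable.aemeasurable ?_
        exact (by fun_prop : Measurable fun p : ℝ × (Fin m → ℝ) => ENNReal.ofReal (p.1 ^ m)).mul
          (hsw2.comp measurable_swap)

/-- For `u ≥ 1` the power is at most one because `ν ≤ 1`. For `u ≤ 1` it is at most `u ^ (-N)`,
which `exp (-x / (2u))` absorbs through `y ^ N / N! ≤ exp y`. The factor `exp (-x u / 2)` remains as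
an integrable majorant. -/
lemma integrableOn_besselK_integrand {ν x : ℝ} (hν : ν ≤ 1) (hx : 0 < x) :
    IntegrableOn (fun u : ℝ => u ^ (ν - 1) * Real.exp (-(x / 2) * (u + 1 / u))) (Ioi 0) := by
  obtain ⟨N, hN⟩ := exists_nat_ge (1 - ν)
  have hdom : IntegrableOn (fun u : ℝ => (1 + (2 / x) ^ N * N.factorial) *
      Real.exp (-(x / 2) * u)) (Ioi 0) :=
    (exp_neg_integrableOn_Ioi 0 (by positivity)).const_mul _
  refine Integrable.mono' hdom (by fun_prop) ?_
  filter_upwards [ae_restrict_mem measurableSet_Ioi] with u hu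
  have hu : 0 < u := hu
  have hfac : (0 : ℝ) < (2 / x) ^ N * N.factorial := by positivity
  have key : u ^ (ν - 1) * Real.exp (-(x / 2 / u)) ≤ 1 + (2 / x) ^ N * N.factorial := by
    rcases le_total 1 u with h1 | h1
    · have h2 : u ^ (ν - 1) ≤ 1 := Real.rpow_le_one_of_one_le_of_nonpos h1 (by linarith)
      have h3 : Real.exp (-(x / 2 / u)) ≤ 1 := Real.exp_le_one_iff.2 (by
        have : 0 < x / 2 / u := by positivity
        linarith)
      nlinarith [mul_le_one₀ h2 (Real.exp_nonneg _) h3]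
    · have h2 : u ^ (ν - 1) ≤ u ^ (-(N : ℝ)) :=
        Real.rpow_le_rpow_of_exponent_ge hu h1 (by linarith)
      rw [Real.rpow_neg hu.le, Real.rpow_natCast] at h2
      have h3 := Real.pow_div_factorial_le_exp (x / 2 / u) (by positivity) N
      have h4 : (u ^ N)⁻¹ = (2 / x) ^ N * N.factorial * ((x / 2 / u) ^ N / N.factorial) := by
        have : (N.factorial : ℝ) ≠ 0 := by positivity
        rw [div_pow, div_pow, div_pow]
        field_simp
      calc u ^ (ν - 1) * Real.exp (-(x / 2 / u))
          ≤ (u ^ N)⁻¹ * Real.exp (-(x / 2 / u)) := by gcongr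
        _ ≤ (2 / x) ^ N * N.factorial * Real.exp (x / 2 / u) * Real.exp (-(x / 2 / u)) := by
            rw [h4]; gcongr
        _ = (2 / x) ^ N * N.factorial := by
            rw [mul_assoc, ← Real.exp_add]; simp
        _ ≤ _ := by linarith
  rw [Real.norm_of_nonneg (by positivity),
    show -(x / 2) * (u + 1 / u) = -(x / 2 / u) + -(x / 2) * u by ring, Real.exp_add, ← mul_assoc]
  gcongr

/-- The substitution `s = √A u` makes the exponent symmetric under `u ↦ 1 / u`, as in the definition
of the Bessel function. -/
lemma lintegral_besselK {ν A : ℝ} (hν : ν ≤ 1) (hA : 0 < A) :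
    ∫⁻ s in Ioi (0 : ℝ), ENNReal.ofReal (s ^ (ν - 1) * Real.exp (-(s + A / s) / 2)) =
      ENNReal.ofReal (2 * besselK ν (Real.sqrt A) * A ^ (ν / 2)) := by
  set c := Real.sqrt A with hc
  have hc0 : 0 < c := Real.sqrt_pos.2 hA
  have hcA : c ^ 2 = A := Real.sq_sqrt hA.le
  set g : ℝ → ℝ := fun s => s ^ (ν - 1) * Real.exp (-(s + A / s) / 2) with hg
  have hcomp : ∀ u ∈ Ioi (0 : ℝ), g (c * u) =
      c ^ (ν - 1) * (u ^ (ν - 1) * Real.exp (-(c / 2) * (u + 1 / u))) := by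
    intro u hu
    have hu : 0 < u := hu
    simp only [hg]
    rw [Real.mul_rpow hc0.le hu.le, mul_assoc]
    congr 3
    rw [← hcA]
    field_simp
  have hint : IntegrableOn (fun u => g (c * u)) (Ioi 0) :=
    IntegrableOn.congr_fun (((integrableOn_besselK_integrand hν hc0)).const_mul _)
      (fun u hu => (hcomp u hu).symm) measurableSet_Ioi
  have hint' : IntegrableOn g (Ioi 0) := by
    have := (integrableOn_Ioi_comp_mul_left_iff g 0 hc0).1 hint
    rwa [mul_zero] at this
  have hval : ∫ s in Ioi (0 : ℝ), g s = 2 * besselK ν c * A ^ (ν / 2) := by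
    have h1 := integral_comp_mul_left_Ioi g 0 hc0
    rw [mul_zero, setIntegral_congr_fun measurableSet_Ioi hcomp, integral_const_mul,
      smul_eq_mul] at h1
    have h2 : c ^ (ν - 1) = A ^ (ν / 2) / c := by
      rw [Real.rpow_sub_one hc0.ne', hc, Real.sqrt_eq_rpow, ← Real.rpow_mul hA.le]
      ring_nf
    rw [h2] at h1
    unfold besselK
    field_simp at h1 ⊢
    linarith
  rw [← hval, ofReal_integral_eq_lintegral_ofReal hint']
  filter_upwards [ae_restrict_mem measurableSet_Ioi] with s hs
  have hs : 0 < s := hs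
  simp only [hg, Pi.zero_apply]
  positivity

lemma measurable_besselK (ν : ℝ) : Measurable (besselK ν) := by
  have h : StronglyMeasurable fun p : ℝ × ℝ =>
      p.2 ^ (ν - 1) * Real.exp (-(p.1 / 2) * (p.2 + 1 / p.2)) :=
    Measurable.stronglyMeasurable (by fun_prop)
  have := (h.integral_prod_right' (ν := volume.restrict (Ioi (0 : ℝ)))).measurable
  exact this.const_mul _

lemma measurable_nigDensity {m : ℕ} (γ : Fin (m + 1) → ℝ) : Measurable (nigDensity γ) := by
  have h1 : Measurable fun z : Fin (m + 1) → ℝ => ∑ i, γ i ^ 2 / z i := by fun_prop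
  have h2 : Measurable fun z : Fin (m + 1) → ℝ => ∏ i, z i ^ (-(3 : ℝ) / 2) := by fun_prop
  exact ((((measurable_besselK _).comp h1.sqrt).const_mul _).mul (h1.pow_const _)).mul h2

/-- Separation of the radial variable. Since `∑ z i = 1`, the exponents sum to an expression in `s`
and `∑ γ i ^ 2 / z i` alone, and the powers of `s` combine to `m - 3 (m + 1) / 2 = -(m + 1) / 2 -
1`. -/
lemma prod_invGaussPDF_smul {m : ℕ} {γ z : Fin (m + 1) → ℝ} (hz : ∀ i, 0 < z i)
    (hz1 : ∑ i, z i = 1) {s : ℝ} (hs : 0 < s) :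
    s ^ m * ∏ i, invGaussPDF (γ i) 1 (s * z i) =
      (Real.exp (∑ i, γ i) * (∏ i, γ i) / (2 * Real.pi) ^ (((m + 1 : ℕ) : ℝ) / 2) *
        ∏ i, z i ^ (-(3 : ℝ) / 2)) *
      (s ^ (-((m + 1 : ℕ) : ℝ) / 2 - 1) * Real.exp (-(s + (∑ i, γ i ^ 2 / z i) / s) / 2)) := by
  have hfac : ∀ i, invGaussPDF (γ i) 1 (s * z i) =
      γ i * (2 * Real.pi) ^ (-(1 : ℝ) / 2) * s ^ (-(3 : ℝ) / 2) * z i ^ (-(3 : ℝ) / 2) *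
        Real.exp (γ i - s / 2 * z i - γ i ^ 2 / z i / s / 2) := fun i => by
    have hzi := hz i
    rw [invGaussPDF, if_pos (by positivity), Real.mul_rpow hs.le hzi.le, Real.sqrt_eq_rpow,
      div_eq_mul_inv, ← Real.rpow_neg (by positivity)]
    have : -(1 * (s * z i) - γ i) ^ 2 / (2 * (s * z i)) =
        γ i - s / 2 * z i - γ i ^ 2 / z i / s / 2 := by
      field_simp
      ring
    rw [this]
    ring_nf
  have hpows : s ^ m * (s ^ (-(3 : ℝ) / 2)) ^ (m + 1) = s ^ (-((m + 1 : ℕ) : ℝ) / 2 - 1) := by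
    rw [← Real.rpow_natCast, ← Real.rpow_natCast, ← Real.rpow_mul hs.le, ← Real.rpow_add hs]
    congr 1
    push_cast
    ring
  have hpi : ((2 * Real.pi) ^ (-(1 : ℝ) / 2)) ^ (m + 1) =
      ((2 * Real.pi) ^ (((m + 1 : ℕ) : ℝ) / 2))⁻¹ := by
    rw [← Real.rpow_natCast, ← Real.rpow_mul (by positivity), ← Real.rpow_neg (by positivity)]
    congr 1
    ring
  have hexp : ∏ i, Real.exp (γ i - s / 2 * z i - γ i ^ 2 / z i / s / 2) =
      Real.exp (∑ i, γ i) * Real.exp (-(s + (∑ i, γ i ^ 2 / z i) / s) / 2) := by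
    rw [← Real.exp_sum, ← Real.exp_add, Finset.sum_sub_distrib, Finset.sum_sub_distrib,
      ← Finset.mul_sum, hz1, ← Finset.sum_div, ← Finset.sum_div]
    congr 1
    ring
  simp_rw [hfac]
  rw [Finset.prod_mul_distrib, Finset.prod_mul_distrib, Finset.prod_mul_distrib,
    Finset.prod_mul_distrib, hexp, Finset.prod_const, Finset.prod_const, Finset.card_univ,
    Fintype.card_fin, ← hpows, hpi]
  ring

/-- The radial integral is a Bessel integral of order `-(m + 1) / 2`; its factor `2` accounts for
the exponent `(m + 1) / 2 - 1` of `2` in the normalizing constant. -/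
lemma lintegral_prod_invGaussPDF_smul {m : ℕ} {γ z : Fin (m + 1) → ℝ} (hγ : ∀ i, 0 < γ i)
    (hz : ∀ i, 0 < z i) (hz1 : ∑ i, z i = 1) :
    ∫⁻ s in Ioi (0 : ℝ), ENNReal.ofReal (s ^ m) *
      ∏ i, ENNReal.ofReal (invGaussPDF (γ i) 1 ((s • z) i)) =
      ENNReal.ofReal (nigDensity γ z) := by
  have hA : 0 < ∑ i, γ i ^ 2 / z i :=
    Finset.sum_pos (fun i _ => div_pos (pow_pos (hγ i) 2) (hz i)) Finset.univ_nonempty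
  have hp : 0 < ∏ i, γ i := Finset.prod_pos fun i _ => hγ i
  have hq : 0 < ∏ i, z i ^ (-(3 : ℝ) / 2) := Finset.prod_pos fun i _ => Real.rpow_pos_of_pos (hz i) _
  have h1 : ∀ s ∈ Ioi (0 : ℝ), ENNReal.ofReal (s ^ m) *
      ∏ i, ENNReal.ofReal (invGaussPDF (γ i) 1 ((s • z) i)) =
      ENNReal.ofReal (Real.exp (∑ i, γ i) * (∏ i, γ i) /
        (2 * Real.pi) ^ (((m + 1 : ℕ) : ℝ) / 2) * ∏ i, z i ^ (-(3 : ℝ) / 2)) *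
      ENNReal.ofReal (s ^ (-((m + 1 : ℕ) : ℝ) / 2 - 1) *
        Real.exp (-(s + (∑ i, γ i ^ 2 / z i) / s) / 2)) := by
    intro s hs
    have hs : 0 < s := hs
    rw [← ENNReal.ofReal_prod_of_nonneg fun i _ => invGaussPDF_nonneg (hγ i).le _ _,
      ← ENNReal.ofReal_mul (by positivity), ← ENNReal.ofReal_mul (by positivity),
      ← prod_invGaussPDF_smul hz hz1 hs]
    rfl
  rw [setLIntegral_congr_fun measurableSet_Ioi h1, lintegral_const_mul' _ _ ENNReal.ofReal_ne_top,
    lintegral_besselK (by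
      have : (0 : ℝ) ≤ ((m + 1 : ℕ) : ℝ) := by positivity
      linarith) hA, ← ENNReal.ofReal_mul (by positivity)]
  congr 1
  unfold nigDensity
  rw [Real.mul_rpow (by norm_num) Real.pi_pos.le, Real.rpow_sub_one (by norm_num),
    show -((m + 1 : ℕ) : ℝ) / 2 / 2 = -((m + 1 : ℕ) : ℝ) / 4 by ring]
  field_simp

/-- The normalized inverse-Gaussian distribution is the law of independent inverse Gaussian
variables divided by their sum. -/
lemma nigMeasure_eq_map_pi_invGauss {m : ℕ} {γ : Fin (m + 1) → ℝ} (hγ : ∀ i, 0 < γ i) :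
    nigMeasure γ = (Measure.pi fun i => invGauss (γ i)).map fun v i => v i / ∑ j, v j := by
  have := fun i => isProbabilityMeasure_invGauss (hγ i)
  have hdens : ∀ i, Measurable fun v => ENNReal.ofReal (invGaussPDF (γ i) 1 v) :=
    fun i => (measurable_invGaussPDF _ _).ennreal_ofReal
  have hpi : Measure.pi (fun i => invGauss (γ i)) =
      (volume : Measure (Fin (m + 1) → ℝ)).withDensity
        fun v => ∏ i, ENNReal.ofReal (invGaussPDF (γ i) 1 (v i)) := by
    have : ∀ i, SigmaFinite ((volume : Measure ℝ).withDensity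
        fun v => ENNReal.ofReal (invGaussPDF (γ i) 1 v)) := fun i => by
      change SigmaFinite (invGauss (γ i)); infer_instance
    exact pi_withDensity_fin (fun _ => (volume : Measure ℝ)) hdens
  have hprod : Measurable fun v : Fin (m + 1) → ℝ =>
      ∏ i, ENNReal.ofReal (invGaussPDF (γ i) 1 (v i)) :=
    Finset.measurable_prod _ fun i _ => (hdens i).comp (measurable_pi_apply i)
  have hdiv : Measurable fun (v : Fin (m + 1) → ℝ) i => v i / ∑ j, v j :=
    measurable_pi_iff.2 fun i => by fun_prop
  classical
  refine Measure.ext_of_lintegral _ fun f hf => ?_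
  have hfd : Measurable fun v : Fin (m + 1) → ℝ => f fun i => v i / ∑ j, v j := hf.comp hdiv
  rw [lintegral_map hf hdiv, hpi, lintegral_withDensity_eq_lintegral_mul _ hprod hfd,
    lintegral_eq_lintegral_simplexPoint (hprod.mul hfd)]
  swap
  · intro v hv
    obtain ⟨i, hi⟩ : ∃ i, v i ≤ 0 := by
      by_contra! h
      exact absurd hv (not_le.2 (Finset.sum_pos (fun i _ => h i) Finset.univ_nonempty))
    have : ENNReal.ofReal (invGaussPDF (γ i) 1 (v i)) = 0 := by
      simp [invGaussPDF, not_lt.2 hi]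
    simp only [Pi.mul_apply]
    rw [Finset.prod_eq_zero (Finset.mem_univ i) this, zero_mul]
  have key : ∀ w : Fin m → ℝ, ∫⁻ s in Ioi (0 : ℝ), ENNReal.ofReal (s ^ m) *
      ((fun v : Fin (m + 1) → ℝ => ∏ i, ENNReal.ofReal (invGaussPDF (γ i) 1 (v i))) *
        fun v : Fin (m + 1) → ℝ => f fun i => v i / ∑ j, v j) (s • simplexPoint w) =
      ENNReal.ofReal (if ∀ i, 0 < simplexPoint w i then nigDensity γ (simplexPoint w) else 0) *
        f (simplexPoint w) := by
    intro w
    have h1 : ∀ s ∈ Ioi (0 : ℝ), ENNReal.ofReal (s ^ m) *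
      ((fun v : Fin (m + 1) → ℝ => ∏ i, ENNReal.ofReal (invGaussPDF (γ i) 1 (v i))) *
        fun v : Fin (m + 1) → ℝ => f fun i => v i / ∑ j, v j) (s • simplexPoint w) =
        (ENNReal.ofReal (s ^ m) *
          ∏ i, ENNReal.ofReal (invGaussPDF (γ i) 1 ((s • simplexPoint w) i))) *
          f (simplexPoint w) := by
      intro s hs
      have hs : s ≠ 0 := ne_of_gt hs
      have : (fun i => (s • simplexPoint w) i / ∑ j, (s • simplexPoint w) j) =
          simplexPoint w := by
        ext i
        simp only [Pi.smul_apply, smul_eq_mul, ← Finset.mul_sum, sum_simplexPoint]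
        field_simp
      simp only [Pi.mul_apply, this, mul_assoc]
    rw [setLIntegral_congr_fun measurableSet_Ioi h1]
    have hms : Measurable fun s : ℝ => ENNReal.ofReal (s ^ m) *
        ∏ i, ENNReal.ofReal (invGaussPDF (γ i) 1 ((s • simplexPoint w) i)) :=
      Measurable.mul (by fun_prop) (hprod.comp (measurable_id.smul_const _))
    rw [lintegral_mul_const _ hms]
    congr 1
    split_ifs with h
    · exact lintegral_prod_invGaussPDF_smul hγ h (sum_simplexPoint w)
    · push Not at h
      obtain ⟨i, hi⟩ := h
      rw [ENNReal.ofReal_zero, ← lintegral_zero (μ := (volume.restrict (Ioi (0 : ℝ))))]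
      refine setLIntegral_congr_fun measurableSet_Ioi fun s hs => ?_
      have : ENNReal.ofReal (invGaussPDF (γ i) 1 ((s • simplexPoint w) i)) = 0 := by
        have : ¬ 0 < s * simplexPoint w i := not_lt.2 (mul_nonpos_of_nonneg_of_nonpos
          (le_of_lt hs) hi)
        simp [invGaussPDF, this]
      rw [Finset.prod_eq_zero (Finset.mem_univ i) this, mul_zero]
  rw [lintegral_congr key]
  have hd : Measurable fun w : Fin m → ℝ => ENNReal.ofReal
      (if ∀ i, 0 < simplexPoint w i then nigDensity γ (simplexPoint w) else 0) := by
    refine (Measurable.ite ?_ ((measurable_nigDensity γ).comp measurable_simplexPoint)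
      measurable_const).ennreal_ofReal
    simp only [ofPred_forall]
    exact MeasurableSet.iInter fun i => measurableSet_lt measurable_const
      ((measurable_pi_apply i).comp measurable_simplexPoint)
  have hfs : Measurable fun w : Fin m → ℝ => f (simplexPoint w) := hf.comp measurable_simplexPoint
  rw [nigMeasure, lintegral_map hf measurable_simplexPoint,
    lintegral_withDensity_eq_lintegral_mul _ (by convert hd) hfs]
  refine lintegral_congr fun w => ?_
  simp only [Pi.mul_apply]


/-! ### Maximal inequalities for independent inverse Gaussian variables. -/

lemma measurable_partialProd {n : ℕ} {L : Fin n → ℝ → ℝ≥0∞} (hL : ∀ i, Measurable (L i)) (k : ℕ) :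
    Measurable fun x : Fin n → ℝ => ∏ i : Fin n, if (i : ℕ) < k then L i (x i) else 1 := by
  refine Finset.measurable_prod _ fun i _ => ?_
  split_ifs
  · exact (hL i).comp (measurable_pi_apply i)
  · exact measurable_const

/-- Doob's maximal inequality for the partial products of independent nonnegative variables of
mean at least `1`. -/
lemma mul_pi_exists_le_partialProd_le {n : ℕ} (μ : Fin n → Measure ℝ)
    [∀ i, IsProbabilityMeasure (μ i)] {L : Fin n → ℝ → ℝ≥0∞} (hL : ∀ i, Measurable (L i))
    (hL1 : ∀ i, 1 ≤ ∫⁻ x, L i x ∂(μ i)) {c : ℝ≥0∞} (hc : c ≠ ∞) :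
    c * Measure.pi μ {x | ∃ k : ℕ, c ≤ ∏ i : Fin n, if (i : ℕ) < k then L i (x i) else 1} ≤
      ∏ i, ∫⁻ x, L i x ∂(μ i) := by
  induction n generalizing c with
  | zero =>
    by_cases h : c ≤ 1
    · simpa using mul_le_one' h prob_le_one
    · simp [h]
  | succ n ih =>
    have h1 : (1 : ℝ≥0∞) ≤ ∏ i, ∫⁻ x, L i x ∂(μ i) := Finset.one_le_prod' fun i _ => hL1 i
    rcases le_or_gt c 1 with hc1 | hc1
    · exact (mul_le_one' hc1 prob_le_one).trans h1
    have h1' : (1 : ℝ≥0∞) ≤ ∏ i : Fin n, ∫⁻ x, L i.succ x ∂(μ i.succ) :=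
      Finset.one_le_prod' fun i _ => hL1 i.succ
    -- Condition on the value `l` of the first factor: the remaining product must reach `c / l`, to
    -- which the induction hypothesis applies. The values `l = 0` and `l = ∞` are treated apart.
    set E : ℝ≥0∞ → Set (Fin n → ℝ) := fun l =>
      {x | ∃ k : ℕ, c ≤ l * ∏ i : Fin n, if (i : ℕ) < k then L i.succ (x i) else 1} with hE
    have hEl : ∀ l, c * Measure.pi (fun i : Fin n => μ i.succ) (E l) ≤
        l * ∏ i : Fin n, ∫⁻ x, L i.succ x ∂(μ i.succ) := by
      intro l
      rcases eq_or_ne l 0 with rfl | h0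
      · have : E 0 = ∅ := by
          ext x
          simp [hE, (zero_lt_one.trans hc1).ne']
        simp [this]
      rcases eq_or_ne l ∞ with rfl | ht
      · rw [ENNReal.top_mul (zero_lt_one.trans_le h1').ne']
        exact le_top
      · have hcl : c / l ≠ ∞ := ENNReal.div_ne_top hc h0
        have := ih (fun i => μ i.succ) (fun i => hL i.succ) (fun i => hL1 i.succ) hcl
        have hset : {x : Fin n → ℝ | ∃ k : ℕ, c / l ≤ ∏ i : Fin n,
            if (i : ℕ) < k then L i.succ (x i) else 1} = E l := by
          ext x
          simp only [hE, mem_ofPred_eq]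
          refine exists_congr fun k => ?_
          rw [ENNReal.div_le_iff_le_mul (Or.inl h0) (Or.inl ht), mul_comm]
        rw [hset] at this
        calc c * Measure.pi (fun i : Fin n => μ i.succ) (E l)
            = l * (c / l * Measure.pi (fun i : Fin n => μ i.succ) (E l)) := by
              rw [← mul_assoc, ENNReal.mul_div_cancel h0 ht]
          _ ≤ _ := by gcongr
    have hmp := (measurePreserving_piFinSuccAbove (α := fun _ => ℝ) μ 0).symm
    have hmeas : MeasurableSet {x : Fin (n + 1) → ℝ | ∃ k : ℕ, c ≤ ∏ i : Fin (n + 1),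
        if (i : ℕ) < k then L i (x i) else 1} := by
      simp only [ofPred_exists]
      exact MeasurableSet.iUnion fun k => measurableSet_le measurable_const
        (measurable_partialProd hL k)
    have hpre : (MeasurableEquiv.piFinSuccAbove (fun _ => ℝ) 0).symm ⁻¹'
        {x : Fin (n + 1) → ℝ | ∃ k : ℕ, c ≤ ∏ i : Fin (n + 1),
        if (i : ℕ) < k then L i (x i) else 1} = {p : ℝ × (Fin n → ℝ) | p.2 ∈ E (L 0 p.1)} := by
      ext p
      have hz : (MeasurableEquiv.piFinSuccAbove (fun _ : Fin (n + 1) => ℝ) 0).symm p =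
        (Fin.cons p.1 p.2 : Fin (n + 1) → ℝ) := by
        ext i
        refine Fin.cases rfl (fun j => rfl) i
      simp only [mem_preimage, mem_ofPred_eq, hE, hz, Fin.prod_univ_succ, Fin.cons_zero,
        Fin.cons_succ, Fin.val_succ, Fin.val_zero]
      constructor
      · rintro ⟨k, hk⟩
        -- The empty product is `1 < c`, so a successful index contains the first factor.
        rcases k with _ | k
        · simp only [not_lt_zero, if_false, Finset.prod_const_one, mul_one] at hk
          exact absurd hk (not_le.2 hc1)
        · exact ⟨k, by simpa using hk⟩
      · rintro ⟨k, hk⟩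
        exact ⟨k + 1, by simpa using hk⟩
    rw [← hmp.measure_preimage hmeas.nullMeasurableSet, hpre,
      Measure.prod_apply (by rw [← hpre]; exact hmp.measurable hmeas), ← lintegral_const_mul' _ _ hc,
      Fin.prod_univ_succ, ← lintegral_mul_const _ (hL 0)]
    exact lintegral_mono fun x => hEl (L 0 x)

/-- The expression is the logarithm of the centred exponential moment of an inverse Gaussian
variable, per unit of `α`. Its sign gives the factors mean at least one, as Doob's inequality
requires. -/
lemma one_sub_sqrt_sub_nonneg (x : ℝ) (hx : x ≤ 1 / 2) : 0 ≤ 1 - Real.sqrt (1 - 2 * x) - x := by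
  have : Real.sqrt (1 - 2 * x) ≤ 1 - x := by
    rw [Real.sqrt_le_left (by linarith)]
    nlinarith [sq_nonneg x]
  linarith

/-- A quadratic bound near the origin, the source of the sub-Gaussian tails. -/
lemma one_sub_sqrt_sub_le_sq {x : ℝ} (hx : |x| ≤ 1 / 4) : 1 - Real.sqrt (1 - 2 * x) - x ≤ x ^ 2 := by
  have hx' := abs_le.1 hx
  have : 1 - x - x ^ 2 ≤ Real.sqrt (1 - 2 * x) := by
    refine Real.le_sqrt_of_sq_le ?_
    have : 0 ≤ x ^ 2 * (1 - 2 * x - x ^ 2) := mul_nonneg (sq_nonneg x) (by nlinarith)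
    nlinarith
  linarith

lemma lintegral_exp_mul_sub_invGauss {α x : ℝ} (hα : 0 < α) (hx : x < 1 / 2) :
    ∫⁻ v, ENNReal.ofReal (Real.exp (x * (v - α))) ∂(invGauss α) =
      ENNReal.ofReal (Real.exp (α * (1 - Real.sqrt (1 - 2 * x) - x))) := by
  have : ∀ v, ENNReal.ofReal (Real.exp (x * (v - α))) =
      ENNReal.ofReal (Real.exp (x * v)) * ENNReal.ofReal (Real.exp (-(x * α))) := fun v => by
    rw [← ENNReal.ofReal_mul (Real.exp_nonneg _), ← Real.exp_add]
    ring_nf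
  simp_rw [this]
  rw [lintegral_mul_const _ (by fun_prop), lintegral_exp_mul_invGauss hα hx,
    ← ENNReal.ofReal_mul (Real.exp_nonneg _), ← Real.exp_add]
  ring_nf

/-- Exponential bound for the partial sums of the coordinates in `J` of independent inverse
Gaussian variables. -/
lemma pi_invGauss_exists_partialSum_ge {n : ℕ} {γ : Fin n → ℝ} (hγ : ∀ i, 0 < γ i)
    (J : Finset (Fin n)) {x T s : ℝ} (hx : |x| ≤ 1 / 4) (hJ : ∑ i ∈ J, γ i ≤ T) :
    Measure.pi (fun i => invGauss (γ i))
        {v | ∃ k : ℕ, s ≤ x * ∑ i ∈ J, if (i : ℕ) < k then v i - γ i else 0} ≤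
      ENNReal.ofReal (Real.exp (T * x ^ 2 - s)) := by
  have := fun i => isProbabilityMeasure_invGauss (hγ i)
  classical
  have hx' := abs_le.1 hx
  have hx2 : x < 1 / 2 := by linarith
  -- Coordinates outside `J` get the factor one, so that the products over all indices below `k`
  -- only see `J`.
  set L : Fin n → ℝ → ℝ≥0∞ := fun i v =>
    if i ∈ J then ENNReal.ofReal (Real.exp (x * (v - γ i))) else 1 with hLdef
  have hLm : ∀ i, Measurable (L i) := fun i => by
    simp only [hLdef]
    split_ifs
    · fun_prop
    · fun_prop
  have hLint : ∀ i, ∫⁻ v, L i v ∂(invGauss (γ i)) = ENNReal.ofReal (Real.exp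
      (if i ∈ J then γ i * (1 - Real.sqrt (1 - 2 * x) - x) else 0)) := fun i => by
    simp only [hLdef]
    split_ifs with h
    · exact lintegral_exp_mul_sub_invGauss (hγ i) hx2
    · simp
  have hL1 : ∀ i, 1 ≤ ∫⁻ v, L i v ∂(invGauss (γ i)) := fun i => by
    rw [hLint, ENNReal.one_le_ofReal, Real.one_le_exp_iff]
    split_ifs
    · exact mul_nonneg (hγ i).le (one_sub_sqrt_sub_nonneg x hx2.le)
    · exact le_rfl
  have hmax := mul_pi_exists_le_partialProd_le (fun i => invGauss (γ i)) hLm hL1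
    (c := ENNReal.ofReal (Real.exp s)) ENNReal.ofReal_ne_top
  have hprod : ∏ i, ∫⁻ v, L i v ∂(invGauss (γ i)) ≤ ENNReal.ofReal (Real.exp (T * x ^ 2)) := by
    simp_rw [hLint]
    rw [← ENNReal.ofReal_prod_of_nonneg fun i _ => Real.exp_nonneg _, ← Real.exp_sum]
    refine ENNReal.ofReal_le_ofReal (Real.exp_le_exp.2 ?_)
    rw [Finset.sum_ite_mem, Finset.univ_inter, ← Finset.sum_mul]
    exact mul_le_mul hJ (one_sub_sqrt_sub_le_sq hx) (one_sub_sqrt_sub_nonneg x hx2.le)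
      ((Finset.sum_nonneg fun i _ => (hγ i).le).trans hJ)
  have hset : {v : Fin n → ℝ | ∃ k : ℕ, s ≤ x * ∑ i ∈ J, if (i : ℕ) < k then v i - γ i else 0} ⊆
      {v | ∃ k : ℕ, ENNReal.ofReal (Real.exp s) ≤
        ∏ i : Fin n, if (i : ℕ) < k then L i (v i) else 1} := by
    rintro v ⟨k, hk⟩
    refine ⟨k, ?_⟩
    have : ∀ i : Fin n, (if (i : ℕ) < k then L i (v i) else 1) = ENNReal.ofReal (Real.exp
        (if i ∈ J then (if (i : ℕ) < k then x * (v i - γ i) else 0) else 0)) := fun i => by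
      simp only [hLdef]
      split_ifs <;> simp
    simp_rw [this]
    rw [← ENNReal.ofReal_prod_of_nonneg fun i _ => Real.exp_nonneg _, ← Real.exp_sum]
    refine ENNReal.ofReal_le_ofReal (Real.exp_le_exp.2 (hk.trans (le_of_eq ?_)))
    rw [Finset.sum_ite_mem, Finset.univ_inter, Finset.mul_sum]
    exact Finset.sum_congr rfl fun i _ => by split_ifs <;> simp
  have h0 : ENNReal.ofReal (Real.exp s) ≠ 0 := by
    rw [ENNReal.ofReal_ne_zero_iff]; exact Real.exp_pos s
  rw [Real.exp_sub, ENNReal.ofReal_div_of_pos (Real.exp_pos s), ENNReal.le_div_iff_mul_le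
    (Or.inl h0) (Or.inl ENNReal.ofReal_ne_top), mul_comm]
  calc _ ≤ _ := by gcongr
    _ ≤ _ := hmax
    _ ≤ _ := hprod

/-- The exponential bound is used for both signs of `x = lam / (2 δ √a)`, which minimizes `a δ x ^ 2
- x lam √a`. The condition `hlarge` says exactly that this `x` is at most `1 / 4`. -/
lemma pi_invGauss_exists_abs_partialSum_ge {n : ℕ} {γ : Fin n → ℝ} (hγ : ∀ i, 0 < γ i)
    (J : Finset (Fin n)) {a δ lam : ℝ} (ha : 0 < a) (hδ : 0 < δ) (hlam : 0 < lam)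
    (hJ : ∑ i ∈ J, γ i ≤ a * δ) (hlarge : 2 * lam / δ ≤ Real.sqrt a) :
    Measure.pi (fun i => invGauss (γ i))
        {v | ∃ k : ℕ, lam * Real.sqrt a ≤ |∑ i ∈ J, if (i : ℕ) < k then v i - γ i else 0|} ≤
      ENNReal.ofReal (2 * Real.exp (-(lam ^ 2 / (4 * δ)))) := by
  set r := Real.sqrt a with hr
  have hr0 : 0 < r := Real.sqrt_pos.2 ha
  have hra : r ^ 2 = a := Real.sq_sqrt ha.le
  set x := lam / (2 * δ) / r with hxdef
  have hx0 : 0 < x := by positivity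
  have hx : |x| ≤ 1 / 4 := by
    rw [abs_of_pos hx0, hxdef, div_le_iff₀ hr0]
    have : lam / (2 * δ) = 1 / 4 * (2 * lam / δ) := by ring
    rw [this]
    gcongr
  have hxn : |-x| ≤ 1 / 4 := by rwa [abs_neg]
  have hval : a * δ * x ^ 2 - x * (lam * r) = -(lam ^ 2 / (4 * δ)) := by
    rw [hxdef, ← hra]
    field_simp
    ring
  have h1 := pi_invGauss_exists_partialSum_ge hγ J (s := x * (lam * r)) hx hJ
  have h2 := pi_invGauss_exists_partialSum_ge hγ J (s := x * (lam * r)) hxn hJ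
  rw [neg_sq, hval] at h2
  rw [hval] at h1
  refine (measure_mono ?_).trans ((measure_union_le _ _).trans ((add_le_add h1 h2).trans ?_))
  · rintro v ⟨k, hk⟩
    rcases le_abs.1 hk with h | h
    · exact Or.inl ⟨k, by gcongr⟩
    · refine Or.inr ⟨k, ?_⟩
      rw [neg_mul, ← mul_neg]
      gcongr
  · rw [← ENNReal.ofReal_add (Real.exp_nonneg _) (Real.exp_nonneg _), two_mul]

/-- With `S` the total, `X` the centred partial sum and `h` the corresponding sum of the `H i`, the
normalized deviation is `(X - h (S - a)) / S`. It is small once `X` and `S - a` are, because `h ≤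
δ`. -/
lemma pi_invGauss_exists_ratio_gt {n : ℕ} {H : Fin n → ℝ} (hH : ∀ i, 0 < H i)
    (hH1 : ∑ i, H i = 1) (J : Finset (Fin n)) {a δ lam : ℝ} (ha : 0 < a) (hδ : 0 < δ)
    (hδ1 : δ ≤ 1) (hlam : 0 < lam) (hJ : ∑ i ∈ J, H i ≤ δ)
    (hlarge : lam / (2 * δ) ≤ Real.sqrt a) :
    Measure.pi (fun i => invGauss (a * H i))
        {v | ∃ k : ℕ, lam < Real.sqrt a *
          |∑ i ∈ J, if (i : ℕ) < k then v i / (∑ j, v j) - H i else 0|} ≤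
      ENNReal.ofReal (4 * Real.exp (-(lam ^ 2 / (64 * δ)))) := by
  have hγ : ∀ i, 0 < a * H i := fun i => mul_pos ha (hH i)
  set r := Real.sqrt a with hr
  have hr0 : 0 < r := Real.sqrt_pos.2 ha
  have hra : r ^ 2 = a := Real.sq_sqrt ha.le
  -- Chosen so that `δ K = lam / 4`: the total may deviate by `K √a`, as it enters with weight at
  -- most `δ`. Also `2 K ≤ √a` keeps `S` above `a / 2`.
  set K := lam / (4 * δ) with hK
  have hK0 : 0 < K := by positivity
  have hKr : 2 * K ≤ r := by
    refine le_trans (le_of_eq ?_) hlarge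
    rw [hK]; field_simp; ring
  have h1 := pi_invGauss_exists_abs_partialSum_ge hγ J ha hδ (lam := lam / 4) (by positivity)
    (by rw [← Finset.mul_sum]; gcongr)
    (by refine le_trans (le_of_eq ?_) hlarge; field_simp; ring)
  have h2 := pi_invGauss_exists_abs_partialSum_ge hγ Finset.univ ha one_pos (lam := K) hK0
    (by rw [← Finset.mul_sum, hH1]) (by rw [div_one]; exact hKr)
  refine (measure_mono ?_).trans ((measure_union_le _ _).trans ((add_le_add h1 h2).trans ?_))
  · rintro v ⟨k, hk⟩
    by_contra hcon
    simp only [mem_union, mem_ofPred_eq, not_or, not_exists, not_le] at hcon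
    obtain ⟨hc1, hc2⟩ := hcon
    have hx := hc1 k
    -- At index `n` the partial sum is complete, so this controls the total.
    have hy := hc2 n
    simp only [Fin.is_lt, if_true] at hy
    rw [Finset.sum_sub_distrib, ← Finset.mul_sum, hH1, mul_one] at hy
    set S := ∑ j, v j with hS
    set h := ∑ i ∈ J, if (i : ℕ) < k then H i else 0 with hh
    have hh0 : 0 ≤ h := Finset.sum_nonneg fun i _ => by
      split_ifs
      exacts [(hH i).le, le_rfl]
    have hhδ : h ≤ δ := le_trans (Finset.sum_le_sum fun i _ => by
      split_ifs
      exacts [le_rfl, (hH i).le]) hJ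
    have hSpos : a / 2 ≤ S := by
      have := (abs_lt.1 hy).1
      nlinarith
    have hS0 : 0 < S := by linarith
    set X := ∑ i ∈ J, if (i : ℕ) < k then v i - a * H i else 0 with hX
    have hsum : (∑ i ∈ J, if (i : ℕ) < k then v i / S - H i else 0) = (X - h * (S - a)) / S := by
      rw [hX, hh, Finset.sum_mul, ← Finset.sum_sub_distrib, Finset.sum_div]
      refine Finset.sum_congr rfl fun i _ => ?_
      split_ifs
      · field_simp; ring
      · simp
    rw [hsum, abs_div, abs_of_pos hS0] at hk
    have hb : |X - h * (S - a)| ≤ lam * r / 2 := by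
      refine (abs_sub _ _).trans ?_
      rw [abs_mul, abs_of_nonneg hh0]
      have : h * |S - a| ≤ δ * (K * r) := by gcongr
      have h3 : δ * (K * r) = lam * r / 4 := by rw [hK]; field_simp
      linarith
    have : r * (|X - h * (S - a)| / S) ≤ r * ((lam * r / 2) / (a / 2)) := by gcongr
    have h4 : r * ((lam * r / 2) / (a / 2)) = lam := by
      rw [← hra]; field_simp
    linarith
  · rw [← ENNReal.ofReal_add (by positivity) (by positivity)]
    refine ENNReal.ofReal_le_ofReal ?_
    have e1 : (lam / 4) ^ 2 / (4 * δ) = lam ^ 2 / (64 * δ) := by field_simp; ring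
    -- Here `δ ≤ 1` is needed: the exponent for the total is larger by a factor `1 / δ`.
    have e2 : lam ^ 2 / (64 * δ) ≤ K ^ 2 / (4 * 1) := by
      have : K ^ 2 / (4 * 1) = lam ^ 2 / (64 * δ) / δ := by rw [hK]; field_simp; ring
      rw [this]
      exact le_div_self (by positivity) hδ hδ1
    rw [e1]
    have := Real.exp_le_exp.2 (neg_le_neg e2)
    linarith

/-! ### Grids on the line and maximal inequalities for the process on a grid. -/

/-- The partition of the line into `M + 2` intervals by the points `s 0 < ... < s M`. -/
def gridCell (s : ℕ → ℝ) (M i : ℕ) : Set ℝ :=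
  if i = 0 then Iic (s 0) else if i ≤ M then Ioc (s (i - 1)) (s i) else Ioi (s M)

lemma measurableSet_gridCell (s : ℕ → ℝ) (M i : ℕ) : MeasurableSet (gridCell s M i) := by
  unfold gridCell
  split_ifs <;> measurability

lemma sum_range_measureReal_gridCell (m : Measure ℝ) [IsProbabilityMeasure m] {s : ℕ → ℝ}
    (hs : Monotone s) {M k : ℕ} (hk : k ≤ M) :
    ∑ i ∈ Finset.range (k + 1), m.real (gridCell s M i) = m.real (Iic (s k)) := by
  induction k with
  | zero => simp [gridCell]
  | succ k ih =>
    rw [Finset.sum_range_succ, ih (by omega)]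
    simp only [gridCell, Nat.add_eq_zero_iff, one_ne_zero, and_false, if_false, if_pos hk,
      Nat.add_sub_cancel]
    rw [← measureReal_union (μ := m) (s₁ := Iic (s k)) (s₂ := Ioc (s k) (s (k + 1)))
        (disjoint_left.2 fun x hx hx' => absurd hx (not_le.2 hx'.1))
      measurableSet_Ioc, Iic_union_Ioc_eq_Iic (hs (Nat.le_succ k))]

lemma sum_measureReal_gridCell (m : Measure ℝ) [IsProbabilityMeasure m] {s : ℕ → ℝ}
    (hs : Monotone s) {M : ℕ} :
    ∑ i : Fin (M + 1 + 1), m.real (gridCell s M i) = 1 := by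
  rw [Fin.sum_univ_eq_sum_range (fun i => m.real (gridCell s M i)), Finset.sum_range_succ,
    sum_range_measureReal_gridCell m hs le_rfl]
  simp only [gridCell, Nat.add_eq_zero_iff, one_ne_zero, and_false, if_false,
    Nat.not_succ_le_self]
  rw [← compl_Iic, probReal_compl_eq_one_sub measurableSet_Iic]
  ring

lemma disjoint_gridCell {s : ℕ → ℝ} (hs : Monotone s) {M i j : ℕ} (hij : i < j)
    (hj : j ≤ M + 1) :
    Disjoint (gridCell s M i) (gridCell s M j) := by
  rw [disjoint_left]
  intro x hx hx'
  have h1 : i ≤ M → x ≤ s i := fun hi => by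
    unfold gridCell at hx
    split_ifs at hx with h0
    · rw [h0]; exact hx
    · exact hx.2
  unfold gridCell at hx'
  rw [if_neg (by omega)] at hx'
  split_ifs at hx' with hjM
  · exact absurd (h1 (by omega)) (not_le.2 ((hs (show i ≤ j - 1 by omega)).trans_lt hx'.1))
  · exact absurd (h1 (by omega)) (not_le.2 ((hs (show i ≤ M by omega)).trans_lt hx'))

lemma iUnion_gridCell (s : ℕ → ℝ) (M : ℕ) :
    ⋃ i : Fin (M + 1 + 1), gridCell s M i = univ := by
  refine eq_univ_of_forall fun x => mem_iUnion.2 ?_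
  rcases lt_or_ge (s M) x with hx | hx
  · exact ⟨Fin.last _, by simpa [gridCell] using hx⟩
  · classical
    have hex : ∃ i, x ≤ s i := ⟨M, hx⟩
    have hle : Nat.find hex ≤ M := Nat.find_min' hex hx
    refine ⟨⟨Nat.find hex, by omega⟩, ?_⟩
    have hsp := Nat.find_spec hex
    unfold gridCell
    simp only
    split_ifs with h0
    · rw [h0] at hsp; exact hsp
    · exact ⟨not_le.1 (Nat.find_min hex (by omega)), hsp⟩

/-- The values of `P` on the cells of a grid are independent inverse Gaussian variables divided
by their sum. -/
lemma IsNIGProcess.measure_gridCell_mem {Ω : Type*} [MeasurableSpace Ω] {μ : Measure Ω}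
    {a : ℝ} (ha : 0 < a) {H : Measure ℝ} [IsProbabilityMeasure H] {P : Kernel Ω ℝ}
    (hP : IsNIGProcess a H P μ) {s : ℕ → ℝ} (hs : Monotone s)
    {M : ℕ} (hH : ∀ i ≤ M + 1, H (gridCell s M i) ≠ 0) {E : Set (Fin (M + 1 + 1) → ℝ)}
    (hE : MeasurableSet E) :
    μ {ω | (fun i : Fin (M + 1 + 1) => (P ω).real (gridCell s M i)) ∈ E} =
      Measure.pi (fun i : Fin (M + 1 + 1) => invGauss (a * H.real (gridCell s M i)))
        {v | (fun i => v i / ∑ j, v j) ∈ E} := by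
  have hlaw := hP.law (M + 1) (fun i => gridCell s M i) (fun i => measurableSet_gridCell s M i)
    (fun i j hij => by
      rcases lt_or_gt_of_ne (fun h => hij (Fin.ext h)) with h | h
      · exact disjoint_gridCell hs h (by omega)
      · exact (disjoint_gridCell hs h (by omega)).symm)
    (iUnion_gridCell s M) (fun i => hH i (by omega))
  have hpos : ∀ i : Fin (M + 1 + 1), 0 < a * H.real (gridCell s M i) := fun i =>
    mul_pos ha (ENNReal.toReal_pos (hH i (by omega)) (measure_ne_top _ _))
  rw [nigMeasure_eq_map_pi_invGauss hpos] at hlaw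
  have hm : Measurable fun ω => fun i : Fin (M + 1 + 1) => (P ω).real (gridCell s M i) :=
    measurable_pi_iff.2 fun i =>
      (Kernel.measurable_coe P (measurableSet_gridCell s M i)).ennreal_toReal
  have hdiv : Measurable fun (v : Fin (M + 1 + 1) → ℝ) i => v i / ∑ j, v j :=
    measurable_pi_iff.2 fun i => by fun_prop
  have := congrArg (fun m : Measure _ => m E) hlaw
  simp only [Measure.map_apply hm hE, Measure.map_apply hdiv hE] at this
  exact this

/-- The event is expressed through the cell masses alone, so its probability can be computed with
normalized independent variables. -/
lemma IsNIGProcess.measure_exists_gt {Ω : Type*} [MeasurableSpace Ω] {μ : Measure Ω}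
    {a : ℝ} (ha : 0 < a) {H : Measure ℝ} [IsProbabilityMeasure H] {P : Kernel Ω ℝ}
    (hP : IsNIGProcess a H P μ) {s : ℕ → ℝ} (hs : Monotone s)
    {M : ℕ} (hH : ∀ i ≤ M + 1, H (gridCell s M i) ≠ 0) (J : Finset (Fin (M + 1 + 1)))
    {δ lam : ℝ} (hδ : 0 < δ) (hδ1 : δ ≤ 1) (hlam : 0 < lam)
    (hJ : ∑ i ∈ J, H.real (gridCell s M i) ≤ δ) (hlarge : lam / (2 * δ) ≤ Real.sqrt a) :
    μ {ω | ∃ k : ℕ, lam < Real.sqrt a * |∑ i ∈ J, if (i : ℕ) < k then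
        (P ω).real (gridCell s M i) - H.real (gridCell s M i) else 0|} ≤
      ENNReal.ofReal (4 * Real.exp (-(lam ^ 2 / (64 * δ)))) := by
  set E : Set (Fin (M + 1 + 1) → ℝ) := {z | ∃ k : ℕ, lam < Real.sqrt a *
    |∑ i ∈ J, if (i : ℕ) < k then z i - H.real (gridCell s M i) else 0|} with hEdef
  have hE : MeasurableSet E := by
    simp only [hEdef, ofPred_exists]
    refine MeasurableSet.iUnion fun k => measurableSet_lt measurable_const ?_
    refine (Measurable.abs (Finset.measurable_sum _ fun i _ => ?_)).const_mul _
    split_ifs <;> fun_prop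
  have := hP.measure_gridCell_mem ha hs hH hE
  refine (le_of_eq this).trans ?_
  exact pi_invGauss_exists_ratio_gt (H := fun i : Fin (M + 1 + 1) => H.real (gridCell s M i))
    (fun i => ENNReal.toReal_pos (hH i (by omega)) (measure_ne_top _ _))
    (sum_measureReal_gridCell H hs) J ha hδ hδ1 hlam hJ hlarge

/-- Maximal inequality for the increments of a normalized inverse-Gaussian process on a grid. -/
lemma IsNIGProcess.measure_exists_increment_gt {Ω : Type*} [MeasurableSpace Ω] {μ : Measure Ω}
    {a : ℝ} (ha : 0 < a) {H : Measure ℝ} [IsProbabilityMeasure H] {P : Kernel Ω ℝ}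
    [IsMarkovKernel P] (hP : IsNIGProcess a H P μ) {s : ℕ → ℝ} (hs : Monotone s)
    {M : ℕ} (hH : ∀ i ≤ M + 1, H (gridCell s M i) ≠ 0)
    {δ lam : ℝ} (hδ : 0 < δ) (hδ1 : δ ≤ 1) (hlam : 0 < lam)
    (hJ : H.real (Iic (s M)) - H.real (Iic (s 0)) ≤ δ) (hlarge : lam / (2 * δ) ≤ Real.sqrt a) :
    μ {ω | ∃ k ≤ M, lam < Real.sqrt a * |((P ω).real (Iic (s k)) - H.real (Iic (s k))) -
        ((P ω).real (Iic (s 0)) - H.real (Iic (s 0)))|} ≤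
      ENNReal.ofReal (4 * Real.exp (-(lam ^ 2 / (64 * δ)))) := by
  -- The cells between `s 0` and `s M`; both unbounded cells are left out.
  set J : Finset (Fin (M + 1 + 1)) := Finset.univ.filter fun i => 1 ≤ (i : ℕ) ∧ (i : ℕ) ≤ M with hJdef
  have hsum : ∀ g : ℕ → ℝ, ∀ k ≤ M, (∑ i ∈ J, if (i : ℕ) < k + 1 then g i else 0) =
      ∑ i ∈ Finset.range (k + 1), g i - g 0 := by
    intro g k hk
    have h1 : ∑ i ∈ Finset.range (k + 1), g i = g 0 + ∑ i ∈ Finset.Ico 1 (k + 1), g i := by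
      rw [Finset.range_eq_Ico, Finset.sum_eq_sum_Ico_succ_bot (Nat.succ_pos k)]
    rw [hJdef, ← Finset.sum_filter, Finset.filter_filter, Finset.sum_filter,
      Fin.sum_univ_eq_sum_range (fun i => if (1 ≤ i ∧ i ≤ M) ∧ i < k + 1 then g i else 0),
      ← Finset.sum_filter, h1, add_sub_cancel_left]
    refine Finset.sum_congr ?_ fun _ _ => rfl
    ext i
    simp only [Finset.mem_filter, Finset.mem_Ico, Finset.mem_range]
    omega
  have hcell : ∀ (m : Measure ℝ) [IsProbabilityMeasure m], m.real (gridCell s M 0) =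
      m.real (Iic (s 0)) := fun m _ => by simp [gridCell]
  refine le_trans (measure_mono ?_) (hP.measure_exists_gt ha hs hH J hδ hδ1 hlam ?_ hlarge)
  · rintro ω ⟨k, hk, hlt⟩
    -- The mass of `Iic (s k)` is the sum over the cells `0, …, k`, that is, over the indices below
    -- `k + 1`.
    refine ⟨k + 1, ?_⟩
    rw [hsum (fun i => (P ω).real (gridCell s M i) - H.real (gridCell s M i)) k hk,
      Finset.sum_sub_distrib, sum_range_measureReal_gridCell _ hs hk,
      sum_range_measureReal_gridCell _ hs hk, hcell, hcell]
    exact hlt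
  · have := hsum (fun i => H.real (gridCell s M i)) M le_rfl
    rw [sum_range_measureReal_gridCell _ hs le_rfl, hcell] at this
    refine le_trans (le_of_eq ?_) hJ
    rw [← this]
    refine Finset.sum_congr rfl fun i hi => ?_
    rw [if_pos]
    simp only [hJdef, Finset.mem_filter] at hi
    omega

/-- Maximal inequality for a normalized inverse-Gaussian process on a grid. -/
lemma IsNIGProcess.measure_exists_value_gt {Ω : Type*} [MeasurableSpace Ω] {μ : Measure Ω}
    {a : ℝ} (ha : 0 < a) {H : Measure ℝ} [IsProbabilityMeasure H] {P : Kernel Ω ℝ}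
    [IsMarkovKernel P] (hP : IsNIGProcess a H P μ) {s : ℕ → ℝ} (hs : Monotone s)
    {M : ℕ} (hH : ∀ i ≤ M + 1, H (gridCell s M i) ≠ 0)
    {lam : ℝ} (hlam : 0 < lam) (hlarge : lam / 2 ≤ Real.sqrt a) :
    μ {ω | ∃ k ≤ M, lam < Real.sqrt a * |(P ω).real (Iic (s k)) - H.real (Iic (s k))|} ≤
      ENNReal.ofReal (4 * Real.exp (-(lam ^ 2 / 64))) := by
  have := hP.measure_exists_gt ha hs hH Finset.univ one_pos le_rfl hlam
    (sum_measureReal_gridCell H hs).le (by rwa [mul_one])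
  rw [mul_one] at this
  refine le_trans (measure_mono ?_) this
  rintro ω ⟨k, hk, hlt⟩
  refine ⟨k + 1, ?_⟩
  rw [Fin.sum_univ_eq_sum_range (fun i => if i < k + 1 then
      (P ω).real (gridCell s M i) - H.real (gridCell s M i) else 0), ← Finset.sum_filter,
    show (Finset.range (M + 1 + 1)).filter (fun i => i < k + 1) = Finset.range (k + 1) by
      ext i; simp only [Finset.mem_filter, Finset.mem_range]; omega,
    Finset.sum_sub_distrib, sum_range_measureReal_gridCell _ hs hk,
    sum_range_measureReal_gridCell _ hs hk]
  exact hlt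


/-! ### Finite-dimensional convergence. -/

/-- Fatou's lemma for images of measures with converging densities under converging maps. -/
lemma map_withDensity_le_liminf {X E : Type*} [MeasurableSpace X] {m : Measure X}
    [TopologicalSpace E] [MeasurableSpace E] [OpensMeasurableSpace E]
    {f : ℕ → X → ℝ≥0∞} {g : X → ℝ≥0∞} {Ψ : ℕ → X → E} {Φ : X → E}
    (hf : ∀ n, Measurable (f n))
    (hΨ : ∀ n, Measurable (Ψ n)) (hΦ : Measurable Φ)
    (hfg : ∀ x, Tendsto (fun n => f n x) atTop (𝓝 (g x)))
    (hΨΦ : ∀ x, Tendsto (fun n => Ψ n x) atTop (𝓝 (Φ x))) {G : Set E} (hG : IsOpen G) :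
    (m.withDensity g).map Φ G ≤ liminf (fun n => (m.withDensity (f n)).map (Ψ n) G) atTop := by
  have hval : ∀ {h : X → ℝ≥0∞} {Θ : X → E}, Measurable Θ →
      (m.withDensity h).map Θ G = ∫⁻ x, (Θ ⁻¹' G).indicator h x ∂m := fun {h Θ} hΘ => by
    rw [Measure.map_apply hΘ hG.measurableSet, withDensity_apply _ (hΘ hG.measurableSet),
      lintegral_indicator (hΘ hG.measurableSet)]
  rw [hval hΦ]
  simp_rw [fun n => hval (h := f n) (hΨ n)]
  refine le_trans (lintegral_mono fun x => ?_)
    (lintegral_liminf_le fun n => (hf n).indicator (hΨ n hG.measurableSet))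
  by_cases hx : Φ x ∈ G
  -- Openness of `G` is used here: if the limit point lies in `G`, so do the approximating points
  -- eventually. Otherwise the left integrand vanishes.
  · have : ∀ᶠ n in atTop, f n x = (Ψ n ⁻¹' G).indicator (f n) x := by
      filter_upwards [(hΨΦ x).eventually (hG.mem_nhds hx)] with n hn
      rw [indicator_of_mem (show x ∈ Ψ n ⁻¹' G from hn)]
    rw [indicator_of_mem (show x ∈ Φ ⁻¹' G from hx), ((hfg x).congr' this).liminf_eq]
  · rw [indicator_of_notMem (show x ∉ Φ ⁻¹' G from hx)]
    exact zero_le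

lemma map_invGauss_eq_withDensity (α : ℝ) {r : ℝ} (hr : 0 < r) :
    (invGauss α).map (fun v => (v - α) / r) =
      volume.withDensity fun x => ENNReal.ofReal (r * invGaussPDF α 1 (α + r * x)) := by
  have hpdf := measurable_invGaussPDF α 1
  refine Measure.ext_of_lintegral _ fun f hf => ?_
  have hf' : Measurable fun v : ℝ => f ((v - α) / r) := hf.comp (by fun_prop)
  have hpdf' : Measurable fun x => ENNReal.ofReal (r * invGaussPDF α 1 (α + r * x)) :=
    ((hpdf.comp (by fun_prop : Measurable fun x : ℝ => α + r * x)).const_mul _).ennreal_ofReal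
  rw [lintegral_map hf (by fun_prop), invGauss,
    lintegral_withDensity_eq_lintegral_mul _ hpdf.ennreal_ofReal hf',
    lintegral_withDensity_eq_lintegral_mul _ hpdf' hf]
  have himg : (fun x : ℝ => α + r * x) '' univ = univ := by
    refine eq_univ_of_forall fun y => ⟨(y - α) / r, mem_univ _, ?_⟩
    field_simp
    ring
  have := lintegral_image_eq_lintegral_abs_deriv_mul (f := fun x : ℝ => α + r * x)
    (f' := fun _ => r) MeasurableSet.univ
    (fun x _ => HasDerivAt.hasDerivWithinAt
      (by simpa using (((hasDerivAt_id x).const_mul r).const_add α)))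
    (fun x _ y _ hxy => by
      simp only [add_right_inj] at hxy
      exact mul_left_cancel₀ hr.ne' hxy)
    ((fun v => ENNReal.ofReal (invGaussPDF α 1 v)) * fun v => f ((v - α) / r))
  rw [himg, setLIntegral_univ, setLIntegral_univ] at this
  rw [this]
  refine lintegral_congr fun x => ?_
  simp only [Pi.mul_apply, abs_of_pos hr]
  rw [ENNReal.ofReal_mul hr.le, mul_assoc]
  congr 4
  field_simp
  ring

/-- A local limit theorem by inspection: at `r ^ 2 (p + x / r)` all powers of `r` cancel and the
exponent is exactly `-x ^ 2 / (2 (p + x / r))`. -/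
lemma tendsto_rescaled_invGaussPDF {p : ℝ} (hp : 0 < p) (x : ℝ) :
    Tendsto (fun r : ℝ => r * invGaussPDF (r ^ 2 * p) 1 (r ^ 2 * p + r * x)) atTop
      (𝓝 (gaussianPDFReal 0 p.toNNReal x)) := by
  have hq : Tendsto (fun r : ℝ => p + x / r) atTop (𝓝 p) := by
    have : Tendsto (fun r : ℝ => x / r) atTop (𝓝 0) := tendsto_const_nhds.div_atTop tendsto_id
    simpa using this.const_add p
  have h1 : Tendsto (fun r : ℝ => p / Real.sqrt (2 * Real.pi) * (p + x / r) ^ (-(3 : ℝ) / 2) *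
      Real.exp (-x ^ 2 / (2 * (p + x / r)))) atTop
      (𝓝 (p / Real.sqrt (2 * Real.pi) * p ^ (-(3 : ℝ) / 2) * Real.exp (-x ^ 2 / (2 * p)))) := by
    refine ((hq.rpow_const (Or.inl hp.ne')).const_mul _).mul ?_
    refine (Real.continuous_exp.tendsto _).comp ?_
    exact tendsto_const_nhds.div (hq.const_mul 2) (by positivity)
  have h2 : gaussianPDFReal 0 p.toNNReal x =
      p / Real.sqrt (2 * Real.pi) * p ^ (-(3 : ℝ) / 2) * Real.exp (-x ^ 2 / (2 * p)) := by
    rw [gaussianPDFReal, Real.coe_toNNReal _ hp.le, sub_zero, Real.sqrt_mul (by positivity) p,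
      show (-(3 : ℝ) / 2) = -1 + -(1 / 2) by norm_num, Real.rpow_add hp, Real.rpow_neg_one,
      Real.rpow_neg hp.le, ← Real.sqrt_eq_rpow]
    field_simp
  rw [h2]
  refine h1.congr' ?_
  filter_upwards [eventually_gt_atTop 0, hq.eventually (lt_mem_nhds hp)] with r hr hpos
  have he : r ^ 2 * p + r * x = r ^ 2 * (p + x / r) := by field_simp
  rw [he, invGaussPDF, if_pos (by positivity), Real.mul_rpow (by positivity) hpos.le]
  have hr3 : (r ^ 2 : ℝ) ^ (-(3 : ℝ) / 2) = (r ^ 3)⁻¹ := by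
    rw [← Real.rpow_natCast, ← Real.rpow_mul hr.le, ← Real.rpow_natCast, ← Real.rpow_neg hr.le]
    norm_num
  have hex : -(1 * (r ^ 2 * (p + x / r)) - r ^ 2 * p) ^ 2 / (2 * (r ^ 2 * (p + x / r))) =
      -x ^ 2 / (2 * (p + x / r)) := by
    have e1 : 1 * (r ^ 2 * (p + x / r)) - r ^ 2 * p = r * x := by field_simp; ring
    rw [e1]
    have := hpos.ne'
    rw [div_eq_div_iff (by positivity) (by positivity)]
    ring
  rw [hr3, hex]
  field_simp

lemma pi_gaussianReal_eq_withDensity {n : ℕ} {p : Fin n → ℝ} (hp : ∀ i, 0 < p i) :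
    Measure.pi (fun i => gaussianReal 0 (p i).toNNReal) =
      (volume : Measure (Fin n → ℝ)).withDensity
        fun x => ∏ i, gaussianPDF 0 (p i).toNNReal (x i) := by
  have h : ∀ i, gaussianReal 0 (p i).toNNReal =
      volume.withDensity (gaussianPDF 0 (p i).toNNReal) := fun i =>
    gaussianReal_of_var_ne_zero _ (by simpa using hp i)
  have : ∀ i, SigmaFinite ((volume : Measure ℝ).withDensity (gaussianPDF 0 (p i).toNNReal)) :=
    fun i => by rw [← h]; infer_instance
  simp_rw [h]
  exact pi_withDensity_fin (fun _ => (volume : Measure ℝ)) fun i => measurable_gaussianPDF _ _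

/-- The characteristic function of a Gaussian vector involves only the mean and variance of each
functional; expansion in coordinates reduces these to means and covariances of the entries. -/
lemma ProbabilityTheory.HasGaussianLaw.integral_and_variance_dual {ι Ω : Type*} [Fintype ι] [DecidableEq ι]
    [MeasurableSpace Ω] {μ : Measure Ω} [IsProbabilityMeasure μ] {X : Ω → ι → ℝ}
    (hX : HasGaussianLaw X μ) (L : StrongDual ℝ (ι → ℝ)) :
    ∫ ω, L (X ω) ∂μ = ∑ i, L (Pi.single i 1) * ∫ ω, X ω i ∂μ ∧
      Var[fun ω => L (X ω); μ] = ∑ i, ∑ j, L (Pi.single i 1) *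
        (L (Pi.single j 1) * cov[fun ω => X ω i, fun ω => X ω j; μ]) := by
  have hL : ∀ ω, L (X ω) = ∑ i, L (Pi.single i 1) * X ω i := fun ω => by
    conv_lhs => rw [← Finset.univ_sum_single (X ω)]
    rw [map_sum]
    refine Finset.sum_congr rfl fun i _ => ?_
    have : (Pi.single i (X ω i) : ι → ℝ) = X ω i • Pi.single i (1 : ℝ) := by
      rw [← Pi.single_smul]; simp
    rw [this, map_smul, smul_eq_mul, mul_comm]
  have hi : ∀ i, HasGaussianLaw (fun ω => X ω i) μ := fun i =>
    hX.map_fun (ContinuousLinearMap.proj (R := ℝ) (φ := fun _ : ι => ℝ) i)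
  simp_rw [hL]
  constructor
  · rw [integral_finsetSum _ fun i _ => (hi i).integrable.const_mul _]
    simp_rw [integral_const_mul]
  · rw [variance_fun_sum fun i => (hi i).memLp_two.const_mul _]
    simp_rw [covariance_const_mul_left, covariance_const_mul_right]

/-- Two Gaussian vectors with the same means and covariances have the same law. -/
lemma ProbabilityTheory.HasGaussianLaw.map_eq_map {ι Ω Ω' : Type*} [Finite ι] [MeasurableSpace Ω]
    [MeasurableSpace Ω'] {μ : Measure Ω} {ν : Measure Ω'} {X : Ω → ι → ℝ} {Z : Ω' → ι → ℝ}
    (hX : HasGaussianLaw X μ) (hZ : HasGaussianLaw Z ν)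
    (hmean : ∀ i, ∫ ω, X ω i ∂μ = ∫ ω, Z ω i ∂ν)
    (hcov : ∀ i j, cov[fun ω => X ω i, fun ω => X ω j; μ] =
      cov[fun ω => Z ω i, fun ω => Z ω j; ν]) : μ.map X = ν.map Z := by
  classical
  have := Fintype.ofFinite ι
  have := hX.isProbabilityMeasure
  have := hZ.isProbabilityMeasure
  have := Measure.isProbabilityMeasure_map (μ := μ) hX.aemeasurable
  have := Measure.isProbabilityMeasure_map (μ := ν) hZ.aemeasurable
  apply Measure.ext_of_charFunDual
  ext L
  rw [hX.charFunDual_map_eq_fun, hZ.charFunDual_map_eq_fun, (hX.integral_and_variance_dual L).1,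
    (hX.integral_and_variance_dual L).2, (hZ.integral_and_variance_dual L).1,
    (hZ.integral_and_variance_dual L).2]
  simp_rw [hmean, hcov]

/-- The image of the product of centred normal distributions under a linear map is Gaussian. -/
lemma hasGaussianLaw_pi_gaussianReal_linear {n : ℕ} {κ : Type*} [Finite κ] (p : Fin n → ℝ)
    (hp : ∀ i, 0 ≤ p i) (c : κ → Fin n → ℝ) :
    HasGaussianLaw (fun (x : Fin n → ℝ) k => ∑ i, c k i * x i)
        (Measure.pi fun i => gaussianReal 0 (p i).toNNReal) ∧
      (∀ k, ∫ x, ∑ i, c k i * x i ∂(Measure.pi fun i => gaussianReal 0 (p i).toNNReal) = 0) ∧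
      ∀ k l, cov[fun x : Fin n → ℝ => ∑ i, c k i * x i, fun x => ∑ i, c l i * x i;
        Measure.pi fun i => gaussianReal 0 (p i).toNNReal] = ∑ i, c k i * c l i * p i := by
  have := Fintype.ofFinite κ
  set m := Measure.pi fun i => gaussianReal 0 (p i).toNNReal with hm
  have heval : ∀ i, HasGaussianLaw (fun x : Fin n → ℝ => x i) m := fun i =>
    ⟨by
      rw [hm, (measurePreserving_eval (fun i => gaussianReal 0 (p i).toNNReal) i).map_eq]
      infer_instance⟩
  have hind : iIndepFun (fun i (x : Fin n → ℝ) => x i) m :=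
    iIndepFun_pi (X := fun _ => id) fun _ => aemeasurable_id
  have hmean : ∀ i, ∫ x : Fin n → ℝ, x i ∂m = 0 := fun i => by
    rw [hm, integral_eval, integral_id_gaussianReal]
  have hcov : ∀ i j, cov[fun x : Fin n → ℝ => x i, fun x => x j; m] = if i = j then p i else 0 := by
    intro i j
    split_ifs with h
    · subst h
      rw [covariance_self (measurable_pi_apply i).aemeasurable]
      have := (measurePreserving_eval (fun i => gaussianReal 0 (p i).toNNReal) i)
      have h2 := variance_map (μ := m) (X := fun y : ℝ => y) (Y := fun x : Fin n → ℝ => x i)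
        aemeasurable_id (measurable_pi_apply i).aemeasurable
      change _ = Var[fun x : Fin n → ℝ => x i; m] at h2
      rw [← h2]
      change Var[fun y : ℝ => y; Measure.map (Function.eval i) m] = _
      rw [hm, this.map_eq, variance_fun_id_gaussianReal, Real.coe_toNNReal _ (hp i)]
    · exact (hind.indepFun h).covariance_eq_zero (heval i).memLp_two (heval j).memLp_two
  refine ⟨?_, fun k => ?_, fun k l => ?_⟩
  · have hall : HasGaussianLaw (fun x : Fin n → ℝ => fun i => x i) m :=
      hind.hasGaussianLaw heval
    have := hall.map_fun (ContinuousLinearMap.pi fun k : κ =>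
      ∑ i, c k i • ContinuousLinearMap.proj (R := ℝ) (φ := fun _ : Fin n => ℝ) i)
    refine this.congr (Eventually.of_forall fun x => ?_)
    ext k
    simp
  · rw [integral_finsetSum _ fun i _ => (heval i).integrable.const_mul _]
    simp [integral_const_mul, hmean]
  · rw [covariance_fun_sum_fun_sum (fun i => (heval i).memLp_two.const_mul _)
      fun i => (heval i).memLp_two.const_mul _]
    simp_rw [covariance_const_mul_left, covariance_const_mul_right, hcov]
    refine Finset.sum_congr rfl fun i _ => ?_
    simp [mul_assoc]

lemma map_pi_invGauss_eq_withDensity {n : ℕ} {p : Fin n → ℝ} (hp : ∀ i, 0 < p i) {r : ℝ}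
    (hr : 0 < r) :
    (Measure.pi fun i => invGauss (r ^ 2 * p i)).map (fun v i => (v i - r ^ 2 * p i) / r) =
      (volume : Measure (Fin n → ℝ)).withDensity fun x =>
        ∏ i, ENNReal.ofReal (r * invGaussPDF (r ^ 2 * p i) 1 (r ^ 2 * p i + r * x i)) := by
  have := fun i => isProbabilityMeasure_invGauss (α := r ^ 2 * p i) (by have := hp i; positivity)
  have hprob : ∀ i, IsProbabilityMeasure ((invGauss (r ^ 2 * p i)).map
      fun v => (v - r ^ 2 * p i) / r) := fun i => Measure.isProbabilityMeasure_map (by fun_prop)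
  have hdens : ∀ i, Measurable fun x =>
      ENNReal.ofReal (r * invGaussPDF (r ^ 2 * p i) 1 (r ^ 2 * p i + r * x)) := fun i =>
    (((measurable_invGaussPDF _ _).comp
      (by fun_prop : Measurable fun x : ℝ => r ^ 2 * p i + r * x)).const_mul _).ennreal_ofReal
  have : ∀ i, SigmaFinite ((volume : Measure ℝ).withDensity fun x =>
      ENNReal.ofReal (r * invGaussPDF (r ^ 2 * p i) 1 (r ^ 2 * p i + r * x))) := fun i => by
    rw [← map_invGauss_eq_withDensity _ hr]; infer_instance
  rw [Measure.pi_map_pi (μ := fun i => invGauss (r ^ 2 * p i))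
    (f := fun i v => (v - r ^ 2 * p i) / r) fun i => by fun_prop]
  simp_rw [fun i => map_invGauss_eq_withDensity (r ^ 2 * p i) hr]
  exact pi_withDensity_fin (fun _ => (volume : Measure ℝ)) hdens

set_option maxHeartbeats 1000000 in
/-- Convergence of the finite-dimensional distributions of rescaled normalized inverse-Gaussian
processes. -/
theorem tendstoInDistribution_nig_grid {H : Measure ℝ} [IsProbabilityMeasure H]
    {a : ℕ → ℝ} (ha_pos : ∀ n, 0 < a n) (ha : Tendsto a atTop atTop)
    {Ω : ℕ → Type*} [∀ n, MeasurableSpace (Ω n)]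
    {μ : ∀ n, Measure (Ω n)} [∀ n, IsProbabilityMeasure (μ n)]
    {P : ∀ n, Kernel (Ω n) ℝ} [∀ n, IsMarkovKernel (P n)]
    (hP : ∀ n, IsNIGProcess (a n) H (P n) (μ n))
    {s : ℕ → ℝ} (hs : Monotone s) {M : ℕ} (hH : ∀ i ≤ M + 1, H (gridCell s M i) ≠ 0)
    {Ω' : Type*} [MeasurableSpace Ω'] {ν : Measure Ω'} [IsProbabilityMeasure ν]
    {Z : Ω' → Fin (M + 1) → ℝ} (hZ : HasGaussianLaw Z ν) (hZ0 : ∀ k, ∫ ω, Z ω k ∂ν = 0)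
    (hZcov : ∀ k l, cov[fun ω => Z ω k, fun ω => Z ω l; ν] =
      min (H.real (Iic (s k))) (H.real (Iic (s l))) - H.real (Iic (s k)) * H.real (Iic (s l))) :
    TendstoInDistribution (fun n ω (k : Fin (M + 1)) =>
      Real.sqrt (a n) * ((P n ω).real (Iic (s k)) - H.real (Iic (s k)))) atTop Z μ ν := by
  set p : Fin (M + 1 + 1) → ℝ := fun i => H.real (gridCell s M i) with hpdef
  have hp : ∀ i, 0 < p i := fun i => ENNReal.toReal_pos (hH i (by omega)) (measure_ne_top _ _)
  have hp1 : ∑ i, p i = 1 := sum_measureReal_gridCell H hs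
  set r : ℕ → ℝ := fun n => Real.sqrt (a n) with hrdef
  have hr : ∀ n, 0 < r n := fun n => Real.sqrt_pos.2 (ha_pos n)
  have hra : ∀ n, r n ^ 2 = a n := fun n => Real.sq_sqrt (ha_pos n).le
  have hrt : Tendsto r atTop atTop := Real.tendsto_sqrt_atTop.comp ha
  have hpre : ∀ (g : ℕ → ℝ) (k : Fin (M + 1)), (∑ i : Fin (M + 1 + 1),
      if (i : ℕ) ≤ k then g i else 0) = ∑ i ∈ Finset.range (k + 1), g i := fun g k => by
    rw [Fin.sum_univ_eq_sum_range (fun i => if i ≤ (k : ℕ) then g i else 0), ← Finset.sum_filter]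
    refine Finset.sum_congr ?_ fun _ _ => rfl
    ext i
    simp only [Finset.mem_filter, Finset.mem_range]
    omega
  have hcum : ∀ (m : Measure ℝ) [IsProbabilityMeasure m] (k : Fin (M + 1)),
      (∑ i : Fin (M + 1 + 1), if (i : ℕ) ≤ k then m.real (gridCell s M i) else 0) =
        m.real (Iic (s k)) := fun m _ k => by
    rw [hpre (fun i => m.real (gridCell s M i)),
      sum_range_measureReal_gridCell m hs (by omega)]
  set h : Fin (M + 1) → ℝ := fun k => H.real (Iic (s k)) with hhdef
  have hcumH : ∀ k : Fin (M + 1), (∑ i : Fin (M + 1 + 1), if (i : ℕ) ≤ k then p i else 0) = h k :=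
    fun k => hcum H k
  have hZcov' : ∀ k l, cov[fun ω => Z ω k, fun ω => Z ω l; ν] = min (h k) (h l) - h k * h l := hZcov
  set T : ℝ → (Fin (M + 1 + 1) → ℝ) → Fin (M + 1) → ℝ := fun ρ z k =>
    ρ * ((∑ i : Fin (M + 1 + 1), if (i : ℕ) ≤ k then z i else 0) - h k) with hTdef
  have hTm : ∀ ρ, Measurable (T ρ) := fun ρ => by
    refine measurable_pi_iff.2 fun k => ?_
    refine ((Finset.measurable_sum _ fun i _ => ?_).sub_const _).const_mul _
    split_ifs <;> fun_prop
  -- The process on the grid as a function of the standardized variables `x i = (v i - a p i) / √a`,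
  -- with `a = r n ^ 2`.
  set Ψ : ℕ → (Fin (M + 1 + 1) → ℝ) → Fin (M + 1) → ℝ := fun n x =>
    T (r n) fun i => (r n ^ 2 * p i + r n * x i) / ∑ j, (r n ^ 2 * p j + r n * x j) with hΨdef
  -- The coefficients of the linearized normalization. Applied to independent centred normal
  -- variables of variances `p i`, they produce the bridge covariance.
  set c : Fin (M + 1) → Fin (M + 1 + 1) → ℝ := fun k i => (if (i : ℕ) ≤ k then 1 else 0) - h k
    with hcdef
  set Φ : (Fin (M + 1 + 1) → ℝ) → Fin (M + 1) → ℝ := fun x k => ∑ i, c k i * x i with hΦdef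
  have hΨm : ∀ n, Measurable (Ψ n) := fun n =>
    (hTm _).comp (measurable_pi_iff.2 fun i => by fun_prop)
  have hΦm : Measurable Φ := measurable_pi_iff.2 fun k => by fun_prop
  have hcell : ∀ n, Measurable fun ω => fun i : Fin (M + 1 + 1) => (P n ω).real (gridCell s M i) :=
    fun n => measurable_pi_iff.2 fun i =>
      (Kernel.measurable_coe (P n) (measurableSet_gridCell s M i)).ennreal_toReal
  have hX : ∀ n, (fun ω (k : Fin (M + 1)) =>
      Real.sqrt (a n) * ((P n ω).real (Iic (s k)) - H.real (Iic (s k)))) =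
      fun ω => T (r n) fun i : Fin (M + 1 + 1) => (P n ω).real (gridCell s M i) := fun n => by
    ext ω k
    simp only [hTdef, hcum, hrdef, hhdef]
  have hXm : ∀ n, Measurable fun ω (k : Fin (M + 1)) =>
      Real.sqrt (a n) * ((P n ω).real (Iic (s k)) - H.real (Iic (s k))) := fun n => by
    rw [hX]
    exact (hTm _).comp (hcell n)
  have hlaw : ∀ n, (μ n).map (fun ω (k : Fin (M + 1)) =>
      Real.sqrt (a n) * ((P n ω).real (Iic (s k)) - H.real (Iic (s k)))) =
      ((volume : Measure (Fin (M + 1 + 1) → ℝ)).withDensity fun x => ∏ i, ENNReal.ofReal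
        (r n * invGaussPDF (r n ^ 2 * p i) 1 (r n ^ 2 * p i + r n * x i))).map (Ψ n) := by
    intro n
    have hcm : Measurable fun (v : Fin (M + 1 + 1) → ℝ) i => (v i - r n ^ 2 * p i) / r n :=
      measurable_pi_iff.2 fun i => by fun_prop
    rw [← map_pi_invGauss_eq_withDensity hp (hr n), Measure.map_map (hΨm n) hcm]
    have hcomp : Ψ n ∘ (fun (v : Fin (M + 1 + 1) → ℝ) i => (v i - r n ^ 2 * p i) / r n) =
        fun v => T (r n) fun i => v i / ∑ j, v j := by
      funext v
      have : ∀ i, r n ^ 2 * p i + r n * ((v i - r n ^ 2 * p i) / r n) = v i := fun i => by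
        have := (hr n).ne'
        field_simp
        ring
      simp only [hΨdef, Function.comp, this]
    rw [hcomp]
    refine Measure.ext fun E hE => ?_
    have hdiv : Measurable fun (v : Fin (M + 1 + 1) → ℝ) i => v i / ∑ j, v j :=
      measurable_pi_iff.2 fun i => by fun_prop
    have hTd : Measurable fun v : Fin (M + 1 + 1) → ℝ => T (r n) fun i => v i / ∑ j, v j :=
      (hTm _).comp hdiv
    rw [Measure.map_apply (hXm n) hE, Measure.map_apply hTd hE, hX]
    have := (hP n).measure_gridCell_mem (ha_pos n) hs hH (hTm (r n) hE)
    rw [← hra n] at this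
    exact this
  have hlim : ν.map Z = ((volume : Measure (Fin (M + 1 + 1) → ℝ)).withDensity fun x =>
      ∏ i, gaussianPDF 0 (p i).toNNReal (x i)).map Φ := by
    rw [← pi_gaussianReal_eq_withDensity hp]
    obtain ⟨hg, hg0, hgc⟩ := hasGaussianLaw_pi_gaussianReal_linear p (fun i => (hp i).le) c
    refine hZ.map_eq_map hg (fun k => by rw [hZ0, hg0]) fun k l => ?_
    rw [hZcov', hgc]
    have hmin : ∀ k l : Fin (M + 1), (∑ i : Fin (M + 1 + 1),
        (if (i : ℕ) ≤ k then (1 : ℝ) else 0) * (if (i : ℕ) ≤ l then (1 : ℝ) else 0) * p i) =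
          min (h k) (h l) := by
      have hle : ∀ k l : Fin (M + 1), k ≤ l → (∑ i : Fin (M + 1 + 1),
        (if (i : ℕ) ≤ k then (1 : ℝ) else 0) * (if (i : ℕ) ≤ l then (1 : ℝ) else 0) * p i) =
          min (h k) (h l) := fun k l hkl => by
        have hkl' : (k : ℕ) ≤ l := hkl
        rw [min_eq_left (show h k ≤ h l from measureReal_mono (Iic_subset_Iic.2 (hs hkl'))),
          ← hcumH k]
        refine Finset.sum_congr rfl fun i _ => ?_
        by_cases hi : (i : ℕ) ≤ k
        · simp [hi, hi.trans hkl']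
        · simp [hi]
      intro k l
      rcases le_total k l with hkl | hkl
      · exact hle k l hkl
      · rw [min_comm, ← hle l k hkl]
        exact Finset.sum_congr rfl fun i _ => by ring
    have hone : ∀ k : Fin (M + 1), (∑ i : Fin (M + 1 + 1),
        (if (i : ℕ) ≤ k then (1 : ℝ) else 0) * p i) = h k := fun k => by
      rw [← hcumH k]
      exact Finset.sum_congr rfl fun i _ => by split_ifs <;> simp
    have hexp : ∀ i, c k i * c l i * p i =
        (if (i : ℕ) ≤ k then (1 : ℝ) else 0) * (if (i : ℕ) ≤ l then (1 : ℝ) else 0) * p i -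
        h l * ((if (i : ℕ) ≤ k then (1 : ℝ) else 0) * p i) -
        h k * ((if (i : ℕ) ≤ l then (1 : ℝ) else 0) * p i) + h k * h l * p i := fun i => by
      simp only [hcdef]; ring
    simp_rw [hexp]
    rw [Finset.sum_add_distrib, Finset.sum_sub_distrib, Finset.sum_sub_distrib, hmin,
      ← Finset.mul_sum, ← Finset.mul_sum, ← Finset.mul_sum, hone, hone, hp1]
    ring
  refine ⟨fun n => (hXm n).aemeasurable, hZ.aemeasurable, ?_⟩
  -- By the portmanteau theorem, the lower bounds on open sets furnished by Fatou's lemma suffice.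
  refine tendsto_of_forall_isOpen_le_liminf' fun G hG => ?_
  change ν.map Z G ≤ liminf (fun n => (μ n).map (fun ω (k : Fin (M + 1)) =>
      Real.sqrt (a n) * ((P n ω).real (Iic (s k)) - H.real (Iic (s k)))) G) atTop
  simp_rw [hlim, hlaw]
  refine map_withDensity_le_liminf (fun n => Finset.measurable_prod _ fun i _ => ?_) hΨm hΦm
    (fun x => ?_) (fun x => ?_) hG
  · exact (((measurable_invGaussPDF _ _).comp (by fun_prop :
      Measurable fun x : Fin (M + 1 + 1) → ℝ => r n ^ 2 * p i + r n * x i)).const_mul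
        _).ennreal_ofReal
  · refine ENNReal.tendsto_finsetProd_of_ne_top _ (fun i _ => ?_) fun i _ => ?_
    · exact ENNReal.tendsto_ofReal ((tendsto_rescaled_invGaussPDF (hp i) (x i)).comp hrt)
    · exact ENNReal.ofReal_ne_top
  · refine tendsto_pi_nhds.2 fun k => ?_
    have hden : Tendsto (fun n => 1 + (∑ i, x i) / r n) atTop (𝓝 1) := by
      have : Tendsto (fun n => (∑ i, x i) / r n) atTop (𝓝 0) := tendsto_const_nhds.div_atTop hrt
      simpa using this.const_add 1
    have hlim' : Tendsto (fun n => Φ x k / (1 + (∑ i, x i) / r n)) atTop (𝓝 (Φ x k)) := by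
      have := (tendsto_const_nhds (x := Φ x k)).div hden one_ne_zero
      rw [div_one] at this
      exact this
    -- No Taylor expansion is needed: `Ψ n x k` equals `Φ x k / (1 + (∑ i, x i) / r n)` exactly,
    -- once the denominator is positive.
    refine hlim'.congr' ?_
    filter_upwards [hden.eventually (lt_mem_nhds one_pos)] with n hn
    have hrn := hr n
    have hS : ∑ j, (r n ^ 2 * p j + r n * x j) = r n ^ 2 * (1 + (∑ i, x i) / r n) := by
      rw [Finset.sum_add_distrib, ← Finset.mul_sum, ← Finset.mul_sum, hp1]
      field_simp
    have hnum : ∀ D : ℝ, (∑ i : Fin (M + 1 + 1), if (i : ℕ) ≤ k then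
        (r n ^ 2 * p i + r n * x i) / D else 0) =
        (r n ^ 2 * h k + r n * ∑ i : Fin (M + 1 + 1), if (i : ℕ) ≤ k then x i else 0) / D := by
      intro D
      rw [← hcumH k, Finset.mul_sum, Finset.mul_sum, ← Finset.sum_add_distrib, Finset.sum_div]
      exact Finset.sum_congr rfl fun i _ => by split_ifs <;> simp
    have hΦ : Φ x k = (∑ i : Fin (M + 1 + 1), if (i : ℕ) ≤ k then x i else 0) - h k * ∑ i, x i := by
      simp only [hΦdef, hcdef]
      rw [Finset.mul_sum, ← Finset.sum_sub_distrib]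
      exact Finset.sum_congr rfl fun i _ => by split_ifs <;> ring
    simp only [hΨdef, hTdef]
    rw [hS, hnum, hΦ]
    have hne : 1 + (∑ i, x i) / r n ≠ 0 := hn.ne'
    have hne' : r n + ∑ i, x i ≠ 0 := by
      intro h0
      apply hne
      field_simp
      rw [mul_zero]
      exact h0
    field_simp
    ring


/-! ### Convergence in distribution of random continuous functions. -/

/-- Where the two elements are within `η`, the Lipschitz bound applies; the exceptional event has
probability at most `η` and costs at most `C`. -/
lemma abs_integral_comp_sub_le {Ω E : Type*} [MeasurableSpace Ω] {μ : Measure Ω}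
    [IsProbabilityMeasure μ] [MetricSpace E] [SecondCountableTopology E] [MeasurableSpace E]
    [BorelSpace E] {X Y : Ω → E} (hX : AEMeasurable X μ) (hY : AEMeasurable Y μ)
    {f : E → ℝ} {C : ℝ} {L : NNReal} (hC : ∀ x y, dist (f x) (f y) ≤ C) (hL : LipschitzWith L f)
    {η : ℝ} (hη : 0 < η) (hμ : μ {ω | η < dist (X ω) (Y ω)} ≤ ENNReal.ofReal η) :
    |∫ ω, f (X ω) ∂μ - ∫ ω, f (Y ω) ∂μ| ≤ (L + C) * η := by
  have hf : Continuous f := hL.continuous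
  rcases isEmpty_or_nonempty E with hE | ⟨⟨x₀⟩⟩
  · have : IsEmpty Ω := ⟨fun ω => hE.elim (X ω)⟩
    exact absurd (IsProbabilityMeasure.ne_zero μ) (by simp [Measure.eq_zero_of_isEmpty])
  have hC0 : 0 ≤ C := dist_nonneg.trans (hC x₀ x₀)
  have hint : ∀ {Z : Ω → E}, AEMeasurable Z μ → Integrable (fun ω => f (Z ω)) μ := fun {Z} hZ => by
    refine Integrable.of_bound (hf.measurable.comp_aemeasurable hZ).aestronglyMeasurable
      (|f x₀| + C) (ae_of_all _ fun ω => ?_)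
    have := hC (Z ω) x₀
    rw [Real.dist_eq] at this
    rw [Real.norm_eq_abs]
    linarith [abs_sub_abs_le_abs_sub (f (Z ω)) (f x₀)]
  rw [← integral_sub (hint hX) (hint hY), ← Real.norm_eq_abs]
  set S : Set Ω := {ω | η < dist (X ω) (Y ω)} with hS
  have hSm : NullMeasurableSet S μ := nullMeasurableSet_lt aemeasurable_const (hX.dist hY)
  have hSi : Integrable (S.indicator fun _ => C) μ :=
    (integrable_const C).indicator₀ hSm
  calc ‖∫ ω, f (X ω) - f (Y ω) ∂μ‖ ≤ ∫ ω, (L * η + S.indicator (fun _ => C) ω) ∂μ := by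
        refine norm_integral_le_of_norm_le ((integrable_const _).add hSi) (ae_of_all _ fun ω => ?_)
        rw [← dist_eq_norm]
        by_cases hω : ω ∈ S
        · rw [indicator_of_mem hω]
          have := hC (X ω) (Y ω)
          have h0 : 0 ≤ (L : ℝ) * η := by positivity
          linarith
        · rw [indicator_of_notMem hω, add_zero]
          refine (hL.dist_le_mul _ _).trans ?_
          have : dist (X ω) (Y ω) ≤ η := not_lt.1 hω
          gcongr
    _ = L * η + C * μ.real S := by
        rw [integral_add (integrable_const _) hSi, integral_indicator₀ hSm]
        simp [mul_comm]
    _ ≤ (L + C) * η := by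
        have : μ.real S ≤ η := ENNReal.toReal_le_of_le_ofReal hη.le hμ
        nlinarith

/-- Random elements that are close in probability, uniformly in the limit, to sequences that
converge in distribution, themselves converge in distribution. -/
lemma tendstoInDistribution_of_forall_approx {Ω : ℕ → Type*} [∀ n, MeasurableSpace (Ω n)]
    {μ : ∀ n, Measure (Ω n)} [∀ n, IsProbabilityMeasure (μ n)] {Ω' : Type*} [MeasurableSpace Ω']
    {ν : Measure Ω'} [IsProbabilityMeasure ν] {E : Type*} [MetricSpace E]
    [SecondCountableTopology E] [MeasurableSpace E] [BorelSpace E] {Y : ∀ n, Ω n → E}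
    {W : Ω' → E} (hY : ∀ n, AEMeasurable (Y n) (μ n)) (hW : AEMeasurable W ν)
    (happ : ∀ η : ℝ, 0 < η → ∃ (Z : ∀ n, Ω n → E) (V : Ω' → E),
      TendstoInDistribution Z atTop V μ ν ∧
      (∀ᶠ n in atTop, μ n {ω | η < dist (Y n ω) (Z n ω)} ≤ ENNReal.ofReal η) ∧
      ν {ω | η < dist (V ω) (W ω)} ≤ ENNReal.ofReal η) :
    TendstoInDistribution Y atTop W μ ν := by
  refine ⟨hY, hW, ?_⟩
  refine tendsto_iff_forall_lipschitz_integral_tendsto.2 ?_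
  rintro f ⟨C, hC⟩ ⟨L, hL⟩
  have hf : Continuous f := hL.continuous
  have hmapW : ∫ x, f x ∂(ν.map W) = ∫ ω, f (W ω) ∂ν :=
    integral_map hW hf.measurable.aestronglyMeasurable
  change Tendsto (fun n => ∫ x, f x ∂((μ n).map (Y n))) atTop (𝓝 (∫ x, f x ∂(ν.map W)))
  rw [hmapW]
  refine (Metric.tendsto_nhds (α := ℝ)).2 fun ε hε => ?_
  -- The maximum with `1` guards against `L = C = 0`, so that `η` can be defined by division.
  have hK : 0 < (L : ℝ) + max C 1 := by positivity
  set η := ε / (4 * ((L : ℝ) + max C 1)) with hηdef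
  have hη : 0 < η := by positivity
  have hKη : ((L : ℝ) + max C 1) * η = ε / 4 := by rw [hηdef]; field_simp
  obtain ⟨Z, V, hZV, hYZ, hVW⟩ := happ η hη
  have h1 := tendsto_iff_forall_lipschitz_integral_tendsto.1 hZV.tendsto
  have h2 : Tendsto (fun n => ∫ x, f x ∂((μ n).map (Z n))) atTop (𝓝 (∫ x, f x ∂(ν.map V))) :=
    h1 f ⟨C, hC⟩ ⟨L, hL⟩
  rw [integral_map hZV.aemeasurable_limit hf.measurable.aestronglyMeasurable] at h2
  have hC' : ∀ x y, dist (f x) (f y) ≤ max C 1 := fun x y => (hC x y).trans (le_max_left _ _)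
  have h3 := abs_integral_comp_sub_le hZV.aemeasurable_limit hW hC' hL hη hVW
  filter_upwards [hYZ, (Metric.tendsto_nhds (α := ℝ)).1 h2 (ε / 4) (by positivity)] with n hn hn'
  have h4 := abs_integral_comp_sub_le (hY n) (hZV.forall_aemeasurable n) hC' hL hη hn
  rw [integral_map (hY n) hf.measurable.aestronglyMeasurable]
  rw [integral_map (hZV.forall_aemeasurable n) hf.measurable.aestronglyMeasurable] at hn'
  rw [hKη] at h3 h4
  rw [Real.dist_eq] at hn' ⊢
  rw [abs_le] at h3 h4
  rw [abs_lt] at hn' ⊢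
  constructor <;> linarith [h3.1, h3.2, h4.1, h4.2, hn'.1, hn'.2]

/-- The points `p + (q - p) j / (M + 1)` of a regular grid on `[p, q]`. -/
noncomputable def gridPoint (p q : ℝ) (M j : ℕ) : ℝ := p + (q - p) * (j / (M + 1))

lemma gridPoint_mem {p q : ℝ} (hpq : p ≤ q) {M j : ℕ} (hj : j ≤ M + 1) :
    gridPoint p q M j ∈ Icc p q := by
  have h1 : (j : ℝ) / (M + 1) ≤ 1 := by
    rw [div_le_one (by positivity)]
    exact_mod_cast hj
  have h0 : (0 : ℝ) ≤ j / (M + 1) := by positivity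
  constructor <;> unfold gridPoint <;> nlinarith

lemma exists_gridPoint_near {p q : ℝ} (hpq : p < q) (M : ℕ) {t : ℝ} (ht : t ∈ Icc p q) :
    ∃ j ≤ M, |t - gridPoint p q M j| ≤ (q - p) / (M + 1) := by
  have hL : 0 < q - p := sub_pos.2 hpq
  set x := (t - p) / (q - p) * (M + 1) with hx
  have hx0 : 0 ≤ x := by
    have := ht.1
    have : 0 ≤ t - p := by linarith
    positivity
  have htx : t = p + (q - p) * (x / (M + 1)) := by
    rw [hx]; field_simp; ring
  have hxM : x ≤ M + 1 := by
    have : (t - p) / (q - p) ≤ 1 := by rw [div_le_one hL]; linarith [ht.2]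
    have h2 : (0 : ℝ) < M + 1 := by positivity
    nlinarith
  have key : ∀ j : ℕ, |x - j| ≤ 1 → |t - gridPoint p q M j| ≤ (q - p) / (M + 1) := fun j hj => by
    have : t - gridPoint p q M j = (q - p) / (M + 1) * (x - j) := by
      rw [htx]; unfold gridPoint; field_simp; ring
    rw [this, abs_mul, abs_of_pos (by positivity)]
    exact mul_le_of_le_one_right (by positivity) hj
  rcases lt_or_ge x (M + 1) with h | h
  · refine ⟨⌊x⌋₊, ?_, key _ ?_⟩
    · have : ⌊x⌋₊ < M + 1 := (Nat.floor_lt hx0).2 (by push_cast; exact h)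
      omega
    · rw [abs_le]
      constructor <;> linarith [Nat.floor_le hx0, Nat.lt_floor_add_one x]
  -- Only `t = q` arises here; `q` is not among the indices up to `M`, but the last of these points
  -- is one mesh width away.
  · refine ⟨M, le_rfl, key _ ?_⟩
    rw [abs_le]
    constructor <;> linarith

/-- A continuous partition of unity of `[p, q]` subordinate to the neighbourhoods of the points of
a grid. -/
lemma exists_grid_partition {p q : ℝ} (hpq : p < q) (M : ℕ) :
    ∃ φ : Fin (M + 1) → C(Icc p q, ℝ), (∀ j t, 0 ≤ φ j t) ∧ (∀ t, ∑ j, φ j t = 1) ∧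
      ∀ j t, φ j t ≠ 0 → |(t : ℝ) - gridPoint p q M j| ≤ 2 * (q - p) / (M + 1) := by
  have hL : 0 < q - p := sub_pos.2 hpq
  -- Hats of half-width two meshes: every `t` has a grid point within one mesh, so the sum of the
  -- hats never vanishes.
  set δ := 2 * (q - p) / (M + 1) with hδ
  set hat : Fin (M + 1) → Icc p q → ℝ := fun j t => max 0 (δ - |(t : ℝ) - gridPoint p q M j|)
    with hhat
  have hhc : ∀ j, Continuous (hat j) := fun j => by fun_prop
  have hh0 : ∀ j t, 0 ≤ hat j t := fun j t => le_max_left _ _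
  have hS : ∀ t, 0 < ∑ j, hat j t := fun t => by
    obtain ⟨j, hj, hjt⟩ := exists_gridPoint_near hpq M t.2
    refine Finset.sum_pos' (fun i _ => hh0 i t) ⟨⟨j, by omega⟩, Finset.mem_univ _, ?_⟩
    refine lt_max_of_lt_right ?_
    have : (q - p) / (M + 1) < δ := by
      rw [hδ, mul_div_assoc]
      have : 0 < (q - p) / ((M : ℝ) + 1) := by positivity
      linarith
    simp only
    linarith
  refine ⟨fun j => ⟨fun t => hat j t / ∑ i, hat i t, (hhc j).div
    (continuous_finsetSum _ fun i _ => hhc i) fun t => (hS t).ne'⟩, fun j t => ?_, fun t => ?_,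
    fun j t hjt => ?_⟩
  · exact div_nonneg (hh0 j t) (hS t).le
  · simp only [ContinuousMap.coe_mk]
    rw [← Finset.sum_div, div_self (hS t).ne']
  · by_contra! hcon
    apply hjt
    have : hat j t = 0 := max_eq_left (by linarith)
    simp [this]

section ContinuousPaths

variable {p q : ℝ}

/-- The interpolation `∑ x j • φ j`. -/
noncomputable def interpolate {N : ℕ} (φ : Fin N → C(Icc p q, ℝ)) (x : Fin N → ℝ) : C(Icc p q, ℝ) :=
  ∑ j, x j • φ j

lemma continuous_interpolate {N : ℕ} (φ : Fin N → C(Icc p q, ℝ)) : Continuous (interpolate φ) :=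
  continuous_finsetSum _ fun j _ => (continuous_apply j).smul continuous_const

/-- At each `t` the interpolation is a convex combination of those `x j` whose weight is nonzero,
all of them within `η` of `w t`. -/
lemma dist_interpolate_le {N : ℕ} {φ : Fin N → C(Icc p q, ℝ)} (h0 : ∀ j t, 0 ≤ φ j t)
    (h1 : ∀ t, ∑ j, φ j t = 1) {x : Fin N → ℝ} {w : C(Icc p q, ℝ)} {η : ℝ} (hη : 0 ≤ η)
    (hx : ∀ j t, φ j t ≠ 0 → |w t - x j| ≤ η) : dist w (interpolate φ x) ≤ η := by
  refine (ContinuousMap.dist_le hη).2 fun t => ?_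
  have hA : interpolate φ x t = ∑ j, φ j t * x j := by
    simp [interpolate, ContinuousMap.sum_apply, mul_comm]
  have hw : w t = ∑ j, φ j t * w t := by rw [← Finset.sum_mul, h1, one_mul]
  rw [Real.dist_eq, hA, hw, ← Finset.sum_sub_distrib]
  calc |∑ j, (φ j t * w t - φ j t * x j)| ≤ ∑ j, |φ j t * w t - φ j t * x j| :=
        Finset.abs_sum_le_sum_abs _ _
    _ ≤ ∑ j, φ j t * η := Finset.sum_le_sum fun j _ => by
        rw [← mul_sub, abs_mul, abs_of_nonneg (h0 j t)]
        by_cases hj : φ j t = 0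
        · simp [hj]
        · exact mul_le_mul_of_nonneg_left (hx j t hj) (h0 j t)
    _ = η := by rw [← Finset.sum_mul, h1, one_mul]

lemma tendsto_interpolate (hpq : p < q) {φ : ∀ M : ℕ, Fin (M + 1) → C(Icc p q, ℝ)}
    (h0 : ∀ M j t, 0 ≤ φ M j t) (h1 : ∀ M t, ∑ j, φ M j t = 1)
    (hφ : ∀ M j t, φ M j t ≠ 0 → |(t : ℝ) - gridPoint p q M j| ≤ 2 * (q - p) / (M + 1))
    (w : C(Icc p q, ℝ)) :
    Tendsto (fun M => interpolate (φ M) fun j =>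
      w ⟨gridPoint p q M j, gridPoint_mem hpq.le (by omega)⟩) atTop (𝓝 w) := by
  refine Metric.tendsto_atTop.2 fun ε hε => ?_
  obtain ⟨δ, hδ, hw⟩ := Metric.uniformContinuous_iff.1
    (CompactSpace.uniformContinuous_of_continuous w.continuous) (ε / 2) (by positivity)
  have hlim : Tendsto (fun M : ℕ => 2 * (q - p) / ((M : ℝ) + 1)) atTop (𝓝 0) :=
    tendsto_const_nhds.div_atTop (tendsto_natCast_atTop_atTop.atTop_add tendsto_const_nhds)
  obtain ⟨N, hN⟩ := eventually_atTop.1 (hlim.eventually (gt_mem_nhds hδ))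
  refine ⟨N, fun M hM => ?_⟩
  rw [dist_comm]
  refine lt_of_le_of_lt (dist_interpolate_le (h0 M) (h1 M) (η := ε / 2) (by positivity)
    fun j t hj => ?_) (by linarith)
  rw [← Real.dist_eq]
  refine (hw ?_).le
  rw [Subtype.dist_eq, Real.dist_eq]
  exact (hφ M j t hj).trans_lt (hN M hM)

/-- A random continuous function is the limit of its interpolations, each a continuous function of
finitely many coordinates. -/
lemma aemeasurable_continuousMap [MeasurableSpace C(Icc p q, ℝ)] [BorelSpace C(Icc p q, ℝ)]
    (hpq : p < q) {Ω : Type*} [MeasurableSpace Ω] {μ : Measure Ω} {Y : Ω → C(Icc p q, ℝ)}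
    (hY : ∀ t, AEMeasurable (fun ω => Y ω t) μ) : AEMeasurable Y μ := by
  choose φ h0 h1 hφ using exists_grid_partition hpq
  refine aemeasurable_of_tendsto_metrizable_ae' (f := fun M ω => interpolate (φ M) fun j =>
    Y ω ⟨gridPoint p q M j, gridPoint_mem hpq.le (by omega)⟩) (fun M => ?_)
    (ae_of_all _ fun ω => tendsto_interpolate hpq h0 h1 hφ (Y ω))
  exact (continuous_interpolate (φ M)).measurable.comp_aemeasurable
    (aemeasurable_pi_iff.2 fun j => hY _)

/-- Criterion for convergence in distribution in `C[p, q]`: convergence of the finite-dimensional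
distributions of approximating processes `X`, on grids. -/
lemma tendstoInDistribution_continuousMap [MeasurableSpace C(Icc p q, ℝ)]
    [BorelSpace C(Icc p q, ℝ)] (hpq : p < q) {Ω : ℕ → Type*} [∀ n, MeasurableSpace (Ω n)]
    {μ : ∀ n, Measure (Ω n)} [∀ n, IsProbabilityMeasure (μ n)] {Ω' : Type*} [MeasurableSpace Ω']
    {ν : Measure Ω'} [IsProbabilityMeasure ν] {Y : ∀ n, Ω n → C(Icc p q, ℝ)}
    {W : Ω' → C(Icc p q, ℝ)} {X : ∀ n, Icc p q → Ω n → ℝ}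
    (hY : ∀ n t, AEMeasurable (fun ω => Y n ω t) (μ n))
    (hX : ∀ M : ℕ, TendstoInDistribution (fun n ω (j : Fin (M + 1)) =>
      X n ⟨gridPoint p q M j, gridPoint_mem hpq.le (by omega)⟩ ω) atTop (fun ω (j : Fin (M + 1)) =>
        W ω ⟨gridPoint p q M j, gridPoint_mem hpq.le (by omega)⟩) μ ν)
    (hW : ∀ t, AEMeasurable (fun ω => W ω t) ν)
    (hXY : ∀ η : ℝ, 0 < η → ∃ δ : ℝ, 0 < δ ∧ ∀ᶠ n in atTop, μ n {ω | ¬ ∀ s t : Icc p q,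
      |(s : ℝ) - t| ≤ δ → |Y n ω s - X n t ω| ≤ η} ≤ ENNReal.ofReal η) :
    TendstoInDistribution Y atTop W μ ν := by
  choose φ h0 h1 hφ using exists_grid_partition hpq
  have hWm := aemeasurable_continuousMap hpq hW
  refine tendstoInDistribution_of_forall_approx
    (fun n => aemeasurable_continuousMap hpq (hY n)) hWm fun η hη => ?_
  obtain ⟨δ, hδ, hev⟩ := hXY η hη
  have hlim : Tendsto (fun M : ℕ => 2 * (q - p) / ((M : ℝ) + 1)) atTop (𝓝 0) :=
    tendsto_const_nhds.div_atTop (tendsto_natCast_atTop_atTop.atTop_add tendsto_const_nhds)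
  have hAm : ∀ M, AEMeasurable (fun ω => interpolate (φ M) fun j =>
      W ω ⟨gridPoint p q M j, gridPoint_mem hpq.le (by omega)⟩) ν := fun M =>
    (continuous_interpolate (φ M)).measurable.comp_aemeasurable (aemeasurable_pi_iff.2 fun j => hW _)
  have hprob := tendstoInMeasure_iff_dist.1 (tendstoInMeasure_of_tendsto_ae
    (fun M => (hAm M).aestronglyMeasurable)
    (ae_of_all ν fun ω => tendsto_interpolate hpq h0 h1 hφ (W ω))) η hη
  have hsmall := hprob.eventually (ge_mem_nhds (ENNReal.ofReal_pos.2 hη))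
  -- One grid serves both ends: twice its mesh is below `δ`, so `Y n` is near the interpolation of
  -- `X n`, and the limit `W` is near its own interpolation in probability.
  obtain ⟨M, hM1, hM2⟩ := ((hlim.eventually (gt_mem_nhds hδ)).and hsmall).exists
  refine ⟨fun n ω => interpolate (φ M) fun j =>
      X n ⟨gridPoint p q M j, gridPoint_mem hpq.le (by omega)⟩ ω,
    fun ω => interpolate (φ M) fun j =>
      W ω ⟨gridPoint p q M j, gridPoint_mem hpq.le (by omega)⟩,
    (hX M).continuous_comp (g := interpolate (φ M)) (continuous_interpolate (φ M)), ?_,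
    (measure_mono fun ω hω => ?_).trans hM2⟩
  swap
  · rw [mem_ofPred_eq] at hω ⊢
    exact hω.le
  filter_upwards [hev] with n hn
  refine (measure_mono fun ω hω => ?_).trans hn
  rw [mem_ofPred_eq] at hω ⊢
  intro hcl
  refine absurd hω (not_lt.2 (dist_interpolate_le (h0 M) (h1 M) hη.le fun j t hj => ?_))
  exact hcl _ _ ((hφ M j t hj).trans hM1.le)

end ContinuousPaths


/-! ### Quantile functions: regularity and inversion. -/

/-- A `C¹` function is uniformly differentiable on a compact interval. -/
lemma exists_forall_abs_sub_deriv_mul_le {f f' : ℝ → ℝ} {p q : ℝ} (hpq : p ≤ q)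
    (hf' : ContinuousOn f' (Icc p q)) (hf : ∀ t ∈ Icc p q, HasDerivAt f (f' t) t) {η : ℝ}
    (hη : 0 < η) : ∃ δ > 0, ∀ t ∈ Icc p q, ∀ r, |r - t| ≤ δ →
      |f r - f t - f' t * (r - t)| ≤ η * |r - t| := by
  obtain ⟨δ₁, hδ₁, h1⟩ := Metric.uniformContinuousOn_iff.1
    (isCompact_Icc.uniformContinuousOn_of_continuous hf') (η / 2) (by positivity)
  -- The point `r` may leave `[p, q]`, where `f'` is not controlled. The expansions at the two
  -- endpoints, valid on both sides, cover this case.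
  have hend : ∀ t ∈ Icc p q, ∃ δ > 0, ∀ r, |r - t| ≤ δ →
      |f r - f t - f' t * (r - t)| ≤ η / 2 * |r - t| := fun t ht => by
    have := (hasDerivAt_iff_isLittleO.1 (hf t ht)).def (c := η / 2) (by positivity)
    obtain ⟨δ, hδ, h⟩ := Metric.eventually_nhds_iff.1 this
    refine ⟨δ / 2, by positivity, fun r hr => ?_⟩
    have := h (y := r) (by rw [Real.dist_eq]; linarith)
    simpa [mul_comm] using this
  obtain ⟨δp, hδp, hp⟩ := hend p ⟨le_rfl, hpq⟩
  obtain ⟨δq, hδq, hq⟩ := hend q ⟨hpq, le_rfl⟩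
  have hmid : ∀ t ∈ Icc p q, ∀ r ∈ Icc p q, |r - t| < δ₁ →
      |f r - f t - f' t * (r - t)| ≤ η / 2 * |r - t| := fun t ht r hr hrt => by
    have hsub : uIcc t r ⊆ Icc p q := uIcc_subset_Icc ht hr
    have := (convex_uIcc t r).norm_image_sub_le_of_norm_hasDerivWithin_le
      (f := fun x => f x - f' t * x) (f' := fun x => f' x - f' t * 1) (C := η / 2) (x := t) (y := r)
      (fun x hx => ((hf x (hsub hx)).sub ((hasDerivAt_id x).const_mul (f' t))).hasDerivWithinAt)
      (fun x hx => by
        have hxt : |x - t| ≤ |r - t| := abs_sub_left_of_mem_uIcc hx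
        have := (h1 x (hsub hx) t ht (by rw [Real.dist_eq]; linarith)).le
        rw [Real.dist_eq] at this
        simpa using this) left_mem_uIcc right_mem_uIcc
    simp only [Real.norm_eq_abs] at this
    convert this using 2
    ring
  refine ⟨min (δ₁ / 2) (min δp δq), by positivity, fun t ht r hr => ?_⟩
  have hr1 : |r - t| < δ₁ := by linarith [hr.trans (min_le_left _ _)]
  have hrp : |r - t| ≤ δp := (hr.trans (min_le_right _ _)).trans (min_le_left _ _)
  have hrq : |r - t| ≤ δq := (hr.trans (min_le_right _ _)).trans (min_le_right _ _)
  -- Split the increment at the endpoint `e` between `t` and `r`, and replace `f' t` by `f' e` on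
  -- the outer piece.
  have hout : ∀ e ∈ Icc p q, |r - t| = |r - e| + |e - t| →
      |f r - f e - f' e * (r - e)| ≤ η / 2 * |r - e| →
      |f r - f t - f' t * (r - t)| ≤ η * |r - t| := fun e he hsum h2 => by
    have het : |e - t| < δ₁ := by linarith [abs_nonneg (r - e)]
    have h3 := hmid t ht e he het
    have h4 := (h1 e he t ht (by rwa [Real.dist_eq])).le
    rw [Real.dist_eq] at h4
    have h5 : |(f' e - f' t) * (r - e)| ≤ η / 2 * |r - e| := by
      rw [abs_mul]; exact mul_le_mul_of_nonneg_right h4 (abs_nonneg _)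
    have h6 : f r - f t - f' t * (r - t) = (f r - f e - f' e * (r - e)) +
      (f e - f t - f' t * (e - t)) + (f' e - f' t) * (r - e) := by ring
    have h7 : 0 ≤ η / 2 * |e - t| := by positivity
    rw [h6, hsum]
    refine (abs_add_three _ _ _).trans ?_
    linarith
  rcases lt_or_ge r p with h | h
  · refine hout p ⟨le_rfl, hpq⟩ ?_ (hp r ?_)
    · rw [abs_of_nonpos (by linarith [ht.1]), abs_of_nonpos (by linarith),
        abs_of_nonpos (by linarith [ht.1])]
      ring
    · refine le_trans ?_ hrp
      rw [abs_of_nonpos (by linarith), abs_of_nonpos (by linarith [ht.1])]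
      linarith [ht.1]
  rcases lt_or_ge q r with h' | h'
  · refine hout q ⟨hpq, le_rfl⟩ ?_ (hq r ?_)
    · rw [abs_of_nonneg (by linarith [ht.2]), abs_of_nonneg (by linarith),
        abs_of_nonneg (by linarith [ht.2])]
      ring
    · refine le_trans ?_ hrq
      rw [abs_of_nonneg (by linarith), abs_of_nonneg (by linarith [ht.2])]
      linarith [ht.2]
  · refine (hmid t ht r ⟨h, h'⟩ hr1).trans ?_
    have := abs_nonneg (r - t)
    nlinarith

section Quantile

variable (m : Measure ℝ) {t : ℝ}

lemma bddBelow_setOf_le_cdf (h0 : 0 < t) : BddBelow {x : ℝ | t ≤ cdf m x} := by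
  obtain ⟨x, hx⟩ := ((tendsto_cdf_atBot m).eventually (gt_mem_nhds h0)).exists
  refine ⟨x, fun y hy => ?_⟩
  by_contra! hlt
  exact absurd (lt_of_le_of_lt ((monotone_cdf m) hlt.le) hx) (not_lt.2 hy)

lemma nonempty_setOf_le_cdf (h1 : t < 1) : {x : ℝ | t ≤ cdf m x}.Nonempty := by
  obtain ⟨x, hx⟩ := ((tendsto_cdf_atTop m).eventually (lt_mem_nhds h1)).exists
  exact ⟨x, hx.le⟩

/-- Right continuity of the distribution function makes the infimum a minimum. This equivalence
replaces the definition of the quantile in almost all later arguments. -/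
lemma quantile_le_iff (h0 : 0 < t) (h1 : t < 1) {x : ℝ} : quantile m t ≤ x ↔ t ≤ cdf m x := by
  refine ⟨fun h => ?_, fun h => csInf_le (bddBelow_setOf_le_cdf m h0) h⟩
  have hge : ∀ y, x < y → t ≤ cdf m y := fun y hy => by
    obtain ⟨z, hz, hzy⟩ := exists_lt_of_csInf_lt (nonempty_setOf_le_cdf m h1)
      (lt_of_le_of_lt h hy)
    exact (show t ≤ cdf m z from hz).trans (monotone_cdf m hzy.le)
  have hc : Tendsto (cdf m) (𝓝[>] x) (𝓝 (cdf m x)) :=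
    ((cdf m).right_continuous x).mono_left (nhdsWithin_mono _ Ioi_subset_Ici_self)
  exact ge_of_tendsto hc (eventually_nhdsWithin_of_forall fun y hy => hge y hy)

lemma lt_quantile_iff (h0 : 0 < t) (h1 : t < 1) {x : ℝ} : x < quantile m t ↔ cdf m x < t := by
  rw [← not_le, quantile_le_iff m h0 h1, not_le]

lemma le_cdf_quantile (h0 : 0 < t) (h1 : t < 1) : t ≤ cdf m (quantile m t) :=
  (quantile_le_iff m h0 h1).1 le_rfl

lemma quantile_mono {s : ℝ} (h0 : 0 < s) (hst : s ≤ t) (h1 : t < 1) :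
    quantile m s ≤ quantile m t :=
  (quantile_le_iff m h0 (hst.trans_lt h1)).2 (hst.trans (le_cdf_quantile m (h0.trans_le hst) h1))

/-- Lower semicontinuity is automatic; the hypothesis excludes a flat piece of the distribution
function at level `t`, which would cause a jump to the right. -/
lemma continuousAt_quantile (h0 : 0 < t) (h1 : t < 1) (h : ∀ b, quantile m t < b → t < cdf m b) :
    ContinuousAt (quantile m) t := by
  have hI : ∀ᶠ s in 𝓝 t, s ∈ Ioo (0 : ℝ) 1 := Ioo_mem_nhds h0 h1
  refine tendsto_order.2 ⟨fun b hb => ?_, fun b hb => ?_⟩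
  · filter_upwards [hI, lt_mem_nhds ((lt_quantile_iff m h0 h1).1 hb)] with s hs hs'
    exact (lt_quantile_iff m hs.1 hs.2).2 hs'
  · obtain ⟨c, hc, hcb⟩ := exists_between hb
    filter_upwards [hI, gt_mem_nhds (h c hc)] with s hs hs'
    exact ((quantile_le_iff m hs.1 hs.2).2 hs'.le).trans_lt hcb

end Quantile

/-- Near `[p, q]`, the quantile function of a measure whose distribution function has a positive
derivative is the inverse of the distribution function, and is continuously differentiable. -/
lemma exists_quantile_regular {p q ε : ℝ} (hp : 0 < p) (hpq : p < q) (hq : q < 1) (hε : 0 < ε)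
    (H : Measure ℝ) [IsProbabilityMeasure H] {h : ℝ → ℝ}
    (hderiv : ∀ x ∈ Icc (quantile H p - ε) (quantile H q + ε),
      HasDerivWithinAt (fun y => cdf H y) (h x)
        (Icc (quantile H p - ε) (quantile H q + ε)) x)
    (hpos : ∀ x ∈ Icc (quantile H p - ε) (quantile H q + ε), 0 < h x)
    (hcont : ContinuousOn h (Icc (quantile H p) (quantile H q))) :
    ∃ p' q', 0 < p' ∧ p' < p ∧ q < q' ∧ q' < 1 ∧
      (∀ u ∈ Icc p' q', cdf H (quantile H u) = u) ∧
      (∀ y ∈ Icc (quantile H p') (quantile H q'), cdf H y ∈ Icc p' q' ∧ quantile H (cdf H y) = y) ∧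
      (∀ t ∈ Icc p q, HasDerivAt (quantile H) (1 / h (quantile H t)) t) ∧
      ContinuousOn (fun t => 1 / h (quantile H t)) (Icc p q) := by
  have hp1 : p < 1 := hpq.trans hq
  have hq0 : 0 < q := hp.trans hpq
  set x₀ := quantile H p with hx₀
  set x₁ := quantile H q with hx₁
  have hx01 : x₀ ≤ x₁ := quantile_mono H hp hpq.le hq
  set I := Icc (x₀ - ε) (x₁ + ε) with hI
  have hcdfc : ContinuousOn (cdf H) I := fun x hx => (hderiv x hx).continuousWithinAt
  have hderivAt : ∀ x ∈ Ioo (x₀ - ε) (x₁ + ε), HasDerivAt (cdf H) (h x) x := fun x hx =>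
    (hderiv x (Ioo_subset_Icc_self hx)).hasDerivAt (Icc_mem_nhds hx.1 hx.2)
  have hmono : StrictMonoOn (cdf H) I := by
    refine strictMonoOn_of_deriv_pos (convex_Icc _ _) hcdfc fun x hx => ?_
    rw [interior_Icc] at hx
    rw [(hderivAt x hx).deriv]
    exact hpos x (Ioo_subset_Icc_self hx)
  -- The left endpoint is excluded so that there are points of `I` to the left of `x` at which
  -- strict monotonicity can be used.
  have hinv : ∀ x ∈ Ioc (x₀ - ε) (x₁ + ε), 0 < cdf H x → cdf H x < 1 →
      quantile H (cdf H x) = x := fun x hx h0 h1 => by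
    refine le_antisymm ((quantile_le_iff H h0 h1).2 le_rfl) ?_
    by_contra! hlt
    obtain ⟨z, hz1, hz2⟩ := exists_between (max_lt hlt hx.1)
    have h3 := (quantile_le_iff H h0 h1).1 ((le_max_left _ _).trans hz1.le)
    have hzI : z ∈ I := ⟨(le_max_right _ _).trans hz1.le, hz2.le.trans hx.2⟩
    exact absurd (hmono hzI (Ioc_subset_Icc_self hx) hz2) (not_lt.2 h3)
  have hmemI : ∀ x, x₀ - ε ≤ x → x ≤ x₁ + ε → x ∈ I := fun x h1 h2 => ⟨h1, h2⟩
  -- Half of `ε` is kept in reserve: strict growth beyond `a` and `b` gives `0 < cdf H a` and `cdf H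
  -- b < 1`.
  set a := x₀ - ε / 2 with ha
  set b := x₁ + ε / 2 with hb
  have haI : a ∈ I := hmemI _ (by linarith) (by linarith)
  have hbI : b ∈ I := hmemI _ (by linarith) (by linarith)
  have hp'0 : 0 < cdf H a := (cdf_nonneg H _).trans_lt
    (hmono (hmemI (x₀ - ε) le_rfl (by linarith)) haI (by linarith))
  have hq'1 : cdf H b < 1 := (hmono hbI (hmemI (x₁ + ε) (by linarith) le_rfl) (by linarith)).trans_le
    (cdf_le_one H _)
  have hp'p : cdf H a < p := (lt_quantile_iff H hp hp1).1 (by linarith)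
  have hqq' : q < cdf H b := (le_cdf_quantile H hq0 hq).trans_lt
    (hmono (hmemI x₁ (by linarith) (by linarith)) hbI (by linarith))
  have hab : a ≤ b := by linarith
  have hcab : ContinuousOn (cdf H) (Icc a b) :=
    hcdfc.mono (Icc_subset_Icc (by linarith) (by linarith))
  have hga : quantile H (cdf H a) = a := hinv a ⟨by linarith, by linarith⟩ hp'0 (by linarith)
  have hgb : quantile H (cdf H b) = b := hinv b ⟨by linarith, by linarith⟩ (by linarith) hq'1
  have hval : ∀ y ∈ Icc a b, cdf H y ∈ Icc (cdf H a) (cdf H b) ∧ quantile H (cdf H y) = y := by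
    intro y hy
    have h1 := monotone_cdf H hy.1
    have h2 := monotone_cdf H hy.2
    exact ⟨⟨h1, h2⟩, hinv y ⟨by linarith [hy.1], by linarith [hy.2]⟩ (by linarith) (by linarith)⟩
  have hcq : ∀ u ∈ Icc (cdf H a) (cdf H b), quantile H u ∈ Icc a b ∧ cdf H (quantile H u) = u := by
    intro u hu
    obtain ⟨x, hx, rfl⟩ := intermediate_value_Icc hab hcab hu
    rw [(hval x hx).2]
    exact ⟨hx, rfl⟩
  have hsub : Icc p q ⊆ Ioo (cdf H a) (cdf H b) := fun t ht => ⟨by linarith [ht.1], by linarith [ht.2]⟩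
  have hgx : ∀ t ∈ Icc p q, quantile H t ∈ Icc x₀ x₁ := fun t ht =>
    ⟨quantile_mono H hp ht.1 (by linarith [ht.2]), quantile_mono H (by linarith [ht.1]) ht.2 hq⟩
  have hgc : ∀ t ∈ Icc p q, ContinuousAt (quantile H) t := fun t ht => by
    refine continuousAt_quantile H (by linarith [ht.1]) (by linarith [ht.2]) fun c hc => ?_
    have hgt := hgx t ht
    have h1 : t < cdf H (min c b) := by
      rw [← (hcq t (Ioo_subset_Icc_self (hsub ht))).2]
      have hlt : quantile H t < min c b := lt_min hc (by linarith [hgt.2])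
      exact hmono (hmemI _ (by linarith [hgt.1]) (by linarith [hgt.2]))
        (hmemI _ (by linarith [hgt.1]) ((min_le_right _ _).trans (by linarith))) hlt
    exact h1.trans_le (monotone_cdf H (min_le_left _ _))
  have hgpos : ∀ t ∈ Icc p q, 0 < h (quantile H t) := fun t ht =>
    hpos _ (hmemI _ (by linarith [(hgx t ht).1]) (by linarith [(hgx t ht).2]))
  refine ⟨cdf H a, cdf H b, hp'0, hp'p, hqq', hq'1, fun u hu => (hcq u hu).2, ?_, fun t ht => ?_, ?_⟩
  · rw [hga, hgb]
    exact hval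
  · rw [one_div]
    refine HasDerivAt.of_local_left_inverse (hgc t ht) (hderivAt _ ?_) (hgpos t ht).ne' ?_
    · constructor <;> linarith [(hgx t ht).1, (hgx t ht).2]
    · filter_upwards [Ioo_mem_nhds (hsub ht).1 (hsub ht).2] with u hu
      exact (hcq u (Ioo_subset_Icc_self hu)).2
  · refine continuousOn_const.div (hcont.comp (fun t ht => (hgc t ht).continuousWithinAt) hgx)
      fun t ht => (hgpos t ht).ne'

/-- Inversion of a distribution function close to `H`: in the scale of `H`, the quantile process is
close to minus the empirical process. -/
lemma quantile_inversion {p' q' p q : ℝ} (hp0 : 0 < p) (hp' : p' < p) (hpq : p ≤ q)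
    (hq' : q < q') (hq1 : q < 1) {H : Measure ℝ}
    (hcg : ∀ u ∈ Icc p' q', cdf H (quantile H u) = u)
    (hgc : ∀ y ∈ Icc (quantile H p') (quantile H q'),
      cdf H y ∈ Icc p' q' ∧ quantile H (cdf H y) = y)
    {m : Measure ℝ} [IsProbabilityMeasure m] {r δ lam K : ℝ} (hr : 0 < r) (hKδ : K / r ≤ δ)
    (hKp : K / r < p - p') (hKq : K / r < q' - q)
    (hosc : ∀ u ∈ Icc p' q', ∀ v ∈ Icc p' q', |u - v| ≤ δ →
      |r * (cdf m (quantile H u) - u) - r * (cdf m (quantile H v) - v)| ≤ lam)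
    (hbd : ∀ u ∈ Icc p' q', |r * (cdf m (quantile H u) - u)| ≤ K) {t : ℝ} (ht : t ∈ Icc p q) :
    ∃ R, quantile H R = quantile m t ∧ |R - t| ≤ K / r ∧
      |r * (R - t) + r * (cdf m (quantile H t) - t)| ≤ lam := by
  have ht0 : 0 < t := by linarith [ht.1]
  have ht1 : t < 1 := by linarith [ht.2]
  have hbd' : ∀ u ∈ Icc p' q', |cdf m (quantile H u) - u| ≤ K / r := fun u hu => by
    have := hbd u hu
    rw [abs_mul, abs_of_pos hr] at this
    rwa [le_div_iff₀ hr, mul_comm]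
  have htm : t ∈ Icc p' q' := ⟨by linarith [ht.1], by linarith [ht.2]⟩
  have hlo : cdf m (quantile H p') < t := by
    have := (abs_le.1 (hbd' p' ⟨le_rfl, by linarith⟩)).2
    linarith [ht.1]
  have hhi : t < cdf m (quantile H q') := by
    have := (abs_le.1 (hbd' q' ⟨by linarith, le_rfl⟩)).1
    linarith [ht.2]
  set y := quantile m t with hy
  have hyI : y ∈ Icc (quantile H p') (quantile H q') :=
    ⟨((lt_quantile_iff m ht0 ht1).2 hlo).le, (quantile_le_iff m ht0 ht1).2 hhi.le⟩
  obtain ⟨hRI, hRy⟩ := hgc y hyI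
  set R := cdf H y with hR
  have hRlow : p' < R := by
    refine lt_of_le_of_ne hRI.1 fun heq => ?_
    have : quantile H p' < y := (lt_quantile_iff m ht0 ht1).2 hlo
    rw [← hRy, ← heq] at this
    exact lt_irrefl _ this
  have hFR : t ≤ cdf m (quantile H R) := by
    rw [hRy]
    exact le_cdf_quantile m ht0 ht1
  have hFr : ∀ u ∈ Ico p' R, cdf m (quantile H u) < t := fun u hu => by
    have huI : u ∈ Icc p' q' := ⟨hu.1, hu.2.le.trans hRI.2⟩
    refine (lt_quantile_iff m ht0 ht1).1 ?_
    by_contra! hcon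
    have h1 := monotone_cdf H (show y ≤ quantile H u from hcon)
    rw [hcg u huI] at h1
    exact absurd hu.2 (not_lt.2 h1)
  -- The distribution function of `m` may jump at `y`. Lower bounds on `R` use its value at `R`,
  -- which is at least `t`; upper bounds use the values below `t` at points `u < R`, and then let
  -- `u` increase to `R`.
  have hlim : ∀ c, (∀ u ∈ Ico p' R, u ≤ c) → R ≤ c := fun c hc => by
    by_contra! hcon
    obtain ⟨u, hu1, hu2⟩ := exists_between (max_lt hcon hRlow)
    exact absurd (hc u ⟨(le_max_right _ _).trans hu1.le, hu2⟩)
      (not_le.2 ((le_max_left _ _).trans_lt hu1))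
  have hRt : |R - t| ≤ K / r := by
    rw [abs_le]
    constructor
    · have := (abs_le.1 (hbd' R hRI)).2
      linarith
    · have : R ≤ t + K / r := hlim _ fun u hu => by
        have h1 := hFr u hu
        have h2 := (abs_le.1 (hbd' u ⟨hu.1, hu.2.le.trans hRI.2⟩)).1
        linarith
      linarith
  refine ⟨R, hRy, hRt, ?_⟩
  have h1 := abs_le.1 (hosc R hRI t htm (hRt.trans hKδ))
  rw [abs_le]
  constructor
  · set D := r * (cdf m (quantile H t) - t) with hD
    by_contra! hcon
    have hlt : R < t - (D + lam) / r := by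
      rw [lt_sub_iff_add_lt, ← lt_sub_iff_add_lt', div_lt_iff₀ hr]
      linarith
    have h2 : 0 ≤ r * (cdf m (quantile H R) - t) := mul_nonneg hr.le (by linarith)
    have := h1.2
    rw [lt_sub_iff_add_lt, ← lt_sub_iff_add_lt', div_lt_iff₀ hr] at hlt
    nlinarith
  · set D := r * (cdf m (quantile H t) - t) with hD
    have hlam : 0 ≤ lam := (abs_nonneg _).trans (hosc t htm t htm (by
      rw [sub_self, abs_zero]; exact (abs_nonneg _).trans (hRt.trans hKδ)))
    have : R ≤ t + (lam - D) / r := hlim _ fun u hu => by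
      have huI : u ∈ Icc p' q' := ⟨hu.1, hu.2.le.trans hRI.2⟩
      rw [← sub_le_iff_le_add', le_div_iff₀ hr]
      -- If `u` is farther than `δ` from `t`, it lies to the left, and then `r (u - t) < -K` already
      -- gives the bound.
      rcases le_or_gt |u - t| δ with huδ | huδ
      · have h2 := (abs_le.1 (hosc u huI t htm huδ)).1
        have h3 : r * (cdf m (quantile H u) - t) ≤ 0 :=
          mul_nonpos_of_nonneg_of_nonpos hr.le (by linarith [hFr u hu])
        linarith
      · have h4 : u - t < -δ := by
          rcases lt_abs.1 huδ with h5 | h5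
          · linarith [(abs_le.1 hRt).2, hu.2]
          · linarith
        have h6 : K ≤ δ * r := (div_le_iff₀ hr).1 hKδ
        have h7 := (abs_le.1 (hbd t htm)).2
        nlinarith
    have h3 : r * (R - t) ≤ r * ((lam - D) / r) := mul_le_mul_of_nonneg_left (by linarith) hr.le
    rw [mul_div_cancel₀ _ hr.ne'] at h3
    linarith


/-! ### From grids to intervals: uniform bounds and equicontinuity. -/

lemma gridPoint_zero (p q : ℝ) (M : ℕ) : gridPoint p q M 0 = p := by simp [gridPoint]

lemma gridPoint_last (p q : ℝ) (M : ℕ) : gridPoint p q M (M + 1) = q := by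
  have : (M : ℝ) + 1 ≠ 0 := by positivity
  simp [gridPoint, this]

lemma gridPoint_succ_sub (p q : ℝ) (M j : ℕ) :
    gridPoint p q M (j + 1) - gridPoint p q M j = (q - p) / (M + 1) := by
  unfold gridPoint
  push_cast
  ring

lemma gridPoint_lt {p q : ℝ} (hpq : p < q) (M j : ℕ) :
    gridPoint p q M j < gridPoint p q M (j + 1) := by
  have := gridPoint_succ_sub p q M j
  have h : 0 < (q - p) / ((M : ℝ) + 1) := div_pos (sub_pos.2 hpq) (by positivity)
  linarith

lemma exists_gridPoint_le_le {p q : ℝ} (M : ℕ) {u : ℝ} (hu : u ∈ Icc p q) :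
    ∃ j ≤ M, gridPoint p q M j ≤ u ∧ u ≤ gridPoint p q M (j + 1) := by
  have key : ∀ k, u ≤ gridPoint p q M (k + 1) →
      ∃ j ≤ k, gridPoint p q M j ≤ u ∧ u ≤ gridPoint p q M (j + 1) := fun k => by
    induction k with
    | zero => exact fun h => ⟨0, le_rfl, by rw [gridPoint_zero]; exact hu.1, h⟩
    | succ k ih =>
      intro h
      rcases le_total u (gridPoint p q M (k + 1)) with h' | h'
      · obtain ⟨j, hj, hj'⟩ := ih h'
        exact ⟨j, by omega, hj'⟩
      · exact ⟨k + 1, le_rfl, h', h⟩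
  exact key M (by rw [gridPoint_last]; exact hu.2)

/-- The image of a regular grid of `[p, q]`, extended by a constant. -/
noncomputable def imageGrid (g : ℝ → ℝ) (p q : ℝ) (M k : ℕ) : ℝ :=
  g (gridPoint p q M (min k (M + 1)))

section Grid

variable {g : ℝ → ℝ} {α β : ℝ} {H : Measure ℝ} [IsProbabilityMeasure H]

lemma imageGrid_of_le {M k : ℕ} (hk : k ≤ M + 1) :
    imageGrid g α β M k = g (gridPoint α β M k) := by rw [imageGrid, min_eq_left hk]

lemma monotone_imageGrid (hαβ : α < β) (hg : MonotoneOn g (Icc α β)) (M : ℕ) :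
    Monotone (imageGrid g α β M) := by
  have hmono : Monotone (gridPoint α β M) :=
    monotone_nat_of_le_succ fun j => (gridPoint_lt hαβ M j).le
  intro i j hij
  exact hg (gridPoint_mem hαβ.le (min_le_right _ _)) (gridPoint_mem hαβ.le (min_le_right _ _))
    (hmono (min_le_min_right _ hij))

lemma measure_gridCell_imageGrid_ne_zero (hα : 0 < α) (hαβ : α < β) (hβ : β < 1)
    (hg : MonotoneOn g (Icc α β)) (hHg : ∀ u ∈ Icc α β, H.real (Iic (g u)) = u) {M N : ℕ}
    (hN : N ≤ M + 1) (i : ℕ) (hi : i ≤ N + 1) : H (gridCell (imageGrid g α β M) N i) ≠ 0 := by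
  have hval : ∀ k ≤ M + 1, H.real (Iic (imageGrid g α β M k)) = gridPoint α β M k := fun k hk => by
    rw [imageGrid_of_le hk, hHg _ (gridPoint_mem hαβ.le hk)]
  suffices hpos : 0 < H.real (gridCell (imageGrid g α β M) N i) by
    intro h0
    simp [measureReal_def, h0] at hpos
  unfold gridCell
  split_ifs with h0 h1
  · rw [hval 0 (by omega), gridPoint_zero]
    exact hα
  · obtain ⟨j, rfl⟩ := Nat.exists_eq_succ_of_ne_zero h0
    have hle := monotone_imageGrid hαβ hg M (Nat.le_succ j)
    have hunion := measureReal_union (μ := H) (s₁ := Iic (imageGrid g α β M j))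
      (s₂ := Ioc (imageGrid g α β M j) (imageGrid g α β M (j + 1)))
      (disjoint_left.2 fun x hx hx' => absurd hx (not_le.2 hx'.1)) measurableSet_Ioc
    rw [Iic_union_Ioc_eq_Iic hle, hval _ (by omega), hval _ (by omega)] at hunion
    rw [Nat.succ_eq_add_one, Nat.add_sub_cancel]
    linarith [gridPoint_lt hαβ M j]
  · rw [← compl_Iic, probReal_compl_eq_one_sub measurableSet_Iic, hval _ hN]
    linarith [(gridPoint_mem hαβ.le hN).2]

/-- Monotonicity brackets `F u` between its values at neighbouring grid points, at the price of one
mesh. The constant `c` allows both values (`c = 0`) and increments. -/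
lemma mul_abs_sub_le_of_gridPoint {F : ℝ → ℝ} (hαβ : α < β) (hF : MonotoneOn F (Icc α β))
    {r lam κ c : ℝ} (hr : 0 ≤ r) {M : ℕ} (hM : r * ((β - α) / (M + 1)) ≤ κ)
    (h : ∀ k ≤ M + 1, r * |F (gridPoint α β M k) - gridPoint α β M k - c| ≤ lam) {u : ℝ}
    (hu : u ∈ Icc α β) : r * |F u - u - c| ≤ lam + κ := by
  obtain ⟨j, hj, h1, h2⟩ := exists_gridPoint_le_le M hu
  have hF1 := hF (gridPoint_mem hαβ.le (by omega)) hu h1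
  have hF2 := hF hu (gridPoint_mem hαβ.le (by omega)) h2
  have hsub := gridPoint_succ_sub α β M j
  have ha := h j (by omega)
  have hb := h (j + 1) (by omega)
  rw [← abs_of_nonneg hr, ← abs_mul, abs_le] at ha hb ⊢
  have e1 : r * (gridPoint α β M (j + 1) - gridPoint α β M j) ≤ κ := by rwa [hsub]
  constructor
  · nlinarith [mul_le_mul_of_nonneg_left hF1 hr, mul_le_mul_of_nonneg_left h2 hr]
  · nlinarith [mul_le_mul_of_nonneg_left hF2 hr, mul_le_mul_of_nonneg_left h1 hr]

lemma exists_mul_div_le (x : ℝ) {κ : ℝ} (hκ : 0 < κ) : ∃ M : ℕ, x / (M + 1) ≤ κ := by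
  obtain ⟨M, hM⟩ := exists_nat_gt (x / κ)
  refine ⟨M, ?_⟩
  rw [div_lt_iff₀ hκ] at hM
  rw [div_le_iff₀ (by positivity)]
  nlinarith

variable {Ω : Type*} [MeasurableSpace Ω] {μ : Measure Ω} {a : ℝ} {P : Kernel Ω ℝ} [IsMarkovKernel P]

lemma monotoneOn_measureReal_Iic (m : Measure ℝ) [IsProbabilityMeasure m]
    (hg : MonotoneOn g (Icc α β)) : MonotoneOn (fun u => m.real (Iic (g u))) (Icc α β) :=
  fun _ hu _ hv huv => measureReal_mono (Iic_subset_Iic.2 (hg hu hv huv))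

/-- The grid bound does not depend on the number of points, so the grid is taken so fine that `√a`
times its mesh is at most `lam`; this is the reason for `2 * lam`. -/
lemma IsNIGProcess.measure_exists_increment_Icc_gt (ha : 0 < a) (hP : IsNIGProcess a H P μ)
    (hα : 0 < α) (hαβ : α < β) (hβ : β < 1) (hg : MonotoneOn g (Icc α β))
    (hHg : ∀ u ∈ Icc α β, H.real (Iic (g u)) = u) {lam : ℝ} (hlam : 0 < lam)
    (hlarge : lam / (2 * (β - α)) ≤ Real.sqrt a) :
    μ {ω | ∃ u ∈ Icc α β, 2 * lam < Real.sqrt a *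
      |(P ω).real (Iic (g u)) - u - ((P ω).real (Iic (g α)) - α)|} ≤
      ENNReal.ofReal (4 * Real.exp (-(lam ^ 2 / (64 * (β - α))))) := by
  obtain ⟨M, hM⟩ := exists_mul_div_le (Real.sqrt a * (β - α)) hlam
  rw [mul_div_assoc] at hM
  have hval : ∀ k ≤ M + 1, H.real (Iic (imageGrid g α β M k)) = gridPoint α β M k := fun k hk => by
    rw [imageGrid_of_le hk, hHg _ (gridPoint_mem hαβ.le hk)]
  have key := hP.measure_exists_increment_gt ha (monotone_imageGrid hαβ hg M) (M := M + 1)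
    (measure_gridCell_imageGrid_ne_zero hα hαβ hβ hg hHg le_rfl) (δ := β - α) (lam := lam)
    (sub_pos.2 hαβ) (by linarith) hlam (by
      rw [hval _ le_rfl, hval _ (by omega), gridPoint_zero, gridPoint_last]) hlarge
  refine le_trans (measure_mono ?_) key
  rintro ω ⟨u, hu, hlt⟩
  by_contra hcon
  rw [mem_ofPred_eq] at hcon
  push Not at hcon
  refine absurd hlt (not_lt.2 ?_)
  rw [two_mul]
  refine mul_abs_sub_le_of_gridPoint hαβ (monotoneOn_measureReal_Iic (P ω) hg)
    (Real.sqrt_nonneg a) hM (fun k hk => ?_) hu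
  have := hcon k hk
  rw [hval k hk, hval 0 (by omega), gridPoint_zero, imageGrid_of_le hk, imageGrid_of_le (by omega),
    gridPoint_zero] at this
  exact this

lemma IsNIGProcess.measure_exists_value_Icc_gt (ha : 0 < a) (hP : IsNIGProcess a H P μ)
    (hα : 0 < α) (hαβ : α < β) (hβ : β < 1) (hg : MonotoneOn g (Icc α β))
    (hHg : ∀ u ∈ Icc α β, H.real (Iic (g u)) = u) {lam : ℝ} (hlam : 0 < lam)
    (hlarge : lam / 2 ≤ Real.sqrt a) :
    μ {ω | ∃ u ∈ Icc α β, 2 * lam < Real.sqrt a * |(P ω).real (Iic (g u)) - u|} ≤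
      ENNReal.ofReal (4 * Real.exp (-(lam ^ 2 / 64))) := by
  obtain ⟨M, hM⟩ := exists_mul_div_le (Real.sqrt a * (β - α)) hlam
  rw [mul_div_assoc] at hM
  have hval : ∀ k ≤ M + 1, H.real (Iic (imageGrid g α β M k)) = gridPoint α β M k := fun k hk => by
    rw [imageGrid_of_le hk, hHg _ (gridPoint_mem hαβ.le hk)]
  have key := hP.measure_exists_value_gt ha (monotone_imageGrid hαβ hg M) (M := M + 1)
    (measure_gridCell_imageGrid_ne_zero hα hαβ hβ hg hHg le_rfl) hlam hlarge
  refine le_trans (measure_mono ?_) key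
  rintro ω ⟨u, hu, hlt⟩
  by_contra hcon
  rw [mem_ofPred_eq] at hcon
  push Not at hcon
  refine absurd hlt (not_lt.2 ?_)
  have := mul_abs_sub_le_of_gridPoint (c := 0) hαβ (monotoneOn_measureReal_Iic (P ω) hg)
    (Real.sqrt_nonneg a) hM (lam := lam) (fun k hk => ?_) hu
  · rw [two_mul]
    simpa using this
  · have := hcon k hk
    rw [hval k hk, imageGrid_of_le hk] at this
    simpa using this

end Grid

section Equicontinuity

variable {g : ℝ → ℝ} {α β : ℝ} {H : Measure ℝ} [IsProbabilityMeasure H]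
  {a : ℕ → ℝ} {Ω : ℕ → Type*} [∀ n, MeasurableSpace (Ω n)]
  {μ : ∀ n, Measure (Ω n)} {P : ∀ n, Kernel (Ω n) ℝ} [∀ n, IsMarkovKernel (P n)]

lemma eventually_le_sqrt (ha : Tendsto a atTop atTop) (x : ℝ) :
    ∀ᶠ n in atTop, x ≤ Real.sqrt (a n) :=
  (Real.tendsto_sqrt_atTop.comp ha).eventually_ge_atTop x

lemma exists_eventually_measure_value_le (ha_pos : ∀ n, 0 < a n) (ha : Tendsto a atTop atTop)
    (hP : ∀ n, IsNIGProcess (a n) H (P n) (μ n))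
    (hα : 0 < α) (hαβ : α < β) (hβ : β < 1) (hg : MonotoneOn g (Icc α β))
    (hHg : ∀ u ∈ Icc α β, H.real (Iic (g u)) = u) {η : ℝ} (hη : 0 < η) :
    ∃ K > 0, ∀ᶠ n in atTop, μ n {ω | ¬ ∀ u ∈ Icc α β,
      |Real.sqrt (a n) * ((P n ω).real (Iic (g u)) - u)| ≤ K} ≤ ENNReal.ofReal η := by
  -- From `exp y ≥ y + 1` and `lam ≥ 1`, the tail `4 exp (-lam ^ 2 / 64)` is at most `256 / lam ≤
  -- η`.
  set lam := 256 / η + 1 with hlam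
  have hlam1 : 1 ≤ lam := by
    have : 0 < 256 / η := by positivity
    linarith
  refine ⟨2 * lam, by positivity, ?_⟩
  filter_upwards [eventually_le_sqrt ha (lam / 2)] with n hn
  refine (measure_mono fun ω hω => ?_).trans (((hP n).measure_exists_value_Icc_gt (ha_pos n) hα hαβ
    hβ hg hHg (by positivity) hn).trans (ENNReal.ofReal_le_ofReal ?_))
  · rw [mem_ofPred_eq] at hω ⊢
    push Not at hω
    obtain ⟨u, hu, h⟩ := hω
    rw [abs_mul, abs_of_nonneg (Real.sqrt_nonneg _)] at h
    exact ⟨u, hu, h⟩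
  · have h1 : lam ^ 2 / 64 + 1 ≤ Real.exp (lam ^ 2 / 64) := Real.add_one_le_exp _
    rw [Real.exp_neg, ← div_eq_mul_inv, div_le_iff₀ (Real.exp_pos _)]
    have h2 : 256 ≤ η * lam := by
      rw [hlam]; field_simp; nlinarith
    have h3 : lam ≤ lam ^ 2 := by nlinarith
    have h4 : η * (lam ^ 2 / 64 + 1) ≤ η * Real.exp (lam ^ 2 / 64) :=
      mul_le_mul_of_nonneg_left h1 hη.le
    have h5 : η * lam ≤ η * lam ^ 2 := mul_le_mul_of_nonneg_left h3 hη.le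
    nlinarith

/-- Asymptotic equicontinuity in probability of normalized inverse-Gaussian processes. -/
lemma exists_eventually_measure_osc_le (ha_pos : ∀ n, 0 < a n) (ha : Tendsto a atTop atTop)
    (hP : ∀ n, IsNIGProcess (a n) H (P n) (μ n))
    (hα : 0 < α) (hαβ : α < β) (hβ : β < 1) (hg : MonotoneOn g (Icc α β))
    (hHg : ∀ u ∈ Icc α β, H.real (Iic (g u)) = u) {lam η : ℝ} (hlam : 0 < lam) (hη : 0 < η) :
    ∃ δ > 0, ∀ᶠ n in atTop, μ n {ω | ¬ ∀ u ∈ Icc α β, ∀ v ∈ Icc α β, |u - v| ≤ δ →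
      |Real.sqrt (a n) * ((P n ω).real (Iic (g u)) - u) -
        Real.sqrt (a n) * ((P n ω).real (Iic (g v)) - v)| ≤ lam} ≤ ENNReal.ofReal η := by
  have hL : 0 < β - α := sub_pos.2 hαβ
  -- Each of `N + 1` blocks fails with probability at most `4 exp (-c (N + 1))`. By `exp x ≥ x ^ 2 /
  -- 2` the sum is at most `8 / (c ^ 2 (N + 1))`, which dictates `N`.
  set c := (lam / 6) ^ 2 / (64 * (β - α)) with hc
  have hc0 : 0 < c := by positivity
  obtain ⟨N, hN⟩ := exists_mul_div_le (8 / c ^ 2) hη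
  set d := (β - α) / (N + 1) with hd
  have hN1 : (0 : ℝ) < N + 1 := by positivity
  have hd0 : 0 < d := by positivity
  refine ⟨d, hd0, ?_⟩
  filter_upwards [eventually_le_sqrt ha (lam / 6 / (2 * d))] with n hn
  set v : ℕ → ℝ := gridPoint α β N with hv
  set D : Ω n → ℝ → ℝ := fun ω u => Real.sqrt (a n) * ((P n ω).real (Iic (g u)) - u) with hD
  have hvsub : ∀ j, v (j + 1) - v j = d := fun j => gridPoint_succ_sub α β N j
  have hvmem : ∀ j ≤ N + 1, v j ∈ Icc α β := fun j hj => gridPoint_mem hαβ.le hj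
  have hvlt : ∀ j, v j < v (j + 1) := gridPoint_lt hαβ N
  set S : ℕ → Set (Ω n) := fun j => {ω | ∃ u ∈ Icc (v j) (v (j + 1)), 2 * (lam / 6) <
    Real.sqrt (a n) * |(P n ω).real (Iic (g u)) - u - ((P n ω).real (Iic (g (v j))) - v j)|} with hS
  have hSμ : ∀ j ∈ Finset.range (N + 1),
      μ n (S j) ≤ ENNReal.ofReal (4 * Real.exp (-(c * (N + 1)))) := fun j hj => by
    rw [Finset.mem_range] at hj
    have hsub : Icc (v j) (v (j + 1)) ⊆ Icc α β :=
      Icc_subset_Icc (hvmem j (by omega)).1 (hvmem (j + 1) (by omega)).2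
    have := (hP n).measure_exists_increment_Icc_gt (ha_pos n) (α := v j) (β := v (j + 1))
      (by linarith [(hvmem j (by omega)).1]) (hvlt j)
      (by linarith [(hvmem (j + 1) (by omega)).2]) (hg.mono hsub) (fun u hu => hHg u (hsub hu))
      (lam := lam / 6) (by positivity) (by rwa [hvsub])
    rw [hvsub] at this
    have e : (lam / 6) ^ 2 / (64 * d) = c * (N + 1) := by rw [hc, hd]; field_simp
    rwa [e] at this
  have hsum : μ n (⋃ j ∈ Finset.range (N + 1), S j) ≤ ENNReal.ofReal η := by
    refine (measure_biUnion_finset_le _ _).trans ((Finset.sum_le_sum hSμ).trans ?_)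
    rw [Finset.sum_const, Finset.card_range, nsmul_eq_mul, ← ENNReal.ofReal_natCast,
      ← ENNReal.ofReal_mul (by positivity)]
    refine ENNReal.ofReal_le_ofReal ?_
    have hx : 0 ≤ c * (N + 1) := by positivity
    have h1 := Real.quadratic_le_exp_of_nonneg hx
    have h2 : (c * (N + 1)) ^ 2 / 2 ≤ Real.exp (c * (N + 1)) := by linarith
    rw [Real.exp_neg, ← div_eq_mul_inv, ← mul_div_assoc, div_le_iff₀ (Real.exp_pos _)]
    rw [div_div, div_le_iff₀ (by positivity)] at hN
    refine le_trans ?_ (mul_le_mul_of_nonneg_left h2 hη.le)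
    push_cast
    nlinarith [mul_le_mul_of_nonneg_right hN hN1.le]
  refine (measure_mono fun ω hω => ?_).trans hsum
  by_contra hcon
  simp only [mem_iUnion, not_exists] at hcon
  have hblock : ∀ j ≤ N, ∀ u, v j ≤ u → u ≤ v (j + 1) → |D ω u - D ω (v j)| ≤ lam / 3 := by
    intro j hj u h1 h2
    by_contra! hlt
    refine hcon j (Finset.mem_range.2 (by omega)) ⟨u, ⟨h1, h2⟩, ?_⟩
    rw [← abs_of_nonneg (Real.sqrt_nonneg (a n)), ← abs_mul]
    have e : D ω u - D ω (v j) = Real.sqrt (a n) *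
      ((P n ω).real (Iic (g u)) - u - ((P n ω).real (Iic (g (v j))) - v j)) := by
      simp only [hD]; ring
    rw [← e]
    linarith
  -- Points at distance at most one block length lie in the same block or in adjacent ones, so at
  -- most three increments of size `lam / 3` are involved.
  have hord : ∀ u ∈ Icc α β, ∀ w ∈ Icc α β, u ≤ w → |u - w| ≤ d → |D ω u - D ω w| ≤ lam := by
    intro u hu w hw huw hdist
    obtain ⟨j, hj, h1, h2⟩ := exists_gridPoint_le_le N hu
    have hu1 := abs_le.1 (hblock j hj u h1 h2)
    rcases le_or_gt w (v (j + 1)) with h3 | h3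
    · have hw1 := abs_le.1 (hblock j hj w (h1.trans huw) h3)
      rw [abs_le]
      constructor <;> linarith [hu1.1, hu1.2, hw1.1, hw1.2]
    · have hjN : j + 1 ≤ N := by
        by_contra hlt
        have : j = N := by omega
        rw [this, hv, gridPoint_last] at h3
        exact absurd hw.2 (not_le.2 h3)
      have hw2 : w ≤ v (j + 1 + 1) := by
        have := hvsub (j + 1)
        rw [abs_sub_comm, abs_of_nonneg (by linarith)] at hdist
        have h2' : u ≤ v (j + 1) := h2
        linarith
      have hw1 := abs_le.1 (hblock (j + 1) hjN w h3.le hw2)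
      have hm1 := abs_le.1 (hblock j hj (v (j + 1)) (hvlt j).le le_rfl)
      rw [abs_le]
      constructor <;> linarith [hu1.1, hu1.2, hw1.1, hw1.2, hm1.1, hm1.2]
  refine hω fun u hu w hw huw => ?_
  rcases le_total u w with h | h
  · exact hord u hu w hw h huw
  · rw [abs_sub_comm]
    exact hord w hw u hu h (by rwa [abs_sub_comm])

end Equicontinuity

/-! ### Continuity of the random quantile paths and the inclusion in the Skorokhod space. -/

/-- A normalized inverse-Gaussian process charges the intervals which its base measure charges. -/
lemma IsNIGProcess.ae_measureReal_Ioc_pos {Ω : Type*} [MeasurableSpace Ω] {μ : Measure Ω}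
    {a : ℝ} (ha : 0 < a) {H : Measure ℝ} [IsProbabilityMeasure H] {P : Kernel Ω ℝ}
    [IsProbabilityMeasure μ] (hP : IsNIGProcess a H P μ) {x y : ℝ} (hxy : x ≤ y)
    (hx : H (Iic x) ≠ 0) (hxy' : H (Ioc x y) ≠ 0) (hy : H (Ioi y) ≠ 0) :
    ∀ᵐ ω ∂μ, 0 < (P ω).real (Ioc x y) := by
  -- With `M = 1` the cells are `Iic x`, `Ioc x y` and `Ioi y`.
  set s : ℕ → ℝ := fun k => if k = 0 then x else y with hs
  have hmono : Monotone s := monotone_nat_of_le_succ fun k => by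
    rcases k with _ | k <;> simp [hs, hxy]
  have hcells : ∀ i ≤ 1 + 1, H (gridCell s 1 i) ≠ 0 := fun i hi => by
    interval_cases i
    · simpa [gridCell, hs] using hx
    · simpa [gridCell, hs] using hxy'
    · simpa [gridCell, hs] using hy
  set E : Set (Fin (1 + 1 + 1) → ℝ) := {z | ¬ 0 < z 1} with hE
  have hEm : MeasurableSet E := (measurableSet_lt measurable_const (measurable_pi_apply 1)).compl
  have key := hP.measure_gridCell_mem ha hmono hcells hEm
  have hprob : ∀ i : Fin (1 + 1 + 1),
      IsProbabilityMeasure (invGauss (a * H.real (gridCell s 1 i))) := fun i =>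
    isProbabilityMeasure_invGauss
      (mul_pos ha (ENNReal.toReal_pos (hcells i (by omega)) (measure_ne_top _ _)))
  have hzero : Measure.pi (fun i : Fin (1 + 1 + 1) => invGauss (a * H.real (gridCell s 1 i)))
      {v | (fun i => v i / ∑ j, v j) ∈ E} = 0 := by
    suffices h : ∀ᵐ v ∂(Measure.pi fun i : Fin (1 + 1 + 1) =>
        invGauss (a * H.real (gridCell s 1 i))), 0 < v 1 / ∑ j, v j from ae_iff.1 h
    have : ∀ᵐ v ∂(Measure.pi fun i : Fin (1 + 1 + 1) => invGauss (a * H.real (gridCell s 1 i))),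
        ∀ i, 0 < v i := ae_all_iff.2 fun i =>
      (measurePreserving_eval (fun i : Fin (1 + 1 + 1) =>
        invGauss (a * H.real (gridCell s 1 i))) i).quasiMeasurePreserving.ae (ae_pos_invGauss _)
    filter_upwards [this] with v hv
    exact div_pos (hv 1) (Finset.sum_pos (fun i _ => hv i) Finset.univ_nonempty)
  rw [hzero] at key
  refine ae_iff.2 (measure_mono_null (fun ω hω => ?_) key)
  have h1 : gridCell s 1 ((1 : Fin (1 + 1 + 1)) : ℕ) = Ioc x y := by simp [gridCell, hs]
  change ¬ 0 < (P ω).real (gridCell s 1 ((1 : Fin (1 + 1 + 1)) : ℕ))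
  rw [h1]
  exact hω


/-- Continuous functions as elements of the Skorokhod space. -/
def SkorokhodSpace.ofContinuous {p q : ℝ} (f : C(Icc p q, ℝ)) : SkorokhodSpace p q :=
  ⟨f, fun t => ⟨f.continuous.continuousWithinAt, f t, f.continuous.continuousWithinAt⟩⟩

/-- The identity time change bounds the Skorokhod distance by the uniform distance. -/
lemma SkorokhodSpace.continuous_ofContinuous {p q : ℝ} :
    Continuous (SkorokhodSpace.ofContinuous (p := p) (q := q)) := by
  refine LipschitzWith.continuous (K := 1) fun f g => ?_
  rw [ENNReal.coe_one, one_mul]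
  refine (iInf_le _ (OrderIso.refl _)).trans (max_le ?_ (iSup_le fun t => ?_))
  · simp
  · change edist (f t) (g t) ≤ edist f g
    rw [edist_dist, edist_dist]
    exact ENNReal.ofReal_le_ofReal (ContinuousMap.dist_apply_le_dist t)

lemma ProbabilityTheory.IsGaussianProcess.hasGaussianLaw_pi {Ω T ι : Type*} [MeasurableSpace Ω]
    {μ : Measure Ω} {X : T → Ω → ℝ} (hX : IsGaussianProcess X μ) [Fintype ι] (τ : ι → T) :
    HasGaussianLaw (fun ω i => X (τ i) ω) μ :=
  ((hX.comp_right τ).hasGaussianLaw Finset.univ).map_fun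
    { toFun := fun x i => x ⟨i, Finset.mem_univ i⟩
      map_add' := fun _ _ => rfl
      map_smul' := fun _ _ => rfl
      cont := by fun_prop }

lemma measureReal_Iic_inter_Iic_unitInterval (s t : unitInterval) :
    (volume : Measure unitInterval).real (Iic s ∩ Iic t) = min (s : ℝ) t := by
  have h : ∀ x : unitInterval, (volume : Measure unitInterval).real (Iic x) = x := fun x => by
    rw [measureReal_def, unitInterval.volume_Iic, ENNReal.toReal_ofReal x.2.1]
  rw [Iic_inter_Iic, h]
  rcases le_total s t with hst | hst
  · rw [inf_eq_left.2 hst, min_eq_left (show (s : ℝ) ≤ t from hst)]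
  · rw [inf_eq_right.2 hst, min_eq_right (show (t : ℝ) ≤ s from hst)]

lemma IsBrownianBridge.covariance_eq_min {Ω : Type*} [MeasurableSpace Ω] {μ : Measure Ω}
    {B : unitInterval → Ω → ℝ}
    (hB : IsBrownianBridge (volume : Measure unitInterval) (fun t => Iic t) B μ)
    (s t : unitInterval) : cov[B s, B t; μ] = min (s : ℝ) t - s * t := by
  have h : ∀ x : unitInterval, (volume : Measure unitInterval).real (Iic x) = x := fun x => by
    rw [measureReal_def, unitInterval.volume_Iic, ENNReal.toReal_ofReal x.2.1]
  rw [hB.covariance, measureReal_Iic_inter_Iic_unitInterval, h, h]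

lemma measurable_quantile {Ω : Type*} [MeasurableSpace Ω] (P : Kernel Ω ℝ) [IsMarkovKernel P]
    {t : ℝ} (h0 : 0 < t) (h1 : t < 1) : Measurable fun ω => quantile (P ω) t := by
  refine measurable_of_Iic fun x => ?_
  have : (fun ω => quantile (P ω) t) ⁻¹' Iic x = {ω | t ≤ (P ω).real (Iic x)} := by
    ext ω
    rw [mem_preimage, mem_Iic, quantile_le_iff (P ω) h0 h1, cdf_eq_real]
    rfl
  rw [this]
  exact measurableSet_le measurable_const
    (Kernel.measurable_coe P measurableSet_Iic).ennreal_toReal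

/-- The measures which charge the intervals inside `(x, y)`, and put mass less than `p` below `x`
and more than `q` below `y`. -/
def chargingMeasures (x y p q : ℝ) : Set (Measure ℝ) :=
  {m | m.real (Iic x) < p ∧ q < m.real (Iic y) ∧
    ∀ r s : ℚ, x < r → (r : ℝ) < s → (s : ℝ) < y → 0 < m.real (Ioc (r : ℝ) s)}

lemma measurableSet_preimage_chargingMeasures {Ω : Type*} [MeasurableSpace Ω] (P : Kernel Ω ℝ)
    (x y p q : ℝ) : MeasurableSet {ω | P ω ∈ chargingMeasures x y p q} := by
  have hm : ∀ {E : Set ℝ}, MeasurableSet E → Measurable fun ω => (P ω).real E := fun hE =>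
    (Kernel.measurable_coe P hE).ennreal_toReal
  change MeasurableSet ({ω | (P ω).real (Iic x) < p} ∩ ({ω | q < (P ω).real (Iic y)} ∩
    {ω | ∀ r s : ℚ, x < r → (r : ℝ) < s → (s : ℝ) < y → 0 < (P ω).real (Ioc (r : ℝ) s)}))
  refine (measurableSet_lt (hm measurableSet_Iic) measurable_const).inter
    ((measurableSet_lt measurable_const (hm measurableSet_Iic)).inter ?_)
  simp_rw [ofPred_forall]
  refine MeasurableSet.iInter fun r : ℚ => MeasurableSet.iInter fun s : ℚ => ?_
  repeat refine MeasurableSet.iInter fun h => ?_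
  exact measurableSet_lt measurable_const (hm measurableSet_Ioc)

/-- The quantile at `t` lies to the right of `x`. For `b < y`, an interval with rational endpoints
between the quantile and `b` is charged, so the distribution function exceeds `t` at `b`; for `b ≥
y` its value at `y` does. -/
lemma continuousAt_quantile_of_mem_chargingMeasures {m : Measure ℝ} [IsProbabilityMeasure m]
    {x y p q : ℝ} (hp : 0 < p) (hq : q < 1) (hm : m ∈ chargingMeasures x y p q) {t : ℝ}
    (ht : t ∈ Icc p q) : ContinuousAt (quantile m) t := by
  obtain ⟨hx, hy, hpos⟩ := hm
  have h0 : 0 < t := by linarith [ht.1]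
  have h1 : t < 1 := by linarith [ht.2]
  refine continuousAt_quantile m h0 h1 fun b hb => ?_
  rcases le_or_gt y b with hyb | hby
  · refine lt_of_lt_of_le ?_ (monotone_cdf m hyb)
    rw [cdf_eq_real]
    linarith [ht.2]
  · have hxt : x < quantile m t := by
      rw [lt_quantile_iff m h0 h1, cdf_eq_real]
      linarith [ht.1]
    obtain ⟨r, hr1, hr2⟩ := exists_rat_btwn hb
    obtain ⟨s, hs1, hs2⟩ := exists_rat_btwn hr2
    have hrs := hpos r s (hxt.trans hr1) hs1 (hs2.trans hby)
    have hunion := measureReal_union (μ := m) (s₁ := Iic (r : ℝ)) (s₂ := Ioc (r : ℝ) s)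
      (disjoint_left.2 fun z hz hz' => absurd hz (not_le.2 hz'.1)) measurableSet_Ioc
    rw [Iic_union_Ioc_eq_Iic hs1.le, ← cdf_eq_real, ← cdf_eq_real] at hunion
    have e1 := le_cdf_quantile m h0 h1
    have e2 := monotone_cdf m hr1.le
    have e3 := monotone_cdf m hs2.le
    linarith

lemma IsNIGProcess.ae_forall_rat_measureReal_Ioc_pos {Ω : Type*} [MeasurableSpace Ω]
    {μ : Measure Ω} [IsProbabilityMeasure μ] {a : ℝ} (ha : 0 < a) {H : Measure ℝ}
    [IsProbabilityMeasure H] {P : Kernel Ω ℝ} (hP : IsNIGProcess a H P μ) {x y : ℝ}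
    (hx : 0 < cdf H x) (hy : cdf H y < 1) (hmono : StrictMonoOn (cdf H) (Icc x y)) :
    ∀ᵐ ω ∂μ, ∀ r s : ℚ, x < r → (r : ℝ) < s → (s : ℝ) < y → 0 < (P ω).real (Ioc (r : ℝ) s) := by
  refine ae_all_iff.2 fun r => ae_all_iff.2 fun s => ?_
  by_cases hcond : x < r ∧ (r : ℝ) < s ∧ (s : ℝ) < y
  swap
  · exact ae_of_all _ fun ω h1 h2 h3 => absurd ⟨h1, h2, h3⟩ hcond
  obtain ⟨h1, h2, h3⟩ := hcond
  have hne : ∀ {E : Set ℝ}, 0 < H.real E → H E ≠ 0 := fun hE h0 => by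
    simp [measureReal_def, h0] at hE
  have hunion := measureReal_union (μ := H) (s₁ := Iic (r : ℝ)) (s₂ := Ioc (r : ℝ) s)
    (disjoint_left.2 fun z hz hz' => absurd hz (not_le.2 hz'.1)) measurableSet_Ioc
  rw [Iic_union_Ioc_eq_Iic h2.le, ← cdf_eq_real, ← cdf_eq_real] at hunion
  have hlt := hmono ⟨h1.le, (h2.trans h3).le⟩ ⟨(h1.trans h2).le, h3.le⟩ h2
  have h := hP.ae_measureReal_Ioc_pos ha h2.le
    (hne (by rw [← cdf_eq_real]; exact hx.trans_le (monotone_cdf H h1.le)))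
    (hne (by linarith))
    (hne (by
      rw [← compl_Iic, probReal_compl_eq_one_sub measurableSet_Iic, ← cdf_eq_real]
      linarith [monotone_cdf H h3.le]))
  filter_upwards [h] with ω hω _ _ _
  exact hω

/-- The quantile process is uniformly close to minus the empirical process, weighted by the
derivative of the limit quantile function. -/
lemma abs_quantileProcess_add_le {p' q' p q : ℝ} (hp0 : 0 < p) (hp' : p' < p) (hpq : p ≤ q)
    (hq' : q < q') (hq1 : q < 1) {H : Measure ℝ}
    (hcg : ∀ u ∈ Icc p' q', cdf H (quantile H u) = u)
    (hgc : ∀ y ∈ Icc (quantile H p') (quantile H q'),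
      cdf H y ∈ Icc p' q' ∧ quantile H (cdf H y) = y)
    {m : Measure ℝ} [IsProbabilityMeasure m] {r δ lam K C η : ℝ} (hr : 0 < r) (hKδ : K / r ≤ δ)
    (hKp : K / r < p - p') (hKq : K / r < q' - q)
    (hosc : ∀ u ∈ Icc p' q', ∀ v ∈ Icc p' q', |u - v| ≤ δ →
      |r * (m.real (Iic (quantile H u)) - u) - r * (m.real (Iic (quantile H v)) - v)| ≤ lam)
    (hbd : ∀ u ∈ Icc p' q', |r * (m.real (Iic (quantile H u)) - u)| ≤ K) {c : ℝ → ℝ}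
    (hη : 0 ≤ η) (hdiff : ∀ t ∈ Icc p q, ∀ R, |R - t| ≤ δ →
      |quantile H R - quantile H t - c t * (R - t)| ≤ η * |R - t|)
    (hC : ∀ t ∈ Icc p q, |c t| ≤ C)
    (hc : ∀ s ∈ Icc p q, ∀ t ∈ Icc p q, |s - t| ≤ δ → |c s - c t| ≤ η) {s t : ℝ}
    (hs : s ∈ Icc p q) (ht : t ∈ Icc p q) (hst : |s - t| ≤ δ) :
    |r * (quantile m s - quantile H s) + r * (m.real (Iic (quantile H t)) - t) * c t| ≤
      2 * (η * K) + 2 * (C * lam) := by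
  set D : ℝ → ℝ := fun u => r * (m.real (Iic (quantile H u)) - u) with hD
  have hmem : ∀ u ∈ Icc p q, u ∈ Icc p' q' := fun u hu => ⟨by linarith [hu.1], by linarith [hu.2]⟩
  obtain ⟨R, hR, hRs, hRD⟩ := quantile_inversion hp0 hp' hpq hq' hq1 hcg hgc (m := m) hr hKδ hKp hKq
    (by simpa only [cdf_eq_real] using hosc) (by simpa only [cdf_eq_real] using hbd) hs
  rw [cdf_eq_real] at hRD
  have hC0 : 0 ≤ C := (abs_nonneg _).trans (hC s hs)
  have e1 : |r * (quantile H R - quantile H s - c s * (R - s))| ≤ η * K := by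
    rw [abs_mul, abs_of_pos hr]
    have h1 := hdiff s hs R (hRs.trans hKδ)
    have h2 : r * |R - s| ≤ K := by rwa [le_div_iff₀ hr, mul_comm] at hRs
    calc r * |quantile H R - quantile H s - c s * (R - s)| ≤ r * (η * |R - s|) :=
          mul_le_mul_of_nonneg_left h1 hr.le
      _ = η * (r * |R - s|) := by ring
      _ ≤ η * K := mul_le_mul_of_nonneg_left h2 hη
  have e2 : |c s * (r * (R - s) + D s)| ≤ C * lam := by
    rw [abs_mul]
    exact mul_le_mul (hC s hs) hRD (abs_nonneg _) hC0
  have e3 : |(c s - c t) * D s| ≤ η * K := by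
    rw [abs_mul]
    exact mul_le_mul (hc s hs t ht hst) (hbd s (hmem s hs)) (abs_nonneg _) hη
  have e4 : |c t * (D s - D t)| ≤ C * lam := by
    rw [abs_mul]
    exact mul_le_mul (hC t ht) (hosc s (hmem s hs) t (hmem t ht) hst) (abs_nonneg _) hC0
  -- Four errors: linearization of `quantile H`, inversion, variation of `c` between `s` and `t`,
  -- and oscillation of `D`.
  have key : r * (quantile m s - quantile H s) + D t * c t =
      r * (quantile H R - quantile H s - c s * (R - s)) + c s * (r * (R - s) + D s) -
        (c s - c t) * D s - c t * (D s - D t) := by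
    rw [hR]; ring
  rw [key]
  rw [abs_le] at e1 e2 e3 e4 ⊢
  constructor <;> linarith [e1.1, e1.2, e2.1, e2.2, e3.1, e3.2, e4.1, e4.2]


/-! ### The limit theorem for the quantile process. -/

theorem corollary1
    {p q ε : ℝ} (hp : 0 < p) (hpq : p < q) (hq : q < 1) (hε : 0 < ε)
    -- the base probability measure, whose distribution function has the derivative `h`
    (H : Measure ℝ) [IsProbabilityMeasure H] (h : ℝ → ℝ)
    (hderiv : ∀ x ∈ Icc (quantile H p - ε) (quantile H q + ε),
      HasDerivWithinAt (fun y => cdf H y) (h x)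
        (Icc (quantile H p - ε) (quantile H q + ε)) x)
    (hpos : ∀ x ∈ Icc (quantile H p - ε) (quantile H q + ε), 0 < h x)
    (hcont : ContinuousOn h (Icc (quantile H p) (quantile H q)))
    -- normalized inverse-Gaussian processes along any sequence of concentrations tending to `∞`
    (a : ℕ → ℝ) (ha_pos : ∀ n, 0 < a n) (ha : Tendsto a atTop atTop)
    {Ω : ℕ → Type*} [∀ n, MeasurableSpace (Ω n)]
    (μ : ∀ n, Measure (Ω n)) [∀ n, IsProbabilityMeasure (μ n)]
    (P : ∀ n, Kernel (Ω n) ℝ) [∀ n, IsMarkovKernel (P n)]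
    (hP : ∀ n, IsNIGProcess (a n) H (P n) (μ n))
    -- the standard Brownian bridge on `[0, 1]`
    {Ω' : Type*} [MeasurableSpace Ω'] (ν : Measure Ω') [IsProbabilityMeasure ν]
    (B : unitInterval → Ω' → ℝ)
    (hB : IsBrownianBridge (volume : Measure unitInterval) (fun t => Iic t) B ν)
    (hB_cont : ∀ᵐ ω ∂ν, Continuous fun t => B t ω)
    -- the limiting process
    (Q : Icc p q → Ω' → ℝ)
    (hQ : ∀ t ω, Q t ω =
      -(B (inclusion (Icc_subset_Icc hp.le hq.le) t) ω) / h (quantile H t)) :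
    ConvergesInDistributionInD
        (fun n (t : Icc p q) ω => Real.sqrt (a n) * (quantile (P n ω) t - quantile H t)) Q μ ν ∧
      IsGaussianProcess Q ν ∧
      (∀ t, ∫ ω, Q t ω ∂ν = 0) ∧
      ∀ s t : Icc p q, cov[Q s, Q t; ν] =
        (min (s : ℝ) t - (s : ℝ) * t) / (h (quantile H s) * h (quantile H t)) := by

  obtain ⟨p', q', hp'0, hp'p, hqq', hq'1, hcg, hgc, hgd, hcc⟩ :=
    exists_quantile_regular hp hpq hq hε H hderiv hpos hcont
  set g := quantile H with hgdef
  set c : ℝ → ℝ := fun t => 1 / h (g t) with hcdef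
  have hp'q' : p' < q' := by linarith
  have hsub : Icc p q ⊆ Icc p' q' := Icc_subset_Icc hp'p.le hqq'.le
  have hg : MonotoneOn g (Icc p' q') := fun u hu v hv huv =>
    quantile_mono H (by linarith [hu.1]) huv (by linarith [hv.2])
  have hHg : ∀ u ∈ Icc p' q', H.real (Iic (g u)) = u := fun u hu => by
    rw [← cdf_eq_real]; exact hcg u hu
  have hmono : StrictMonoOn (cdf H) (Icc (g p') (g q')) := fun x hx y hy hxy => by
    refine lt_of_le_of_ne (monotone_cdf H hxy.le) fun heq => ?_
    rw [← (hgc x hx).2, ← (hgc y hy).2, heq] at hxy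
    exact lt_irrefl _ hxy
  set ι : Icc p q → unitInterval := inclusion (Icc_subset_Icc hp.le hq.le) with hι
  have hιval : ∀ t, ((ι t : unitInterval) : ℝ) = t := fun t => rfl
  have hQ' : ∀ t ω, Q t ω = -c t * B (ι t) ω := fun t ω => by
    rw [hQ, hcdef]
    ring
  have hQfun : ∀ t, Q t = fun ω => -c t * B (ι t) ω := fun t => funext (hQ' t)
  refine ⟨?_, ?_, fun t => ?_, fun s t => ?_⟩
  rotate_left
  · have := IsGaussianProcess.smul (fun t : Icc p q => -c t) (hB.gaussian.comp_right ι)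
    have he : Q = fun (t : Icc p q) ω => (-c t) • (B ∘ ι) t ω := by
      funext t ω
      exact hQ' t ω
    rw [he]
    exact this
  · rw [hQfun, integral_const_mul, hB.mean, mul_zero]
  · rw [hQfun, hQfun, covariance_const_mul_left, covariance_const_mul_right,
      hB.covariance_eq_min, hιval, hιval, hcdef]
    simp only [div_eq_mul_inv, mul_inv]
    ring
  -- the modified quantile processes and the limit, as random continuous functions
  set G : ∀ n, Set (Ω n) := fun n => {ω | P n ω ∈ chargingMeasures (g p') (g q') p q} with hG
  have hGm : ∀ n, MeasurableSet (G n) := fun n =>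
    measurableSet_preimage_chargingMeasures (P n) _ _ _ _
  set X : ∀ n, Icc p q → Ω n → ℝ := fun n t ω =>
    Real.sqrt (a n) * (quantile (P n ω) t - g t) with hX
  have hgcont : ContinuousOn g (Icc p q) := fun t ht => (hgd t ht).continuousAt.continuousWithinAt
  have hXc : ∀ n, ∀ ω ∈ G n, Continuous fun t => X n t ω := fun n ω hω => by
    have h1 : ContinuousOn (fun t => Real.sqrt (a n) * (quantile (P n ω) t - g t)) (Icc p q) :=
      continuousOn_const.mul (ContinuousOn.sub (fun t ht =>
        (continuousAt_quantile_of_mem_chargingMeasures hp hq hω ht).continuousWithinAt) hgcont)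
    exact continuousOn_iff_continuous_domRestrict.1 h1
  classical
  set Y : ∀ n, Ω n → C(Icc p q, ℝ) := fun n ω =>
    if hω : ω ∈ G n then ⟨fun t => X n t ω, hXc n ω hω⟩ else 0 with hY
  have hYG : ∀ n, ∀ ω ∈ G n, ∀ t, Y n ω t = X n t ω := fun n ω hω t => by
    simp only [hY, dif_pos hω, ContinuousMap.coe_mk]
  have hYm : ∀ n t, AEMeasurable (fun ω => Y n ω t) (μ n) := fun n t => by
    have he : (fun ω => Y n ω t) = (G n).indicator (X n t) := by
      funext ω
      by_cases hω : ω ∈ G n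
      · rw [indicator_of_mem hω, hYG n ω hω]
      · rw [indicator_of_notMem hω]
        simp [hY, dif_neg hω]
    rw [he]
    exact (((measurable_quantile (P n) (by linarith [t.2.1]) (by linarith [t.2.2])).sub_const
      _).const_mul _ |>.indicator (hGm n)).aemeasurable
  have hQc : ∀ᵐ ω ∂ν, Continuous fun t => Q t ω := by
    filter_upwards [hB_cont] with ω hω
    have h1 : Continuous fun t : Icc p q => c t := continuousOn_iff_continuous_domRestrict.1 hcc
    simp_rw [hQ']
    exact h1.neg.mul (hω.comp (continuous_inclusion _))
  set W : Ω' → C(Icc p q, ℝ) := fun ω =>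
    if hω : Continuous fun t => Q t ω then ⟨fun t => Q t ω, hω⟩ else 0 with hW
  have hWQ : ∀ᵐ ω ∂ν, ∀ t, W ω t = Q t ω := by
    filter_upwards [hQc] with ω hω t
    simp only [hW, dif_pos hω, ContinuousMap.coe_mk]
  have hWm : ∀ t, AEMeasurable (fun ω => W ω t) ν := fun t => by
    have h1 : AEMeasurable (Q t) ν := by
      rw [hQfun]
      exact (hB.gaussian.aemeasurable (ι t)).const_mul _
    refine h1.congr ?_
    filter_upwards [hWQ] with ω hω
    exact (hω t).symm
  have hKr : ∀ K x : ℝ, 0 < x → ∀ᶠ n in atTop, K / Real.sqrt (a n) < x := fun K x hx => by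
    have : Tendsto (fun n => K / Real.sqrt (a n)) atTop (𝓝 0) :=
      tendsto_const_nhds.div_atTop (Real.tendsto_sqrt_atTop.comp ha)
    exact this.eventually (gt_mem_nhds hx)
  have hsqrt : ∀ n, 0 < Real.sqrt (a n) := fun n => Real.sqrt_pos.2 (ha_pos n)
  have hrat : ∀ n, μ n {ω | ¬ ∀ r s : ℚ, g p' < r → (r : ℝ) < s → (s : ℝ) < g q' →
      0 < (P n ω).real (Ioc (r : ℝ) s)} = 0 := fun n =>
    ae_iff.1 ((hP n).ae_forall_rat_measureReal_Ioc_pos (ha_pos n)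
      (by rw [hcg p' ⟨le_rfl, hp'q'.le⟩]; exact hp'0)
      (by rw [hcg q' ⟨hp'q'.le, le_rfl⟩]; exact hq'1) hmono)
  -- When the process is bounded by `K`, the mass below `g p'` stays under `p` and the mass below `g
  -- q'` stays above `q`; the condition on rational intervals holds almost surely.
  have hGsub : ∀ K n, K / Real.sqrt (a n) < p - p' → K / Real.sqrt (a n) < q' - q → (G n)ᶜ ⊆
      {ω | ¬ ∀ u ∈ Icc p' q', |Real.sqrt (a n) * ((P n ω).real (Iic (g u)) - u)| ≤ K} ∪
      {ω | ¬ ∀ r s : ℚ, g p' < r → (r : ℝ) < s → (s : ℝ) < g q' →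
        0 < (P n ω).real (Ioc (r : ℝ) s)} := fun K n h1 h2 ω hω => by
    by_contra hcon
    rw [mem_union, not_or, mem_ofPred_eq, mem_ofPred_eq, not_not, not_not] at hcon
    obtain ⟨hb, hr⟩ := hcon
    have hb' : ∀ u ∈ Icc p' q', |(P n ω).real (Iic (g u)) - u| ≤ K / Real.sqrt (a n) :=
      fun u hu => by
        have := hb u hu
        rw [abs_mul, abs_of_pos (hsqrt n)] at this
        rwa [le_div_iff₀ (hsqrt n), mul_comm]
    refine hω ⟨?_, ?_, hr⟩
    · linarith [(abs_le.1 (hb' p' ⟨le_rfl, hp'q'.le⟩)).2]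
    · linarith [(abs_le.1 (hb' q' ⟨hp'q'.le, le_rfl⟩)).1]
  have hGtend : Tendsto (fun n => μ n (G n)ᶜ) atTop (𝓝 0) := by
    refine ENNReal.tendsto_nhds_zero.2 fun e he => ?_
    obtain ⟨η, hη, hηe⟩ : ∃ η : ℝ, 0 < η ∧ ENNReal.ofReal η ≤ e := by
      obtain ⟨η, hη, hηe⟩ := ENNReal.lt_iff_exists_nnreal_btwn.1 he
      exact ⟨η, by exact_mod_cast hη, by rw [ENNReal.ofReal_coe_nnreal]; exact hηe.le⟩
    obtain ⟨K, -, hK⟩ := exists_eventually_measure_value_le ha_pos ha hP hp'0 hp'q' hq'1 hg hHg hη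
    filter_upwards [hK, hKr K (p - p') (by linarith), hKr K (q' - q) (by linarith)] with n h1 h2 h3
    refine (measure_mono (hGsub K n h2 h3)).trans ((measure_union_le _ _).trans ?_)
    rw [hrat, add_zero]
    exact h1.trans hηe
  let _ : MeasurableSpace C(Icc p q, ℝ) := borel _
  have _ : BorelSpace C(Icc p q, ℝ) := ⟨rfl⟩
  have hconv : TendstoInDistribution Y atTop W μ ν := by
    -- The approximating process is minus the rescaled distribution function times `c`, whose limits
    -- on grids are known.
    refine tendstoInDistribution_continuousMap hpq (X := fun n t ω =>
      -(Real.sqrt (a n) * ((P n ω).real (Iic (g t)) - t) * c t)) hYm (fun M => ?_) hWm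
      fun η hη => ?_
    · have hgrid : ∀ j ≤ M, imageGrid g p q M j = g (gridPoint p q M j) := fun j hj =>
        imageGrid_of_le (by omega)
      have hmem : ∀ j ≤ M, gridPoint p q M j ∈ Icc p q := fun j hj => gridPoint_mem hpq.le (by omega)
      have hHgrid : ∀ j ≤ M, H.real (Iic (imageGrid g p q M j)) = gridPoint p q M j := fun j hj => by
        rw [hgrid j hj, hHg _ (hsub (hmem j hj))]
      set τ : Fin (M + 1) → Icc p q := fun j => ⟨gridPoint p q M j, hmem j (by omega)⟩ with hτ
      have hfd := tendstoInDistribution_nig_grid ha_pos ha hP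
        (monotone_imageGrid hpq (hg.mono hsub) M) (M := M)
        (measure_gridCell_imageGrid_ne_zero hp hpq hq (hg.mono hsub)
          (fun u hu => hHg u (hsub hu)) (by omega))
        (Z := fun ω (j : Fin (M + 1)) => B (ι (τ j)) ω)
        (hB.gaussian.hasGaussianLaw_pi fun j => ι (τ j)) (fun k => hB.mean _) (fun k l => by
          rw [hHgrid k (by omega), hHgrid l (by omega)]
          exact hB.covariance_eq_min _ _)
      have hcm : Continuous fun (x : Fin (M + 1) → ℝ) j => -(x j * c (τ j)) := by fun_prop
      refine (hfd.continuous_comp hcm).congr (fun n => ae_of_all _ fun ω => ?_) ?_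
      · funext j
        simp only [Function.comp, hτ]
        rw [hHgrid j (by omega), hgrid j (by omega)]
      · filter_upwards [hWQ] with ω hω
        funext j
        simp only [Function.comp]
        rw [hω, hQ']
        ring
    · obtain ⟨C₀, hC₀⟩ := isCompact_Icc.exists_bound_of_continuousOn hcc
      set C := max C₀ 1 with hC
      have hC1 : 0 < C := by positivity
      obtain ⟨K, hK0, hK⟩ := exists_eventually_measure_value_le ha_pos ha hP hp'0 hp'q' hq'1 hg hHg
        (η := η / 3) (by positivity)
      -- The tolerances `η / (4 * C)` for the oscillation and `η / (4 * K)` for `g` and `c` turn the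
      -- bound `2 (η' K) + 2 (C lam)`, with `η' = η / (4 * K)`, into exactly `η`.
      obtain ⟨δ₁, hδ₁, hosc⟩ := exists_eventually_measure_osc_le ha_pos ha hP hp'0 hp'q' hq'1 hg hHg
        (lam := η / (4 * C)) (η := η / 3) (by positivity) (by positivity)
      obtain ⟨δ₂, hδ₂, hdiff⟩ := exists_forall_abs_sub_deriv_mul_le hpq.le hcc hgd
        (η := η / (4 * K)) (by positivity)
      obtain ⟨δ₃, hδ₃, hcu⟩ := Metric.uniformContinuousOn_iff.1
        (isCompact_Icc.uniformContinuousOn_of_continuous hcc) (η / (4 * K)) (by positivity)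
      set δ := min δ₁ (min δ₂ (δ₃ / 2)) with hδ
      have hδ0 : 0 < δ := by positivity
      have hle1 : δ ≤ δ₁ := min_le_left _ _
      have hle2 : δ ≤ δ₂ := (min_le_right _ _).trans (min_le_left _ _)
      have hle3 : δ ≤ δ₃ / 2 := (min_le_right _ _).trans (min_le_right _ _)
      refine ⟨δ, hδ0, ?_⟩
      filter_upwards [hK, hosc, hKr K (p - p') (by linarith), hKr K (q' - q) (by linarith),
        hKr K δ hδ0] with n h1 h2 h3 h4 h5
      have hη3 : ENNReal.ofReal (η / 3) + ENNReal.ofReal (η / 3) ≤ ENNReal.ofReal η := by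
        rw [← ENNReal.ofReal_add (by positivity) (by positivity)]
        exact ENNReal.ofReal_le_ofReal (by linarith)
      refine le_trans ?_ hη3
      refine le_trans ?_ (add_le_add h1 h2)
      rw [← add_zero (μ n {ω | ¬ ∀ u ∈ Icc p' q', _}), ← hrat n]
      refine le_trans (measure_mono ?_) ((measure_union_le _ _).trans
        (add_le_add (measure_union_le _ _) le_rfl))
      intro ω hω
      by_contra hcon
      rw [mem_union, not_or] at hcon
      obtain ⟨hcon1, hcon2⟩ := hcon
      have hωG : ω ∈ G n := by
        by_contra hωG
        exact hcon1 (hGsub K n h3 h4 hωG)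
      rw [mem_union, not_or, mem_ofPred_eq, not_not] at hcon1
      rw [mem_ofPred_eq, not_not] at hcon2
      refine hω fun s t hst => ?_
      rw [hYG n ω hωG, sub_neg_eq_add]
      have := abs_quantileProcess_add_le hp hp'p hpq.le hqq' hq hcg hgc (m := P n ω) (hsqrt n)
        h5.le h3 h4 (fun u hu v hv huv => hcon2 u hu v hv (huv.trans hle1)) hcon1.1 (c := c) (C := C)
        (η := η / (4 * K)) (by positivity) (fun t ht R hR => hdiff t ht R (hR.trans hle2))
        (fun t ht => (hC₀ t ht).trans (le_max_left _ _))
        (fun s hs t ht hst => (hcu s hs t ht (by rw [Real.dist_eq]; linarith)).le) s.2 t.2 hst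
      refine this.trans (le_of_eq ?_)
      field_simp
      ring
  refine ⟨fun n ω => SkorokhodSpace.ofContinuous (Y n ω),
    fun ω => SkorokhodSpace.ofContinuous (W ω), ?_, hWQ,
    hconv.continuous_comp SkorokhodSpace.continuous_ofContinuous⟩
  refine tendsto_of_tendsto_of_tendsto_of_le_of_le tendsto_const_nhds hGtend
    (fun n => zero_le) fun n => measure_mono fun ω hω hωG => hω fun t => hYG n ω hωG t
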